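/- **Definitions.** Let $k$ be a field, $n\ge 0$, and let $A=k\langle x_1,\dots,x_n\rangle$ be the free right-symmetric algebra with unit, i.e. the free unital nonassociative $k$-algebra on $x_1,\dots,x_n$ modulo the identity $(xy)z-x(yz)=(xz)y-x(zy)$. Nonassociative words in $x_1,\dots,x_n$ (including the empty word $1$, of degree $0$) are ordered by $x_1<\dots<x_n$, $u<v$ if $d(u)<d(v)$, and, for $d(u)=d(v)\ge 2$, $u=u_1u_2$, $v=v_1v_2$, by $u<v$ iff $u_1<v_1$, or $u_1=v_1$ and $u_2<v_2$. A word is good if it has no subword $(rs)t$ with $r,s,t$ nonempty and $s>t$; the good words form a basis of $A$. The leading word $\overline g$ of $0\ne g\in A$ is the greatest word with nonzero coefficient in the expansion of $g$ in good words. For $f\in A$ let $(f)$ be the two-sided ideal generated by $f$. A field is computable if its elements are coded by natural numbers in such a way that the set of codes is decidable and the field operations are computable. Elements of $A$ are given to algorithms as finite lists of pairs (coefficient, nonassociative word), a list standing for the sum of its terms. **Theorem.** Let $k$ be a field and $n\ge 0$. 1. For every $f\in A$ the ideal $(f)$ has a finite or infinite (possibly empty) $k$-basis $e_1,e_2,\dots$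 with $\overline{e_1}<\overline{e_2}<\cdots$. For every $D$ only finitely many $i$ satisfy $d(\overline{e_i})\le D$, and for every nonzero $h\in A$ one has $h\in(f)$ if and only if $h$ lies in the finite-dimensional space $\operatorname{span}_k\{e_i : d(\overline{e_i})\le d(\overline h)\}$. 2. Suppose that $k$ is computable. Then the basis in 1 is effectively enumerable: there is an algorithm that, given $f$ and $i$, outputs the $i$-th basis element together with its leading word, or reports that the basis has fewer than $i$ elements, where for every $f$ the enumerated sequence has all the properties in 1. Moreover there is an algorithm that, given $f,h\in A$, decides whether $h\in(f)$; and the word problem for right-symmetric algebras with a single defining relation is decidable: there is an algorithm that, given $f,g,h\in A$, decides whether $g$ and $h$ are equal in $A/(f)$. -/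

import Mathlib

/-! ## Nonassociative words, their order, and good words -/

/-- Nonassociative words in `x_0, …, x_{n-1}`, including the empty word `1`. -/
abbrev NAWord (n : ℕ) : Type := WithOne (FreeMagma (Fin n))

/-- The order on nonempty words: `u < v` if `d(u) < d(v)`; for equal degrees, letters are compared
by their indices and products `u₁u₂`, `v₁v₂` lexicographically. -/
def magmaLT {n : ℕ} : FreeMagma (Fin n) → FreeMagma (Fin n) → Prop
  | .of i, .of j => i < j
  | .of _, .mul _ _ => True
  | .mul _ _, .of _ => False
  | .mul u₁ u₂, .mul v₁ v₂ =>
      (FreeMagma.mul u₁ u₂).length < (FreeMagma.mul v₁ v₂).length ∨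
      ((FreeMagma.mul u₁ u₂).length = (FreeMagma.mul v₁ v₂).length ∧
        (magmaLT u₁ v₁ ∨ (u₁ = v₁ ∧ magmaLT u₂ v₂)))

/-- A nonempty word is bad if it contains a subword `(rs)t` with `s > t`. -/
inductive IsBad {n : ℕ} : FreeMagma (Fin n) → Prop
  | head (r s t : FreeMagma (Fin n)) (h : magmaLT t s) : IsBad ((r * s) * t)
  | left (u v : FreeMagma (Fin n)) (h : IsBad u) : IsBad (u * v)
  | right (u v : FreeMagma (Fin n)) (h : IsBad v) : IsBad (u * v)

namespace NAWord

/-- The degree of a word; the empty word has degree `0`. -/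
def deg {n : ℕ} (w : NAWord n) : ℕ :=
  WithOne.recOneCoe (motive := fun _ => ℕ) 0 (fun u => u.length) w

/-- The order on words; the empty word is smaller than every other word. -/
def lt {n : ℕ} (u v : NAWord n) : Prop :=
  (u = 1 ∧ v ≠ 1) ∨
    ∃ a b : FreeMagma (Fin n), u = (a : NAWord n) ∧ v = (b : NAWord n) ∧ magmaLT a b

/-- A word is good if it is not bad; the empty word is good. -/
def IsGood {n : ℕ} (w : NAWord n) : Prop :=
  ∀ u : FreeMagma (Fin n), w = (u : NAWord n) → ¬ IsBad u

end NAWord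

/-! ## Free right-symmetric algebras and one-relator right-symmetric algebras -/

/-- The congruence on the free unital nonassociative algebra that imposes
`(xy)z - x(yz) = (xz)y - x(zy)`. -/
noncomputable def rightSymmCon (k : Type*) [Field k] (n : ℕ) : RingCon (MonoidAlgebra k (NAWord n)) :=
  ringConGen fun a b => ∃ x y z : MonoidAlgebra k (NAWord n),
    a = (x * y) * z - x * (y * z) ∧ b = (x * z) * y - x * (z * y)

/-- The free right-symmetric algebra `k⟨x_0, …, x_{n-1}⟩` with unit. -/
abbrev FreeRS (k : Type*) [Field k] (n : ℕ) : Type _ := (rightSymmCon k n).Quotient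

namespace FreeRS

noncomputable instance instModule (k : Type*) [Field k] (n : ℕ) : Module k (FreeRS k n) where
  add_smul a b x := by
    refine Quotient.inductionOn' x fun y => ?_
    exact congrArg (fun t : MonoidAlgebra k (NAWord n) => (t : FreeRS k n)) (add_smul a b y)
  zero_smul x := by
    refine Quotient.inductionOn' x fun y => ?_
    exact congrArg (fun t : MonoidAlgebra k (NAWord n) => (t : FreeRS k n)) (zero_smul k y)

/-- The element of the free right-symmetric algebra that is represented by a word. -/
noncomputable def word (k : Type*) [Field k] {n : ℕ} (w : NAWord n) : FreeRS k n :=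
  ((MonoidAlgebra.single w (1 : k) : MonoidAlgebra k (NAWord n)) : FreeRS k n)

/-- The two-sided ideal `(f)`. -/
noncomputable def ideal {k : Type*} [Field k] {n : ℕ} (f : FreeRS k n) : TwoSidedIdeal (FreeRS k n) :=
  TwoSidedIdeal.span {f}

/-- The right-symmetric algebra with generators `x_0, …, x_{n-1}` and single relation `f = 0`. -/
abbrev OneRelator {k : Type*} [Field k] {n : ℕ} (f : FreeRS k n) : Type _ :=
  (ideal f).ringCon.Quotient

/-- `w` is the leading word of `g`: in an expansion of `g` in good words, `w` is the greatest word
with nonzero coefficient. -/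
def IsLeadingWord {k : Type*} [Field k] {n : ℕ} (g : FreeRS k n) (w : NAWord n) : Prop :=
  ∃ c : NAWord n →₀ k,
    (∀ v ∈ c.support, v.IsGood) ∧ (c.sum fun v a => a • word k v) = g ∧
    w ∈ c.support ∧ ∀ v ∈ c.support, v = w ∨ v.lt w

/-- `e` lists the elements of a `k`-basis of `(f)` together with their leading words, which strictly
increase. The list may be finite: `e i = none` means that it has fewer than `i + 1` entries.
Membership of `h` in `(f)` is membership in the span of the finitely many listed elements whose
degree is at most that of `h`. -/
structure IsLeadingBasis {k : Type*} [Field k] {n : ℕ} (f : FreeRS k n)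
    (e : ℕ → Option (FreeRS k n × NAWord n)) : Prop where
  initial : ∀ i j, i ≤ j → (e j).isSome → (e i).isSome
  linearIndependent :
    LinearIndependent k fun i : {i : ℕ // (e i).isSome} => ((e i).get i.2).1
  span_eq : (Submodule.span k {g | ∃ i w, e i = some (g, w)} : Set (FreeRS k n)) = ideal f
  leading : ∀ i g w, e i = some (g, w) → IsLeadingWord g w
  increasing : ∀ i j g h u v, i < j → e i = some (g, u) → e j = some (h, v) → u.lt v
  finite_deg_le : ∀ D : ℕ, {i | ∃ g w, e i = some (g, w) ∧ w.deg ≤ D}.Finite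
  mem_iff : ∀ (h : FreeRS k n) (v : NAWord n), IsLeadingWord h v →
    (h ∈ ideal f ↔ h ∈ Submodule.span k {g | ∃ i w, e i = some (g, w) ∧ w.deg ≤ v.deg})

end FreeRS

/-! ## Effective presentation of words and elements -/

/-- Code numbers of nonempty words. -/
def magmaEncode {n : ℕ} : FreeMagma (Fin n) → ℕ
  | .of i => 2 * (i : ℕ)
  | .mul u v => 2 * Nat.pair (magmaEncode u) (magmaEncode v) + 1

/-- The word with a given code number, if there is one. -/
def magmaDecode (n : ℕ) (m : ℕ) : Option (FreeMagma (Fin n)) :=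
  if m % 2 = 0 then
    if h : m / 2 < n then some (.of ⟨m / 2, h⟩) else none
  else if m = 0 then none
  else
    (magmaDecode n (Nat.unpair (m / 2)).1).bind fun u =>
      (magmaDecode n (Nat.unpair (m / 2)).2).map fun v => .mul u v
termination_by m
decreasing_by
  · have := Nat.unpair_left_le (m / 2); omega
  · have := Nat.unpair_right_le (m / 2); omega

theorem magmaDecode_encode {n : ℕ} (w : FreeMagma (Fin n)) :
    magmaDecode n (magmaEncode w) = some w := by
  induction w with
  | ih1 i =>
    rw [magmaDecode]
    simp [magmaEncode]
  | ih2 u v hu hv =>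
    change magmaDecode n (2 * Nat.pair (magmaEncode u) (magmaEncode v) + 1) = some (.mul u v)
    rw [magmaDecode]
    have h1 : (2 * Nat.pair (magmaEncode u) (magmaEncode v) + 1) % 2 ≠ 0 := by omega
    have h2 : (2 * Nat.pair (magmaEncode u) (magmaEncode v) + 1) / 2 =
        Nat.pair (magmaEncode u) (magmaEncode v) := by omega
    simp only [h2, Nat.unpair_pair, hu, hv]
    simp

theorem magmaEncode_of_decode {n : ℕ} : ∀ (m : ℕ) (w : FreeMagma (Fin n)),
    magmaDecode n m = some w → magmaEncode w = m := by
  intro m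
  induction m using Nat.strong_induction_on with
  | _ m ih =>
    intro w hw
    rw [magmaDecode] at hw
    split_ifs at hw with h1 h2 h3
    · obtain rfl := Option.some.inj hw
      simp only [magmaEncode]
      omega
    · obtain ⟨u, hu, hw⟩ := Option.bind_eq_some_iff.1 hw
      obtain ⟨v, hv, rfl⟩ := Option.map_eq_some_iff.1 hw
      have l1 := Nat.unpair_left_le (m / 2)
      have l2 := Nat.unpair_right_le (m / 2)
      simp only [magmaEncode]
      rw [ih _ (by omega) u hu, ih _ (by omega) v hv, Nat.pair_unpair]
      omega

instance magmaEncodable (n : ℕ) : Encodable (FreeMagma (Fin n)) where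
  encode := magmaEncode
  decode := magmaDecode n
  encodek := magmaDecode_encode

theorem primrec_magmaDecode_isSome (n : ℕ) : Primrec fun m => (magmaDecode n m).isSome := by
  let g : ℕ → List Bool → Option Bool := fun _ l =>
    some (bif l.length % 2 == 0 then decide (l.length / 2 < n)
      else ((l[(Nat.unpair (l.length / 2)).1]?).getD false &&
        (l[(Nat.unpair (l.length / 2)).2]?).getD false))
  have hlen : Primrec fun p : ℕ × List Bool => p.2.length := Primrec.list_length.comp Primrec.snd
  have hhalf : Primrec fun p : ℕ × List Bool => p.2.length / 2 :=
    Primrec.nat_div.comp hlen (Primrec.const 2)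
  have hun := Primrec.unpair.comp hhalf
  have hg : Primrec₂ g := by
    refine Primrec.option_some.comp (Primrec.cond ?_ ?_ ?_)
    · exact Primrec.beq.comp (Primrec.nat_mod.comp hlen (Primrec.const 2)) (Primrec.const 0)
    · exact (Primrec.nat_lt.comp hhalf (Primrec.const n)).decide
    · refine Primrec.and.comp ?_ ?_
      · exact Primrec.option_getD.comp
          (Primrec.list_getElem?.comp Primrec.snd (Primrec.fst.comp hun)) (Primrec.const false)
      · exact Primrec.option_getD.comp
          (Primrec.list_getElem?.comp Primrec.snd (Primrec.snd.comp hun)) (Primrec.const false)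
  have key : Primrec₂ fun (_ : ℕ) (m : ℕ) => (magmaDecode n m).isSome := by
    refine Primrec.nat_strong_rec _ hg fun a m => ?_
    simp only [g, List.length_map, List.length_range]
    congr 1
    conv_rhs => rw [magmaDecode]
    by_cases h : m % 2 = 0
    · by_cases h2 : m / 2 < n <;> simp [h, h2]
    · have hm : m ≠ 0 := by rintro rfl; simp at h
      have l1 : (Nat.unpair (m / 2)).1 < m := by
        have := Nat.unpair_left_le (m / 2); omega
      have l2 : (Nat.unpair (m / 2)).2 < m := by
        have := Nat.unpair_right_le (m / 2); omega
      have hb : (m % 2 == 0) = false := by simpa using h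
      simp only [hb, cond_false, h, if_false, hm, List.getElem?_map, List.getElem?_range l1,
        List.getElem?_range l2, Option.map_some, Option.getD_some]
      cases magmaDecode n (Nat.unpair (m / 2)).1 <;>
        cases magmaDecode n (Nat.unpair (m / 2)).2 <;> rfl
  exact key.comp (Primrec.const 0) Primrec.id

instance magmaPrimcodable (n : ℕ) : Primcodable (FreeMagma (Fin n)) where
  prim := by
    refine Primrec.nat_iff.1 ?_
    refine (Primrec.cond (primrec_magmaDecode_isSome n) Primrec.succ (Primrec.const 0)).of_eq ?_
    intro m
    change _ = Encodable.encode (magmaDecode n m)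
    cases h : magmaDecode n m with
    | none => rfl
    | some w =>
      have := magmaEncode_of_decode m w h
      change m + 1 = magmaEncode w + 1
      rw [this]

instance wordPrimcodable (n : ℕ) : Primcodable (NAWord n) :=
  inferInstanceAs (Primcodable (Option (FreeMagma (Fin n))))

/-- A field whose elements are coded by natural numbers is computable if its operations are. -/
structure IsComputableField (k : Type*) [Field k] [Primcodable k] : Prop where
  add : Computable₂ fun a b : k => a + b
  mul : Computable₂ fun a b : k => a * b
  neg : Computable fun a : k => -a
  inv : Computable fun a : k => a⁻¹

/-- Finite presentations of elements of the free right-symmetric algebra: finite lists of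
coefficients and (arbitrary, possibly bad or repeated) nonassociative words. -/
abbrev RSExpr (k : Type*) (n : ℕ) : Type _ := List (k × NAWord n)

/-- The element presented by a list: the sum of its terms. -/
noncomputable def RSExpr.eval {k : Type*} [Field k] {n : ℕ} (l : RSExpr k n) : FreeRS k n :=
  (l.map fun p => p.1 • FreeRS.word k p.2).sum

/-! A nonempty good word is a rooted tree: its first letter is the root, and its right factors,
written in nondecreasing order, are the subtrees at the root. Attaching a subtree at the root is the
operation `ins`, written u∘v here. It satisfies (u∘v)∘w = (u∘w)∘v, so the good words form a NAP
magma. On good words it is strictly monotone in both arguments, and u∘(v∘w) < (u∘v)∘w. Hence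
rewriting (xy)z as (xz)y + x(yz) - x(zy) changes a product of good words only by smaller terms, and
the leading word of a product is the ∘-product of the leading words (`gw_mul_gw`). In particular the
good words span. They are independent because grafting at all vertices of a tree is a
right-symmetric product whose leading term is again ∘ (`graft_right_symm`, `value_sub_mem`,
`linearIndependent_word`).

Let f be monic with leading word w ≠ 1. The ideal (f) is spanned by the iterated products of f with
good words, and the leading word of such a product arises from w by the same multiplications. Two
such products with the same leading word differ by a combination of products with smaller leading
words (`IdealExpr.sub_mem_exprLow`), so no S-polynomial contributes anything new. There are two
essential overlaps (`mulList_sub_gw_mul`, `gw_mul_sub_gw_mul`); in both of them the two products are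
compared through products in which f occurs twice. Therefore one product for each multiple of w
gives a basis, and the leading words of (f) are exactly the multiples of w in the NAP magma
(`leadSet_eq_redSet`). The first part follows by division with remainder.

For the algorithms, multiples of w are recognised by recursion on trees (`redB_iff`). Everything
else is found by unbounded search. Congruence modulo (f) is witnessed by an explicit combination in
the free nonassociative algebra, which is checked by comparing coefficients (`sub_mem_ideal_iff`).
The search for a certified remainder of h whose leading word is not a multiple of w always ends, and
h lies in (f) exactly if this remainder is zero. The end of the basis is recognised because, for f ≠
0 and at least one letter, there are infinitely many leading words (`exists_leadCount_eq_iff`). -/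

/-! ## Ranks of words and the linear order they induce -/

namespace RSWord

variable {n : ℕ}

/-- A strict bound for the ranks of words of length at most `d + 1`. -/
def rankBound (n : ℕ) : ℕ → ℕ
  | 0 => n
  | d + 1 => rankBound n d + rankBound n d * rankBound n d

/-- A strictly monotone numbering of the nonempty words. -/
def rank : FreeMagma (Fin n) → ℕ
  | .of i => i
  | .mul a b => rankBound n (a.length + b.length - 2) +
      (rank a * rankBound n (a.length + b.length - 2) + rank b)

theorem rankBound_mono : Monotone (rankBound n) :=
  monotone_nat_of_le_succ fun d => by simp [rankBound]

theorem rank_mul (a b : FreeMagma (Fin n)) :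
    rank (a * b) = rankBound n (a.length + b.length - 2) +
      (rank a * rankBound n (a.length + b.length - 2) + rank b) := rfl

theorem length_mul (a b : FreeMagma (Fin n)) : (a * b).length = a.length + b.length := rfl

/-- With `B` the bound for shorter words, a product has rank `B + (x * B + y)` with digits `x, y <
B`, which is less than `B + B * B`. -/
theorem rank_lt_rankBound (u : FreeMagma (Fin n)) : ∀ d, u.length ≤ d + 1 → rank u < rankBound n d := by
  induction u using FreeMagma.recOnMul with
  | ih1 i => exact fun d _ => (show (i : ℕ) < rankBound n 0 from i.2).trans_le (rankBound_mono d.zero_le)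
  | ih2 a b ha hb =>
    intro d hd
    have la := a.length_pos
    have lb := b.length_pos
    rw [length_mul] at hd
    obtain ⟨e, rfl⟩ : ∃ e, d = e + 1 := ⟨d - 1, by omega⟩
    refine lt_of_lt_of_le ?_ (rankBound_mono (show a.length + b.length - 2 + 1 ≤ e + 1 by omega))
    have h1 := ha (a.length + b.length - 2) (by omega)
    have h2 := hb (a.length + b.length - 2) (by omega)
    rw [rank_mul, rankBound]
    nlinarith

/-- The offset `rankBound` in the rank of a product exceeds the ranks of all shorter words. -/
theorem rank_lt_of_length_lt {u v : FreeMagma (Fin n)} (h : u.length < v.length) :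
    rank u < rank v := by
  induction v using FreeMagma.recOnMul with
  | ih1 i => have := u.length_pos; simp at h; omega
  | ih2 a b _ _ =>
    rw [length_mul] at h
    have := u.length_pos
    have h1 := rank_lt_rankBound u (a.length + b.length - 2) (by omega)
    rw [rank_mul]
    omega

/-- The ranks of the factors are the digits of a two-digit number, so numerical comparison is
lexicographic. -/
theorem rank_mul_lt {a b c d : FreeMagma (Fin n)} (h : (a * b).length = (c * d).length) :
    rank (a * b) < rank (c * d) ↔ rank a < rank c ∨ (rank a = rank c ∧ rank b < rank d) := by
  rw [length_mul, length_mul] at h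
  have := a.length_pos
  have := b.length_pos
  have := c.length_pos
  have := d.length_pos
  have h2 := rank_lt_rankBound b (a.length + b.length - 2) (by omega)
  have h3 := rank_lt_rankBound d (a.length + b.length - 2) (by omega)
  rw [rank_mul, rank_mul, ← h]
  generalize rankBound n (a.length + b.length - 2) = N at *
  rcases lt_trichotomy (rank a) (rank c) with h4 | h4 | h4
  · simp only [h4, true_or, iff_true]; nlinarith
  · simp [h4]
  · have : ¬ rank a < rank c := by omega
    have h5 : rank a ≠ rank c := by omega
    simp only [this, h5, false_and, or_self, iff_false]
    nlinarith

theorem rank_injective : Function.Injective (rank (n := n)) := by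
  intro u
  induction u using FreeMagma.recOnMul with
  | ih1 i =>
    intro v h
    have hl : v.length = 1 := by
      by_contra h1
      have := v.length_pos
      exact absurd h (rank_lt_of_length_lt (by simp; omega)).ne
    cases v with
    | of j => rw [Fin.ext h]
    | mul a b => have := a.length_pos; have := b.length_pos; simp at hl; omega
  | ih2 a b ha hb =>
    intro v h
    have hl : (a * b).length = v.length := by
      rcases lt_trichotomy (a * b).length v.length with h1 | h1 | h1
      · exact absurd h (rank_lt_of_length_lt h1).ne
      · exact h1
      · exact absurd h (rank_lt_of_length_lt h1).ne'
    cases v with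
    | of j => have := a.length_pos; have := b.length_pos; rw [length_mul] at hl; simp at hl; omega
    | mul c d =>
      change rank (a * b) = rank (c * d) at h
      have h1 := (rank_mul_lt hl).not.1 h.not_lt
      have h2 := (rank_mul_lt hl.symm).not.1 h.symm.not_lt
      rw [@ha c (by omega), @hb d (by omega)]
      rfl

instance instLinearOrder : LinearOrder (FreeMagma (Fin n)) := LinearOrder.lift' rank rank_injective

theorem lt_iff_rank {u v : FreeMagma (Fin n)} : u < v ↔ rank u < rank v := Iff.rfl

theorem lt_of_length_lt {u v : FreeMagma (Fin n)} (h : u.length < v.length) : u < v :=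
  rank_lt_of_length_lt h

theorem length_le_of_le {u v : FreeMagma (Fin n)} (h : u ≤ v) : u.length ≤ v.length :=
  not_lt.1 fun h1 => (lt_of_length_lt h1).not_ge h

theorem mul_lt_mul_iff {a b c d : FreeMagma (Fin n)} (h : a.length + b.length = c.length + d.length) :
    a * b < c * d ↔ a < c ∨ (a = c ∧ b < d) := by
  rw [lt_iff_rank, rank_mul_lt h, rank_injective.eq_iff]
  rfl

theorem magmaLT_iff (u v : FreeMagma (Fin n)) : magmaLT u v ↔ u < v := by
  induction u generalizing v with
  | ih1 i =>
    cases v with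
    | of j => exact Iff.rfl
    | mul c d =>
      refine iff_of_true trivial (lt_of_length_lt ?_)
      have := c.length_pos; have := d.length_pos
      simp only [FreeMagma.length]; omega
  | ih2 a b ha hb =>
    cases v with
    | of j =>
      refine iff_of_false id (lt_of_length_lt ?_).not_gt
      have := a.length_pos; have := b.length_pos
      simp only [FreeMagma.length]; omega
    | mul c d =>
      change (_ ∨ (_ ∧ (magmaLT a c ∨ (a = c ∧ magmaLT b d)))) ↔ a * b < c * d
      rw [ha, hb]
      constructor
      · rintro (h | ⟨h, h1⟩)
        · exact lt_of_length_lt h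
        · exact (mul_lt_mul_iff h).2 h1
      · intro h
        rcases (length_le_of_le h.le).lt_or_eq with h1 | h1
        · exact Or.inl h1
        · exact Or.inr ⟨h1, (mul_lt_mul_iff h1).1 h⟩

/-! ## Sorted insertion -/

/-- Insertion of `v` among the right factors of `u`, past those that are greater than `v`. -/
def ins : FreeMagma (Fin n) → FreeMagma (Fin n) → FreeMagma (Fin n)
  | .of i, v => .of i * v
  | .mul a b, v => if v < b then ins a v * b else a * b * v

theorem ins_of (i : Fin n) (v : FreeMagma (Fin n)) : ins (.of i) v = .of i * v := rfl

theorem ins_mul (a b v : FreeMagma (Fin n)) :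
    ins (a * b) v = if v < b then ins a v * b else a * b * v := rfl

theorem ins_mul_of_lt {b v : FreeMagma (Fin n)} (a : FreeMagma (Fin n)) (h : v < b) :
    ins (a * b) v = ins a v * b := by rw [ins_mul, if_pos h]

theorem ins_mul_of_le {b v : FreeMagma (Fin n)} (a : FreeMagma (Fin n)) (h : b ≤ v) :
    ins (a * b) v = a * b * v := by rw [ins_mul, if_neg h.not_gt]

theorem length_ins (u v : FreeMagma (Fin n)) : (ins u v).length = u.length + v.length := by
  induction u with
  | ih1 i => rfl
  | ih2 a b ha _ =>
    rw [ins_mul]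
    split_ifs
    · rw [length_mul, ha]; simp only [length_mul]; omega
    · rfl

/-- An inserted word stops at the last factor that does not exceed it. The smaller of `v` and `w`
passes the larger one, and the larger one never goes beyond the place where the smaller one stops.
Goodness of `u` plays no role. -/
theorem ins_right_comm (u v w : FreeMagma (Fin n)) : ins (ins u v) w = ins (ins u w) v := by
  wlog hvw : v ≤ w generalizing v w
  · exact (this w v (not_le.1 hvw).le).symm
  rcases hvw.eq_or_lt with rfl | hvw
  · rfl
  induction u with
  | ih1 i => rw [ins_of, ins_of, ins_mul_of_lt _ hvw, ins_mul_of_le _ hvw.le, ins_of]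
  | ih2 a b ha _ =>
    rcases lt_or_ge w b with h | h
    · rw [ins_mul_of_lt _ h, ins_mul_of_lt _ (hvw.trans h), ins_mul_of_lt _ h,
        ins_mul_of_lt _ (hvw.trans h), ha]
    · rw [ins_mul_of_le _ h, ins_mul_of_lt _ hvw]
      rcases lt_or_ge v b with h1 | h1
      · rw [ins_mul_of_lt _ h1, ins_mul_of_le _ h]
      · rw [ins_mul_of_le _ h1, ins_mul_of_le _ hvw.le]

/-- A bad subword lies in one of the factors or is the whole product; in the latter case sorted
insertion moves `v`. Goodness thus becomes a recursive condition. -/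
theorem isBad_mul_iff {u v : FreeMagma (Fin n)} :
    IsBad (u * v) ↔ IsBad u ∨ IsBad v ∨ ins u v ≠ u * v := by
  have key : ins u v ≠ u * v ↔ ∃ r s, u = r * s ∧ v < s := by
    cases u with
    | of i => simp only [ins_of, ne_eq, not_true_eq_false, false_iff]; rintro ⟨r, s, h, -⟩; cases h
    | mul a b =>
      change ins (a * b) v ≠ a * b * v ↔ ∃ r s, a * b = r * s ∧ v < s
      constructor
      · intro h
        exact ⟨a, b, rfl, by_contra fun h1 => h (ins_mul_of_le _ (not_lt.1 h1))⟩
      · rintro ⟨r, s, h, h1⟩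
        obtain ⟨rfl, rfl⟩ : a = r ∧ b = s := by cases h; exact ⟨rfl, rfl⟩
        rw [ins_mul_of_lt _ h1]
        intro h2
        injection h2 with _ h2
        exact h1.ne' h2
  constructor
  · intro h
    generalize hx : u * v = x at h
    cases h with
    | head r s t h =>
      cases hx
      exact Or.inr (Or.inr (key.2 ⟨r, s, rfl, (magmaLT_iff _ _).1 h⟩))
    | left u v h => cases hx; exact Or.inl h
    | right u v h => cases hx; exact Or.inr (Or.inl h)
  · rintro (h | h | h)
    · exact .left _ _ h
    · exact .right _ _ h
    · obtain ⟨r, s, rfl, h1⟩ := key.1 h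
      exact .head _ _ _ ((magmaLT_iff _ _).2 h1)

theorem not_isBad_of (i : Fin n) : ¬ IsBad (FreeMagma.of i) := by
  intro h
  generalize hx : FreeMagma.of i = x at h
  cases h <;> cases hx

theorem good_mul_iff {u v : FreeMagma (Fin n)} :
    ¬ IsBad (u * v) ↔ ¬ IsBad u ∧ ¬ IsBad v ∧ ins u v = u * v := by
  rw [isBad_mul_iff]; tauto

theorem good_ins {u v : FreeMagma (Fin n)} (hu : ¬ IsBad u) (hv : ¬ IsBad v) :
    ¬ IsBad (ins u v) := by
  induction u with
  | ih1 i => exact good_mul_iff.2 ⟨hu, hv, rfl⟩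
  | ih2 a b ha _ =>
    obtain ⟨h1, h2, h3⟩ := good_mul_iff.1 hu
    rcases lt_or_ge v b with h | h
    · rw [ins_mul_of_lt _ h]
      refine good_mul_iff.2 ⟨ha h1, h2, ?_⟩
      -- After commuting the insertions, `v` is inserted into `ins a b = a * b`, where it passes
      -- `b`.
      rw [ins_right_comm, h3, ins_mul_of_lt _ h]
    · rw [ins_mul_of_le _ h]
      exact good_mul_iff.2 ⟨hu, hv, ins_mul_of_le _ h⟩

/-! ## Monotonicity of sorted insertion on good words -/

/-- Goodness enters where `v < b ≤ v'`: there the left factor `a * b` equals `ins a b`, and `ins a v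
< ins a b` by induction. -/
theorem ins_lt_ins_left {u v v' : FreeMagma (Fin n)} (hu : ¬ IsBad u) (h : v < v') :
    ins u v < ins u v' := by
  induction u generalizing v v' with
  | ih1 i =>
    rcases (length_le_of_le h.le).lt_or_eq with hl | hl
    · exact lt_of_length_lt (by rw [length_ins, length_ins]; omega)
    · exact (mul_lt_mul_iff (by omega)).2 (Or.inr ⟨rfl, h⟩)
  | ih2 a b ha _ =>
    rcases (length_le_of_le h.le).lt_or_eq with hl | hl
    · exact lt_of_length_lt (by rw [length_ins, length_ins]; omega)
    obtain ⟨h1, -, h3⟩ := good_mul_iff.1 hu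
    rcases lt_or_ge v' b with h4 | h4
    · rw [ins_mul_of_lt _ h4, ins_mul_of_lt _ (h.trans h4), mul_lt_mul_iff (by simp [length_ins, hl])]
      exact Or.inl (ha h1 h)
    · rw [ins_mul_of_le _ h4]
      rcases lt_or_ge v b with h5 | h5
      · rw [ins_mul_of_lt _ h5, mul_lt_mul_iff (by simp only [length_ins, length_mul]; omega), ← h3]
        exact Or.inl (ha h1 h5)
      · rw [ins_mul_of_le _ h5, mul_lt_mul_iff (by omega)]
        exact Or.inr ⟨rfl, h⟩

theorem ins_le_ins_left {u v v' : FreeMagma (Fin n)} (hu : ¬ IsBad u) (h : v ≤ v') :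
    ins u v ≤ ins u v' := by
  rcases h.eq_or_lt with rfl | h
  · rfl
  · exact (ins_lt_ins_left hu h).le

theorem exists_ins_eq_mul (u v : FreeMagma (Fin n)) : ∃ p q, ins u v = p * q ∧ v ≤ q := by
  induction u with
  | ih1 i => exact ⟨_, _, rfl, le_rfl⟩
  | ih2 a b _ _ =>
    rcases lt_or_ge v b with h | h
    · exact ⟨_, _, ins_mul_of_lt _ h, h.le⟩
    · exact ⟨_, _, ins_mul_of_le _ h, le_rfl⟩

theorem mul_lt_mul_of_length_lt {a b c d : FreeMagma (Fin n)}
    (h : a.length + b.length = c.length + d.length) (h1 : a.length < c.length) :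
    a * b < c * d :=
  (mul_lt_mul_iff h).2 (Or.inl (lt_of_length_lt h1))

/-- The last factor of `ins a v` is at least `v`, hence longer than `d`. Of two products of equal
length, the one with the longer last factor has the shorter left factor and is smaller. -/
theorem ins_lt_mul_of_length_lt {a v c d : FreeMagma (Fin n)}
    (h : a.length + v.length = c.length + d.length) (h1 : d.length < v.length) :
    ins a v < c * d := by
  obtain ⟨p, q, hpq, hq⟩ := exists_ins_eq_mul a v
  have h2 := length_le_of_le hq
  have h3 := congrArg FreeMagma.length hpq
  rw [length_ins, length_mul] at h3
  rw [hpq]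
  exact mul_lt_mul_of_length_lt (by omega) (by omega)

/-- The mixed case of monotonicity in the left argument, where `v` moves into one word and stays at
the end of the other, and where lengths alone do not decide. -/
theorem ins_lt_mul {a a' b v : FreeMagma (Fin n)} (hb : ¬ IsBad (a' * b)) (h : a < a')
    (hv : b ≤ v) (hl : v.length = b.length) : ins a v < a' * b := by
  induction a generalizing a' b with
  | ih1 i =>
    rcases (length_le_of_le h.le).lt_or_eq with h1 | h1
    · exact lt_of_length_lt (by rw [length_ins, length_mul]; omega)
    · exact (mul_lt_mul_iff (by omega)).2 (Or.inl h)
  | ih2 c d hc _ =>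
    rcases (length_le_of_le h.le).lt_or_eq with h1 | h1
    · exact lt_of_length_lt (by rw [length_ins, length_mul a']; omega)
    rcases lt_or_ge v d with h2 | h2
    swap
    · rw [ins_mul_of_le _ h2]
      exact (mul_lt_mul_iff (by omega)).2 (Or.inl h)
    rw [ins_mul_of_lt _ h2]
    have h3 := length_le_of_le h2.le
    rw [length_mul] at h1
    rw [mul_lt_mul_iff (by rw [length_ins]; omega)]
    refine Or.inl ?_
    rcases h3.lt_or_eq with h3 | h3
    · exact lt_of_length_lt (by rw [length_ins]; omega)
    cases a' with
    | of j => have := c.length_pos; have := d.length_pos; simp at h1; omega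
    | mul c' d' =>
      change c * d < c' * d' at h
      change _ = (c' * d').length at h1
      change ¬ IsBad (c' * d' * b) at hb
      change ins c v < c' * d'
      obtain ⟨h4, -, h5⟩ := good_mul_iff.1 hb
      -- The factors of the good word `c' * d' * b` are in nondecreasing order.
      have h6 : d' ≤ b := by
        by_contra h6
        rw [ins_mul_of_lt _ (not_le.1 h6)] at h5
        injection h5 with _ h5
        exact h6 h5.le
      rw [length_mul] at h1
      rcases (mul_lt_mul_iff h1).1 h with h7 | ⟨-, h7⟩
      · rcases (length_le_of_le (h6.trans hv)).lt_or_eq with h8 | h8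
        · exact ins_lt_mul_of_length_lt (by omega) h8
        · exact hc h4 h7 (h6.trans hv) h8.symm
      · exact absurd (h6.trans hv) (h2.trans h7).not_ge

/-- The cases are whether `v` passes the last factor of `u` and that of `u'`. In the mixed cases,
`ins a v` is compared with `a' * b'`, or `a * b = ins a b` with `ins a' v`. -/
theorem ins_lt_ins_right {u u' : FreeMagma (Fin n)} (hu : ¬ IsBad u) (hu' : ¬ IsBad u')
    (v : FreeMagma (Fin n)) (h : u < u') : ins u v < ins u' v := by
  induction u generalizing u' with
  | ih1 i =>
    rcases (length_le_of_le h.le).lt_or_eq with hl | hl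
    · exact lt_of_length_lt (by rw [length_ins, length_ins]; omega)
    cases u' with
    | of j =>
      rw [ins_of, ins_of]
      exact (mul_lt_mul_iff (by simp)).2 (Or.inl h)
    | mul c d => have := c.length_pos; have := d.length_pos; simp at hl; omega
  | ih2 a b ha _ =>
    rcases (length_le_of_le h.le).lt_or_eq with hl | hl
    · exact lt_of_length_lt (by rw [length_ins, length_ins]; omega)
    cases u' with
    | of j =>
      have := a.length_pos; have := b.length_pos
      simp at hl; omega
    | mul a' b' =>
      change a * b < a' * b' at h
      change ins (a * b) v < ins (a' * b') v
      change (a * b).length = (a' * b').length at hl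
      change ¬ IsBad (a' * b') at hu'
      obtain ⟨h1, -, h3⟩ := good_mul_iff.1 hu
      obtain ⟨h1', -, h3'⟩ := good_mul_iff.1 hu'
      rw [length_mul, length_mul] at hl
      have hc := (mul_lt_mul_iff hl).1 h
      have hlb : b'.length ≤ b.length := by
        rcases hc with hc | ⟨rfl, hc⟩
        · have := length_le_of_le hc.le; omega
        · omega
      rcases lt_or_ge v b with h4 | h4 <;> rcases lt_or_ge v b' with h5 | h5
      · rw [ins_mul_of_lt _ h4, ins_mul_of_lt _ h5, mul_lt_mul_iff (by simp only [length_ins]; omega)]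
        rcases hc with hc | ⟨rfl, hc⟩
        · exact Or.inl (ha h1 h1' hc)
        · exact Or.inr ⟨rfl, hc⟩
      · have h6 := length_le_of_le h4.le
        have h7 := length_le_of_le h5
        rw [ins_mul_of_lt _ h4, ins_mul_of_le _ h5,
          mul_lt_mul_iff (by simp only [length_ins, length_mul]; omega)]
        refine Or.inl ?_
        rcases hc with hc | ⟨rfl, hc⟩
        · rcases h6.lt_or_eq with h6 | h6
          · exact lt_of_length_lt (by rw [length_ins, length_mul]; omega)
          · rcases h7.lt_or_eq with h7 | h7
            · exact ins_lt_mul_of_length_lt (by omega) h7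
            · exact ins_lt_mul hu' hc h5 h7.symm
        · exact absurd (hc.trans_le h5) h4.not_gt
      · have h6 := length_le_of_le h4
        have h7 := length_le_of_le h5.le
        rw [ins_mul_of_le _ h4, ins_mul_of_lt _ h5,
          mul_lt_mul_iff (by simp only [length_ins, length_mul]; omega), ← h3]
        rcases hc with hc | ⟨rfl, hc⟩
        · exact Or.inl ((ins_le_ins_left h1 h4).trans_lt (ha h1 h1' hc))
        · rcases (ins_le_ins_left h1 h4).lt_or_eq with h8 | h8
          · exact Or.inl h8
          · exact Or.inr ⟨h8, h5⟩
      · rw [ins_mul_of_le _ h4, ins_mul_of_le _ h5, mul_lt_mul_iff (by simp only [length_mul]; omega)]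
        exact Or.inl h

/-- The factor `ins v w` is longer than `v` and `w`, and a longer last factor makes a word of given
length smaller. This is why the terms `x(yz)` and `x(zy)` of the right-symmetric identity are
negligible. -/
theorem ins_ins_lt {u : FreeMagma (Fin n)} (hu : ¬ IsBad u) (v w : FreeMagma (Fin n)) :
    ins u (ins v w) < ins (ins u v) w := by
  have hlv := v.length_pos
  have hlw := w.length_pos
  have hlq := length_ins v w
  induction u with
  | ih1 i =>
    rw [ins_of, ins_of]
    rcases lt_or_ge w v with h | h
    · rw [ins_mul_of_lt _ h]
      exact mul_lt_mul_of_length_lt (by simp only [length_ins]; omega) (by simp [length_ins, hlw])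
    · rw [ins_mul_of_le _ h]
      exact mul_lt_mul_of_length_lt (by simp only [length_ins, length_mul]; omega)
        (by simp [hlv])
  | ih2 a b ha _ =>
    obtain ⟨h1, -, h3⟩ := good_mul_iff.1 hu
    have hla := a.length_pos
    have hlb := b.length_pos
    have hvq : v < ins v w := lt_of_length_lt (by omega)
    have hwq : w < ins v w := lt_of_length_lt (by omega)
    rcases lt_or_ge (ins v w) b with h | h
    · rw [ins_mul_of_lt _ h, ins_mul_of_lt _ (hvq.trans h), ins_mul_of_lt _ (hwq.trans h),
        mul_lt_mul_iff (by simp only [length_ins]; omega)]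
      exact Or.inl (ha h1)
    rw [ins_mul_of_le _ h]
    rcases lt_or_ge v b with hvb | hvb
    · rw [ins_mul_of_lt _ hvb]
      rcases lt_or_ge w b with hwb | hwb
      · rw [ins_mul_of_lt _ hwb, mul_lt_mul_iff (by simp only [length_ins, length_mul]; omega), ← h3]
        exact Or.inl ((ins_le_ins_left h1 h).trans_lt (ha h1))
      · rw [ins_mul_of_le _ hwb]
        exact mul_lt_mul_of_length_lt (by simp only [length_ins, length_mul]; omega)
          (by simp only [length_ins, length_mul]; omega)
    · rw [ins_mul_of_le _ hvb]
      rcases lt_or_ge w v with hwv | hwv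
      · rw [ins_mul_of_lt _ hwv]
        exact mul_lt_mul_of_length_lt (by simp only [length_ins, length_mul]; omega)
          (by simp only [length_ins, length_mul]; omega)
      · rw [ins_mul_of_le _ hwv]
        exact mul_lt_mul_of_length_lt (by simp only [length_ins, length_mul]; omega)
          (by simp only [length_mul]; omega)

end RSWord

namespace RSWord

variable {n : ℕ}

/-! ## The free NAP magma of good words -/

/-- The first letter of a word. -/
def head : FreeMagma (Fin n) → Fin n
  | .of i => i
  | .mul a _ => head a

/-- The right factors `r_k, …, r_1` of a word `(⋯(x r_1)⋯) r_k`. -/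
def factors : FreeMagma (Fin n) → List (FreeMagma (Fin n))
  | .of _ => []
  | .mul a b => b :: factors a

theorem head_ins (u v : FreeMagma (Fin n)) : head (ins u v) = head u := by
  induction u with
  | ih1 i => rfl
  | ih2 a b ha _ =>
    rw [ins_mul]
    split_ifs
    · exact ha
    · rfl

theorem factors_ins (u v : FreeMagma (Fin n)) : (factors (ins u v)).Perm (v :: factors u) := by
  induction u with
  | ih1 i => exact .refl _
  | ih2 a b ha _ =>
    rw [ins_mul]
    split_ifs
    · exact (ha.cons b).trans (.swap _ _ _)
    · exact .refl _

/-- The word with a given first letter and given right factors. -/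
def build (i : Fin n) (l : List (FreeMagma (Fin n))) : FreeMagma (Fin n) :=
  l.foldr (fun v u => ins u v) (.of i)

instance : LeftCommutative fun (v u : FreeMagma (Fin n)) => ins u v :=
  ⟨fun v w u => ins_right_comm u w v⟩

theorem build_perm {i : Fin n} {l l' : List (FreeMagma (Fin n))} (h : l.Perm l') :
    build i l = build i l' := h.foldr_eq _

theorem build_factors {u : FreeMagma (Fin n)} (hu : ¬ IsBad u) : build (head u) (factors u) = u := by
  induction u with
  | ih1 i => rfl
  | ih2 a b ha _ =>
    obtain ⟨h1, -, h3⟩ := good_mul_iff.1 hu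
    conv_rhs => rw [← h3, ← ha h1]
    rfl

/-- A good word is rebuilt by inserting its factors into its first letter, and the order of
insertion does not matter. -/
theorem eq_of_factors_perm {u v : FreeMagma (Fin n)} (hu : ¬ IsBad u) (hv : ¬ IsBad v)
    (h : head u = head v) (h1 : (factors u).Perm (factors v)) : u = v := by
  rw [← build_factors hu, ← build_factors hv, h, build_perm h1]

theorem good_of_mem_factors {u v : FreeMagma (Fin n)} (hu : ¬ IsBad u) (hv : v ∈ factors u) :
    ¬ IsBad v := by
  induction u with
  | ih1 i => cases hv
  | ih2 a b ha _ =>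
    obtain ⟨h1, h2, -⟩ := good_mul_iff.1 hu
    rcases List.mem_cons.1 hv with rfl | hv
    · exact h2
    · exact ha h1 hv

theorem length_lt_of_mem_factors {u v : FreeMagma (Fin n)} (hv : v ∈ factors u) :
    v.length < u.length := by
  induction u with
  | ih1 i => cases hv
  | ih2 a b ha _ =>
    have := a.length_pos
    rw [length_mul]
    rcases List.mem_cons.1 hv with rfl | hv
    · omega
    · have := ha hv; omega

theorem good_build (i : Fin n) {l : List (FreeMagma (Fin n))} (hl : ∀ v ∈ l, ¬ IsBad v) :
    ¬ IsBad (build i l) := by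
  induction l with
  | nil => exact not_isBad_of i
  | cons v l ih =>
    exact good_ins (ih fun w hw => hl w (.tail _ hw)) (hl v (.head _))

theorem head_build (i : Fin n) (l : List (FreeMagma (Fin n))) : head (build i l) = i := by
  induction l with
  | nil => rfl
  | cons v l ih => exact (head_ins _ _).trans ih

theorem factors_build (i : Fin n) (l : List (FreeMagma (Fin n))) : (factors (build i l)).Perm l := by
  induction l with
  | nil => exact .refl _
  | cons v l ih => exact (factors_ins _ _).trans (ih.cons v)

end RSWord

open RSWord

/-- Nonempty good words. -/
abbrev GoodWord (n : ℕ) : Type := {u : FreeMagma (Fin n) // ¬ IsBad u}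

namespace GoodWord

variable {n : ℕ}

instance : Mul (GoodWord n) := ⟨fun u v => ⟨ins u.1 v.1, good_ins u.2 v.2⟩⟩

/-- A letter as a good word. -/
def of (i : Fin n) : GoodWord n := ⟨.of i, not_isBad_of i⟩

theorem val_mul (u v : GoodWord n) : (u * v).1 = ins u.1 v.1 := rfl

theorem length_mul (u v : GoodWord n) : (u * v).1.length = u.1.length + v.1.length :=
  length_ins _ _

theorem mul_right_comm (u v w : GoodWord n) : u * v * w = u * w * v :=
  Subtype.ext (ins_right_comm _ _ _)

theorem mul_lt_mul_left {v v' : GoodWord n} (u : GoodWord n) (h : v < v') : u * v < u * v' :=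
  ins_lt_ins_left u.2 h

theorem mul_lt_mul_right {u u' : GoodWord n} (h : u < u') (v : GoodWord n) : u * v < u' * v :=
  ins_lt_ins_right u.2 u'.2 v.1 h

theorem mul_mul_lt (u v w : GoodWord n) : u * (v * w) < u * v * w := ins_ins_lt u.2 v.1 w.1

theorem lt_of_length_lt {u v : GoodWord n} (h : u.1.length < v.1.length) : u < v :=
  RSWord.lt_of_length_lt h

theorem lt_mul_right (u v : GoodWord n) : u < u * v :=
  lt_of_length_lt (by have := v.1.length_pos; rw [length_mul]; omega)

theorem lt_mul_left (u v : GoodWord n) : v < u * v :=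
  lt_of_length_lt (by have := u.1.length_pos; rw [length_mul]; omega)

instance : WellFoundedLT (GoodWord n) :=
  ⟨(InvImage.wf (fun u : GoodWord n => rank u.1) wellFounded_lt)⟩

/-- Every good word is a letter or a product of two good words whose concatenation is good. -/
theorem induction {motive : GoodWord n → Prop} (of : ∀ i, motive (of i))
    (mul : ∀ u v : GoodWord n, (u * v).1 = u.1 * v.1 → motive u → motive v → motive (u * v))
    (u : GoodWord n) : motive u := by
  obtain ⟨u, hu⟩ := u
  induction u with
  | ih1 i => exact of i
  | ih2 a b ha hb =>
    obtain ⟨h1, h2, h3⟩ := good_mul_iff.1 hu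
    have h4 : (⟨a * b, hu⟩ : GoodWord n) = ⟨a, h1⟩ * ⟨b, h2⟩ := Subtype.ext h3.symm
    rw [h4]
    exact mul _ _ h3 (ha h1) (hb h2)

/-- The good word that is equivalent to a given word. -/
def norm : FreeMagma (Fin n) → GoodWord n
  | .of i => of i
  | .mul a b => norm a * norm b

theorem norm_mul (a b : FreeMagma (Fin n)) : norm (a * b) = norm a * norm b := rfl

theorem norm_val (u : GoodWord n) : norm u.1 = u := by
  induction u using induction with
  | of i => rfl
  | mul u v h hu hv => rw [h, norm_mul, hu, hv]

theorem eq_of_factors {u v : GoodWord n} (h : head u.1 = head v.1)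
    (h1 : (factors u.1 : Multiset (FreeMagma (Fin n))) = factors v.1) : u = v :=
  Subtype.ext (eq_of_factors_perm u.2 v.2 h (Multiset.coe_eq_coe.1 h1))

theorem factors_mul (u v : GoodWord n) :
    (factors (u * v).1 : Multiset (FreeMagma (Fin n))) = v.1 ::ₘ factors u.1 :=
  Multiset.coe_eq_coe.2 (factors_ins u.1 v.1)

theorem head_mul (u v : GoodWord n) : head (u * v).1 = head u.1 := head_ins _ _

/-- Comparison of the multisets of factors: either `s = s'`, or `s'` is a factor of `q` and `s` one
of `q'`, and `p` collects what remains. All overlaps of elements of the ideal are computed from this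
freeness. -/
theorem eq_of_mul_eq_mul {q s q' s' : GoodWord n} (h : q * s = q' * s') :
    (q = q' ∧ s = s') ∨ ∃ p, q = p * s' ∧ q' = p * s := by
  have h1 := factors_mul q s
  rw [h, factors_mul] at h1
  have h2 : head q.1 = head q'.1 := by rw [← head_mul q s, h, head_mul]
  rcases Multiset.cons_eq_cons.1 h1.symm with ⟨h3, h4⟩ | ⟨-, cs, h4, h5⟩
  · exact Or.inl ⟨eq_of_factors h2 h4, Subtype.ext h3⟩
  · obtain ⟨l, rfl⟩ := Quot.exists_rep cs
    have hl : ∀ v ∈ l, ¬ IsBad v := fun v hv =>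
      good_of_mem_factors q.2 (by
        rw [← Multiset.mem_coe, h4]
        exact Multiset.mem_cons_of_mem hv)
    have h6 : (factors (build (head q.1) l) : Multiset (FreeMagma (Fin n))) = l :=
      Multiset.coe_eq_coe.2 (factors_build _ _)
    refine Or.inr ⟨⟨build (head q.1) l, good_build _ hl⟩, eq_of_factors ?_ ?_, eq_of_factors ?_ ?_⟩
    · rw [head_mul]; exact (head_build _ _).symm
    · rw [factors_mul, h4, h6]; rfl
    · rw [head_mul, ← h2]; exact (head_build _ _).symm
    · rw [factors_mul, h5, h6]; rfl

/-- The product of `w` with the factors `vs`. -/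
def mulList (w : GoodWord n) (vs : List (GoodWord n)) : GoodWord n :=
  vs.foldr (fun v u => u * v) w

theorem mulList_cons (w v : GoodWord n) (vs : List (GoodWord n)) :
    mulList w (v :: vs) = mulList w vs * v := rfl

theorem head_mulList (w : GoodWord n) (vs : List (GoodWord n)) :
    head (mulList w vs).1 = head w.1 := by
  induction vs with
  | nil => rfl
  | cons v vs ih => rw [mulList_cons, head_mul, ih]

theorem factors_mulList (w : GoodWord n) (vs : List (GoodWord n)) :
    (factors (mulList w vs).1 : Multiset (FreeMagma (Fin n))) =
      (vs : Multiset (GoodWord n)).map Subtype.val + factors w.1 := by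
  induction vs with
  | nil => simp [mulList]
  | cons v vs ih => rw [mulList_cons, factors_mul, ih]; simp

theorem perm_of_mulList_eq {w : GoodWord n} {vs vs' : List (GoodWord n)}
    (h : mulList w vs = mulList w vs') : vs.Perm vs' := by
  have h1 := factors_mulList w vs
  rw [h, factors_mulList] at h1
  exact (Multiset.coe_eq_coe.1 (Multiset.map_injective Subtype.val_injective
    (add_right_cancel h1))).symm

/-- By its length, `s` cannot be a factor of `w`, so it is one of the added factors. -/
theorem exists_perm_of_mulList_eq_mul {w q s : GoodWord n} {vs : List (GoodWord n)}
    (h : mulList w vs = q * s) (hl : w.1.length ≤ s.1.length) :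
    ∃ vs', vs.Perm (s :: vs') ∧ q = mulList w vs' := by
  classical
  have h1 := factors_mulList w vs
  rw [h, factors_mul] at h1
  have h2 : s ∈ vs := by
    have h3 : s.1 ∈ (vs : Multiset (GoodWord n)).map Subtype.val + factors w.1 := by
      rw [← h1]; exact Multiset.mem_cons_self _ _
    rcases Multiset.mem_add.1 h3 with h3 | h3
    · obtain ⟨x, hx, h4⟩ := Multiset.mem_map.1 h3
      rw [← Subtype.ext h4]
      exact hx
    · exact absurd (length_lt_of_mem_factors h3) hl.not_gt
  have h3 := List.perm_cons_erase h2
  refine ⟨_, h3, eq_of_factors ?_ ?_⟩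
  · rw [head_mulList, ← head_mul q s, ← h, head_mulList]
  · rw [factors_mulList]
    rw [Multiset.coe_eq_coe.2 h3, ← Multiset.cons_coe, Multiset.map_cons, Multiset.cons_add] at h1
    exact (Multiset.cons_inj_right _).1 h1

/-- Reduces the existence of added factors to an inclusion of multisets, which can be decided. -/
theorem exists_mulList_iff {w u : GoodWord n} : (∃ vs, mulList w vs = u) ↔
    head w.1 = head u.1 ∧ (factors w.1 : Multiset (FreeMagma (Fin n))) ≤ factors u.1 := by
  constructor
  · rintro ⟨vs, rfl⟩
    rw [head_mulList, factors_mulList]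
    exact ⟨rfl, Multiset.le_add_left _ _⟩
  · rintro ⟨h, h1⟩
    obtain ⟨c, hc⟩ := Multiset.le_iff_exists_add.1 h1
    have hg : ∀ v ∈ c, ¬ IsBad v := fun v hv => good_of_mem_factors u.2 (by
      rw [← Multiset.mem_coe, hc]; exact Multiset.mem_add.2 (Or.inr hv))
    obtain ⟨c, rfl⟩ := CanLift.prf (β := Multiset (GoodWord n)) c hg
    obtain ⟨l, rfl⟩ := Quot.exists_rep c
    refine ⟨l, eq_of_factors ?_ ?_⟩
    · rw [head_mulList, h]
    · rw [factors_mulList, hc, add_comm]; rfl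

/-! ### Multiples of a word in the NAP magma. -/

/-- The smallest set that contains `w` and is closed under multiplication by good words. -/
inductive Red (w : GoodWord n) : GoodWord n → Prop
  | self : Red w w
  | mul_right {u : GoodWord n} (v : GoodWord n) : Red w u → Red w (u * v)
  | mul_left (u : GoodWord n) {v : GoodWord n} : Red w v → Red w (u * v)

theorem Red.mulList {w : GoodWord n} (vs : List (GoodWord n)) : Red w (mulList w vs) := by
  induction vs with
  | nil => exact .self
  | cons v vs ih => exact .mul_right v ih

theorem Red.length_le {w u : GoodWord n} (h : Red w u) : w.1.length ≤ u.1.length := by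
  induction h with
  | self => rfl
  | mul_right v _ ih => rw [length_mul]; omega
  | mul_left v _ ih => rw [length_mul]; omega

/-- Either all multiplications are on the right, or the last left multiplication turns a multiple of
`w` into a factor `s`; later right multiplications only add factors beside it. -/
theorem Red.cases_factor {w u : GoodWord n} (h : Red w u) :
    (∃ vs, GoodWord.mulList w vs = u) ∨ ∃ q s, u = q * s ∧ Red w s := by
  induction h with
  | self => exact Or.inl ⟨[], rfl⟩
  | mul_right v _ ih =>
    rcases ih with ⟨vs, rfl⟩ | ⟨q, s, rfl, h⟩
    · exact Or.inl ⟨v :: vs, rfl⟩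
    · exact Or.inr ⟨q * v, s, mul_right_comm _ _ _, h⟩
  | mul_left u h _ => exact Or.inr ⟨_, _, rfl, h⟩

/-- Makes `Red` recursive, hence decidable: a factor of `u * v` that is a multiple of `w` is `v`
itself or a factor of `u`. -/
theorem red_mul_iff {w u v : GoodWord n} :
    Red w (u * v) ↔ (∃ vs, GoodWord.mulList w vs = u * v) ∨ Red w u ∨ Red w v := by
  constructor
  · intro h
    rcases h.cases_factor with h | ⟨q, s, h, h1⟩
    · exact Or.inl h
    · rcases eq_of_mul_eq_mul h with ⟨rfl, rfl⟩ | ⟨p, rfl, rfl⟩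
      · exact Or.inr (Or.inr h1)
      · exact Or.inr (Or.inl (.mul_left _ h1))
  · rintro (⟨vs, h⟩ | h | h)
    · rw [← h]; exact .mulList vs
    · exact .mul_right _ h
    · exact .mul_left _ h

theorem red_of_iff {w : GoodWord n} {i : Fin n} :
    Red w (of i) ↔ ∃ vs, GoodWord.mulList w vs = of i := by
  constructor
  · intro h
    rcases h.cases_factor with h | ⟨q, s, h, -⟩
    · exact h
    · have h1 := congrArg (fun x => x.1.length) h
      have h2 := q.1.length_pos
      have h3 := s.1.length_pos
      simp only [length_mul] at h1
      simp [of] at h1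
      omega
  · rintro ⟨vs, h⟩; rw [← h]; exact .mulList vs

end GoodWord

/-! ## The free right-symmetric algebra as a module over its words -/

namespace FreeRS

variable {k : Type*} [Field k] {n : ℕ}

/-- The quotient map from the free unital nonassociative algebra. -/
noncomputable def mk (k : Type*) [Field k] (n : ℕ) : MonoidAlgebra k (NAWord n) →ₗ[k] FreeRS k n where
  toFun x := (x : FreeRS k n)
  map_add' _ _ := rfl
  map_smul' _ _ := rfl

theorem mk_mul (x y : MonoidAlgebra k (NAWord n)) : mk k n (x * y) = mk k n x * mk k n y := rfl

theorem mk_surjective : Function.Surjective (mk k n) := Quotient.mk''_surjective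

theorem mk_eq_iff {x y : MonoidAlgebra k (NAWord n)} :
    mk k n x = mk k n y ↔ rightSymmCon k n x y := (rightSymmCon k n).eq

theorem mk_single (w : NAWord n) (a : k) : mk k n (MonoidAlgebra.single w a) = a • word k w := by
  have h : (MonoidAlgebra.single w a : MonoidAlgebra k (NAWord n)) =
      a • MonoidAlgebra.single w 1 := by
    rw [MonoidAlgebra.smul_single, smul_eq_mul, mul_one]
  rw [h, map_smul]
  rfl

instance : IsScalarTower k (FreeRS k n) (FreeRS k n) where
  smul_assoc a x y := by
    obtain ⟨x, rfl⟩ := mk_surjective x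
    obtain ⟨y, rfl⟩ := mk_surjective y
    simp only [smul_eq_mul]
    rw [← map_smul, ← mk_mul, ← mk_mul, ← map_smul, smul_mul_assoc]

instance : SMulCommClass k (FreeRS k n) (FreeRS k n) where
  smul_comm a x y := by
    obtain ⟨x, rfl⟩ := mk_surjective x
    obtain ⟨y, rfl⟩ := mk_surjective y
    simp only [smul_eq_mul]
    rw [← map_smul, ← mk_mul, ← mk_mul, ← map_smul, mul_smul_comm]

theorem word_one : word k (1 : NAWord n) = 1 := rfl

theorem word_mul (u v : NAWord n) : word k (u * v) = word k u * word k v := by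
  change mk k n _ = mk k n _ * mk k n _
  rw [← mk_mul, MonoidAlgebra.single_mul_single, one_mul]

theorem right_symm (x y z : FreeRS k n) :
    x * y * z - x * (y * z) = x * z * y - x * (z * y) := by
  obtain ⟨x, rfl⟩ := mk_surjective x
  obtain ⟨y, rfl⟩ := mk_surjective y
  obtain ⟨z, rfl⟩ := mk_surjective z
  simp only [← mk_mul, ← map_sub]
  exact mk_eq_iff.2 (RingCon.le_ringConGen _ _ ⟨x, y, z, rfl, rfl⟩)

theorem mul_right_comm' (x y z : FreeRS k n) :
    x * y * z = x * z * y + x * (y * z) - x * (z * y) := by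
  rw [sub_eq_iff_eq_add.1 (right_symm x y z)]
  abel

end FreeRS

/-! ## Ranks of words and the filtration by rank -/

namespace NAWord

variable {n : ℕ}

/-- A strictly monotone numbering of the words. -/
def rk (w : NAWord n) : ℕ :=
  WithOne.recOneCoe (motive := fun _ => ℕ) 0 (fun u => rank u + 1) w

theorem rk_one : rk (1 : NAWord n) = 0 := rfl

theorem rk_coe (u : FreeMagma (Fin n)) : rk (u : NAWord n) = rank u + 1 := rfl

theorem eq_one_or_coe (w : NAWord n) : w = 1 ∨ ∃ u : FreeMagma (Fin n), w = (u : NAWord n) :=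
  WithOne.cases_on (P := fun w => w = 1 ∨ ∃ u : FreeMagma (Fin n), w = (u : NAWord n)) w
    (Or.inl rfl) fun u => Or.inr ⟨u, rfl⟩

theorem rk_injective : Function.Injective (rk (n := n)) := by
  intro u v h
  obtain rfl | ⟨u, rfl⟩ := eq_one_or_coe u <;> obtain rfl | ⟨v, rfl⟩ := eq_one_or_coe v
  · rfl
  · rw [rk_one, rk_coe] at h; omega
  · rw [rk_one, rk_coe] at h; omega
  · rw [rk_coe, rk_coe] at h; rw [rank_injective (Nat.succ_injective h)]

theorem lt_iff_rk {u v : NAWord n} : u.lt v ↔ rk u < rk v := by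
  unfold NAWord.lt
  obtain rfl | ⟨u, rfl⟩ := eq_one_or_coe u <;> obtain rfl | ⟨v, rfl⟩ := eq_one_or_coe v
  · simp [WithOne.one_ne_coe]
  · simp [WithOne.coe_ne_one, rk_one, rk_coe]
  · simp [WithOne.one_ne_coe, WithOne.coe_ne_one, rk_one, rk_coe]
  · simp [WithOne.coe_ne_one, rk_coe, WithOne.coe_inj, magmaLT_iff, lt_iff_rank]

theorem isGood_one : IsGood (1 : NAWord n) := fun _ h => absurd h WithOne.one_ne_coe

theorem isGood_coe {u : FreeMagma (Fin n)} : IsGood (u : NAWord n) ↔ ¬ IsBad u :=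
  ⟨fun h => h u rfl, fun h _ hv => by rwa [← WithOne.coe_inj.1 hv]⟩

theorem isGood_iff {w : NAWord n} : w.IsGood ↔ w = 1 ∨ ∃ u : GoodWord n, w = (u.1 : NAWord n) := by
  constructor
  · intro h
    obtain rfl | ⟨u, rfl⟩ := eq_one_or_coe w
    · exact Or.inl rfl
    · exact Or.inr ⟨⟨u, isGood_coe.1 h⟩, rfl⟩
  · rintro (rfl | ⟨u, rfl⟩)
    · exact isGood_one
    · exact isGood_coe.2 u.2

theorem deg_le_of_rk_le {u v : NAWord n} (h : rk u ≤ rk v) : u.deg ≤ v.deg := by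
  obtain rfl | ⟨u, rfl⟩ := eq_one_or_coe u
  · exact Nat.zero_le _
  · obtain rfl | ⟨v, rfl⟩ := eq_one_or_coe v
    · rw [rk_one, rk_coe] at h; omega
    · rw [rk_coe, rk_coe] at h
      exact length_le_of_le (not_lt.1 fun h1 => absurd (lt_iff_rank.1 h1) (by omega))

end NAWord

namespace GoodWord

variable {n : ℕ}

/-- The rank of a nonempty good word among all words. -/
def rk (u : GoodWord n) : ℕ := NAWord.rk (u.1 : NAWord n)

theorem rk_lt {u v : GoodWord n} : rk u < rk v ↔ u < v := by
  rw [rk, rk, NAWord.rk_coe, NAWord.rk_coe]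
  exact Nat.succ_lt_succ_iff

theorem rk_le {u v : GoodWord n} : rk u ≤ rk v ↔ u ≤ v := by
  rw [← not_lt, rk_lt, not_lt]

end GoodWord

namespace FreeRS

variable {k : Type*} [Field k] {n : ℕ}

/-- The span of the good words of rank less than `N`. -/
noncomputable def low (k : Type*) [Field k] (n N : ℕ) : Submodule k (FreeRS k n) :=
  Submodule.span k {x | ∃ w : NAWord n, w.IsGood ∧ w.rk < N ∧ x = word k w}

/-- The element represented by a nonempty good word. -/
noncomputable def gw (k : Type*) [Field k] {n : ℕ} (u : GoodWord n) : FreeRS k n :=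
  word k (u.1 : NAWord n)

theorem low_mono {M N : ℕ} (h : M ≤ N) : low k n M ≤ low k n N :=
  Submodule.span_mono fun _ ⟨w, h1, h2, h3⟩ => ⟨w, h1, h2.trans_le h, h3⟩

theorem word_mem_low {w : NAWord n} (hw : w.IsGood) {N : ℕ} (h : w.rk < N) : word k w ∈ low k n N :=
  Submodule.subset_span ⟨w, hw, h, rfl⟩

theorem one_mem_low {N : ℕ} (h : 0 < N) : (1 : FreeRS k n) ∈ low k n N :=
  word_mem_low NAWord.isGood_one h

theorem gw_mem_low {u : GoodWord n} {N : ℕ} (h : u.rk < N) : gw k u ∈ low k n N :=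
  word_mem_low (NAWord.isGood_coe.2 u.2) h

/-- A submodule condition on the elements of `low k n N` holds if it holds for `1` and for the
nonempty good words of rank less than `N`. -/
theorem low_induction {N : ℕ} {S : Submodule k (FreeRS k n)} (h1 : 0 < N → (1 : FreeRS k n) ∈ S)
    (h : ∀ u : GoodWord n, u.rk < N → gw k u ∈ S) : low k n N ≤ S := by
  refine Submodule.span_le.2 ?_
  rintro _ ⟨w, hw, hlt, rfl⟩
  rcases NAWord.isGood_iff.1 hw with rfl | ⟨u, rfl⟩
  · exact h1 hlt
  · exact h u hlt

theorem low_le_comap {N : ℕ} {S : Submodule k (FreeRS k n)} (φ : FreeRS k n →ₗ[k] FreeRS k n)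
    (h1 : 0 < N → φ 1 ∈ S) (h : ∀ u : GoodWord n, u.rk < N → φ (gw k u) ∈ S)
    {p : FreeRS k n} (hp : p ∈ low k n N) : φ p ∈ S :=
  low_induction (S := S.comap φ) h1 h hp

theorem mem_low_succ_of_sub {p : FreeRS k n} {u : GoodWord n} (h : p - gw k u ∈ low k n u.rk)
    {N : ℕ} (hN : u.rk < N) : p ∈ low k n N := by
  rw [← sub_add_cancel p (gw k u)]
  exact add_mem (low_mono hN.le h) (gw_mem_low hN)

/-- The leading word of a product of good words is their product in the NAP magma. -/
theorem gw_mul_gw (u v : GoodWord n) :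
    gw k u * gw k v - gw k (u * v) ∈ low k n (u * v).rk := by
  -- The induction is on the product word, for all pairs of factors at once, because rewriting
  -- changes the factors.
  generalize ht : u * v = t
  induction t using WellFoundedLT.induction generalizing u v with
  | ind t IH =>
  have hmul : ∀ x y : GoodWord n, x * y < t → ∀ N, (x * y).rk < N → gw k x * gw k y ∈ low k n N :=
    fun x y h N hN => mem_low_succ_of_sub (IH _ h x y rfl) hN
  have hconcat : ∀ x y : GoodWord n, (x * y).1 = x.1 * y.1 → gw k (x * y) = gw k x * gw k y := by
    intro x y h
    rw [gw, h, gw, gw, ← word_mul]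
    rfl
  subst ht
  induction u using GoodWord.induction with
  | of i => rw [← hconcat _ v rfl, sub_self]; exact zero_mem _
  | mul a b hab _ _ =>
    -- If `v` does not pass the last factor `b`, the concatenation is already good. Otherwise `(ab)v
    -- = (av)b + a(bv) - a(vb)`, where the first term has the leading word `a * v * b = a * b * v`
    -- and the other two are smaller by `mul_mul_lt`.
    rcases lt_or_ge v.1 b.1 with hvb | hvb
    swap
    · rw [← hconcat _ v (by rw [GoodWord.val_mul, hab, ins_mul_of_le _ hvb]), sub_self]
      exact zero_mem _
    have hav : a * v < a * b * v := GoodWord.lt_of_length_lt (by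
      have := b.1.length_pos; simp only [GoodWord.length_mul]; omega)
    have hbv : b * v < a * b * v := GoodWord.lt_of_length_lt (by
      have := a.1.length_pos; simp only [GoodWord.length_mul]; omega)
    have hvb' : v * b < a * b * v := GoodWord.lt_of_length_lt (by
      have := a.1.length_pos; simp only [GoodWord.length_mul]; omega)
    have ht : gw k (a * b * v) = gw k (a * v) * gw k b := by
      rw [GoodWord.mul_right_comm]
      refine hconcat _ _ ?_
      rw [GoodWord.mul_right_comm, GoodWord.val_mul, hab, ins_mul_of_lt _ hvb, GoodWord.val_mul]
    have h1 : (gw k a * gw k v - gw k (a * v)) * gw k b ∈ low k n (a * b * v).rk := by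
      refine low_le_comap (LinearMap.mulRight k (gw k b)) (fun _ => ?_) (fun y hy => ?_)
        (IH _ hav a v rfl)
      · rw [LinearMap.mulRight_apply, one_mul]
        exact gw_mem_low (GoodWord.rk_lt.2
          ((GoodWord.lt_mul_left a b).trans (GoodWord.lt_mul_right _ v)))
      · have h2 : y * b < a * b * v := by
          rw [GoodWord.mul_right_comm]
          exact GoodWord.mul_lt_mul_right (GoodWord.rk_lt.1 hy) b
        exact hmul _ _ h2 _ (GoodWord.rk_lt.2 h2)
    have h2 : ∀ x y : GoodWord n, x * y < a * b * v → a * (x * y) < a * b * v →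
        gw k a * (gw k x * gw k y) ∈ low k n (a * b * v).rk := by
      intro x y hxy haxy
      refine low_le_comap (LinearMap.mulLeft k (gw k a)) (fun _ => ?_) (fun z hz => ?_)
        (hmul x y hxy _ (Nat.lt_succ_self _))
      · rw [LinearMap.mulLeft_apply, mul_one]
        exact gw_mem_low (GoodWord.rk_lt.2
          ((GoodWord.lt_mul_right a b).trans (GoodWord.lt_mul_right _ v)))
      · have hz := GoodWord.rk_le.1 (Nat.lt_succ_iff.1 hz)
        have h3 : a * z < a * b * v := by
          refine lt_of_le_of_lt ?_ haxy
          rcases hz.eq_or_lt with rfl | hz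
          · rfl
          · exact (GoodWord.mul_lt_mul_left a hz).le
        exact hmul _ _ h3 _ (GoodWord.rk_lt.2 h3)
    have h3 := h2 b v hbv (GoodWord.mul_mul_lt a b v)
    have h4 := h2 v b hvb' (by rw [GoodWord.mul_right_comm]; exact GoodWord.mul_mul_lt a v b)
    have h5 : gw k (a * b) * gw k v - gw k (a * b * v) =
        (gw k a * gw k v - gw k (a * v)) * gw k b + gw k a * (gw k b * gw k v)
          - gw k a * (gw k v * gw k b) := by
      rw [ht, hconcat a b hab, mul_right_comm', sub_mul]
      abel
    rw [h5]
    exact sub_mem (add_mem h1 h3) h4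

theorem mul_gw_mem {x v : GoodWord n} {p : FreeRS k n} (hp : p ∈ low k n x.rk) :
    p * gw k v ∈ low k n (x * v).rk := by
  refine low_le_comap (LinearMap.mulRight k (gw k v)) (fun _ => ?_) (fun y hy => ?_) hp
  · rw [LinearMap.mulRight_apply, one_mul]
    exact gw_mem_low (GoodWord.rk_lt.2 (GoodWord.lt_mul_left x v))
  · exact mem_low_succ_of_sub (gw_mul_gw y v)
      (GoodWord.rk_lt.2 (GoodWord.mul_lt_mul_right (GoodWord.rk_lt.1 hy) v))

theorem gw_mul_mem {u x : GoodWord n} {p : FreeRS k n} (hp : p ∈ low k n x.rk) :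
    gw k u * p ∈ low k n (u * x).rk := by
  refine low_le_comap (LinearMap.mulLeft k (gw k u)) (fun _ => ?_) (fun y hy => ?_) hp
  · rw [LinearMap.mulLeft_apply, mul_one]
    exact gw_mem_low (GoodWord.rk_lt.2 (GoodWord.lt_mul_right u x))
  · exact mem_low_succ_of_sub (gw_mul_gw u y)
      (GoodWord.rk_lt.2 (GoodWord.mul_lt_mul_left u (GoodWord.rk_lt.1 hy)))

/-- Good words span: every nonempty word is a letter or a product of shorter words, and `gw_mul_gw`
expresses products of good words through good words. -/
theorem exists_mem_low (x : FreeRS k n) : ∃ N, x ∈ low k n N := by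
  have hadd : ∀ x y : FreeRS k n, (∃ N, x ∈ low k n N) → (∃ N, y ∈ low k n N) →
      ∃ N, x + y ∈ low k n N := by
    rintro x y ⟨M, hM⟩ ⟨N, hN⟩
    exact ⟨max M N, add_mem (low_mono (le_max_left _ _) hM) (low_mono (le_max_right _ _) hN)⟩
  have hgw : ∀ u : FreeMagma (Fin n), ∃ N, word k (u : NAWord n) ∈ low k n N := by
    intro u
    induction u with
    | ih1 i => exact ⟨_, gw_mem_low (u := GoodWord.of i) (Nat.lt_succ_self _)⟩
    | ih2 a b ha hb =>
      obtain ⟨M, hM⟩ := ha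
      obtain ⟨N, hN⟩ := hb
      rw [WithOne.coe_mul, word_mul]
      generalize word k (b : NAWord n) = y at hN
      generalize word k (a : NAWord n) = x at hM
      induction hM using Submodule.span_induction with
      | mem x hx =>
        obtain ⟨w, hw, -, rfl⟩ := hx
        induction hN using Submodule.span_induction with
        | mem y hy =>
          obtain ⟨w', hw', -, rfl⟩ := hy
          rcases NAWord.isGood_iff.1 hw with rfl | ⟨u, rfl⟩
          · rw [word_one, one_mul]; exact ⟨_, word_mem_low hw' (Nat.lt_succ_self _)⟩
          rcases NAWord.isGood_iff.1 hw' with rfl | ⟨v, rfl⟩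
          · rw [word_one, mul_one]; exact ⟨_, word_mem_low hw (Nat.lt_succ_self _)⟩
          exact ⟨_, mem_low_succ_of_sub (gw_mul_gw u v) (Nat.lt_succ_self _)⟩
        | zero => rw [mul_zero]; exact ⟨0, zero_mem _⟩
        | add y y' _ _ h h' => rw [mul_add]; exact hadd _ _ h h'
        | smul c y _ h =>
          obtain ⟨N, h⟩ := h
          rw [mul_smul_comm]; exact ⟨N, Submodule.smul_mem _ c h⟩
      | zero => rw [zero_mul]; exact ⟨0, zero_mem _⟩
      | add x x' _ _ h h' => rw [add_mul]; exact hadd _ _ h h'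
      | smul c x _ h =>
        obtain ⟨N, h⟩ := h
        rw [smul_mul_assoc]; exact ⟨N, Submodule.smul_mem _ c h⟩
  obtain ⟨x, rfl⟩ := mk_surjective x
  induction x using MonoidAlgebra.induction_linear with
  | zero => exact ⟨0, by rw [map_zero]; exact zero_mem _⟩
  | add x y hx hy => rw [map_add]; exact hadd _ _ hx hy
  | single w a =>
    rw [mk_single]
    obtain rfl | ⟨u, rfl⟩ := NAWord.eq_one_or_coe w
    · exact ⟨1, Submodule.smul_mem _ _ (one_mem_low one_pos)⟩
    · obtain ⟨N, hN⟩ := hgw u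
      exact ⟨N, Submodule.smul_mem _ _ hN⟩

end FreeRS

/-! ## A model: right-symmetric grafting on the free NAP algebra -/

namespace GoodWord

variable (k : Type*) [Field k] {n : ℕ}

/-- The bilinear extension of the product of good words. -/
noncomputable def circ : (GoodWord n →₀ k) →ₗ[k] (GoodWord n →₀ k) →ₗ[k] (GoodWord n →₀ k) :=
  Finsupp.linearCombination k fun u => Finsupp.linearCombination k fun v => Finsupp.single (u * v) 1

/-- Grafting at the inner vertices of a word. -/
noncomputable def graftInner : FreeMagma (Fin n) → (GoodWord n →₀ k) →ₗ[k] (GoodWord n →₀ k)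
  | .of _ => 0
  -- Here `b` hangs at the root of `a`. The vertices other than the root are those of `a` other than
  -- its root, the root of `b`, and the other vertices of `b`; each kind gives one summand.
  | .mul a b => (circ k).flip (Finsupp.single (norm b) 1) ∘ₗ graftInner a +
      circ k (Finsupp.single (norm a) 1) ∘ₗ (circ k (Finsupp.single (norm b) 1) + graftInner b)

/-- The bilinear extension of `graftInner`. -/
noncomputable def inner : (GoodWord n →₀ k) →ₗ[k] (GoodWord n →₀ k) →ₗ[k] (GoodWord n →₀ k) :=
  Finsupp.linearCombination k fun u => graftInner k u.1

/-- The right-symmetric product: grafting at all vertices. -/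
noncomputable def graft : (GoodWord n →₀ k) →ₗ[k] (GoodWord n →₀ k) →ₗ[k] (GoodWord n →₀ k) :=
  circ k + inner k

variable {k}

theorem circ_single (u v : GoodWord n) :
    circ k (Finsupp.single u 1) (Finsupp.single v 1) = Finsupp.single (u * v) 1 := by
  simp [circ]

/-- A property of finitely supported functions that defines a submodule holds if it holds for the
basis. -/
theorem finsupp_induction {S : Submodule k (GoodWord n →₀ k)} (h : ∀ u, Finsupp.single u 1 ∈ S)
    (x : GoodWord n →₀ k) : x ∈ S := by
  induction x using Finsupp.induction_linear with
  | zero => exact zero_mem _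
  | add x y hx hy => exact add_mem hx hy
  | single u a =>
    have h1 : Finsupp.single u a = a • Finsupp.single u (1 : k) := by simp
    rw [h1]
    exact S.smul_mem a (h u)

theorem eq_of_eq_on_single {V : Type*} [AddCommGroup V] [Module k V]
    {φ ψ : (GoodWord n →₀ k) →ₗ[k] V}
    (h : ∀ u, φ (Finsupp.single u 1) = ψ (Finsupp.single u 1)) : φ = ψ :=
  LinearMap.ext fun x => finsupp_induction (S := LinearMap.eqLocus φ ψ) h x

theorem circ_right_comm (x y z : GoodWord n →₀ k) :
    circ k (circ k x y) z = circ k (circ k x z) y := by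
  have h : ∀ u v w : GoodWord n,
      circ k (circ k (Finsupp.single u 1) (Finsupp.single v 1)) (Finsupp.single w 1) =
      circ k (circ k (Finsupp.single u 1) (Finsupp.single w 1)) (Finsupp.single v 1) := by
    intro u v w
    simp only [circ_single, mul_right_comm u v w]
  have h1 : ∀ u v : GoodWord n, ∀ z,
      circ k (circ k (Finsupp.single u 1) (Finsupp.single v 1)) z =
      circ k (circ k (Finsupp.single u 1) z) (Finsupp.single v 1) := fun u v z =>
    LinearMap.congr_fun (f := circ k (circ k (Finsupp.single u 1) (Finsupp.single v 1)))
      (g := (circ k).flip (Finsupp.single v 1) ∘ₗ circ k (Finsupp.single u 1))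
      (eq_of_eq_on_single fun w => h u v w) z
  have h2 : ∀ u : GoodWord n, ∀ y z,
      circ k (circ k (Finsupp.single u 1) y) z = circ k (circ k (Finsupp.single u 1) z) y :=
    fun u y z => LinearMap.congr_fun (f := (circ k).flip z ∘ₗ circ k (Finsupp.single u 1))
      (g := circ k (circ k (Finsupp.single u 1) z)) (eq_of_eq_on_single fun v => h1 u v z) y
  exact LinearMap.congr_fun (f := (circ k).flip z ∘ₗ (circ k).flip y)
    (g := (circ k).flip y ∘ₗ (circ k).flip z) (eq_of_eq_on_single fun u => h2 u y z) x

theorem norm_ins (u v : FreeMagma (Fin n)) : norm (ins u v) = norm u * norm v := by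
  induction u with
  | ih1 i => rfl
  | ih2 a b ha _ =>
    rw [ins_mul]
    split_ifs
    · rw [norm_mul, norm_mul, ha, mul_right_comm]
    · rfl

theorem graftInner_mul (a b : FreeMagma (Fin n)) (x : GoodWord n →₀ k) :
    graftInner k (a * b) x = circ k (graftInner k a x) (Finsupp.single (norm b) 1) +
      circ k (Finsupp.single (norm a) 1)
        (circ k (Finsupp.single (norm b) 1) x + graftInner k b x) := rfl

/-- Grafting is defined on words but depends only on the tree: reordering the factors permutes the
summands, by `circ_right_comm`. -/
theorem graftInner_ins (a b : FreeMagma (Fin n)) : graftInner k (ins a b) = graftInner k (a * b) := by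
  induction a with
  | ih1 i => rfl
  | ih2 c d hc _ =>
    rw [ins_mul]
    split_ifs
    · refine LinearMap.ext fun x => ?_
      rw [graftInner_mul, graftInner_mul (c * d), hc, graftInner_mul, graftInner_mul c, norm_ins,
        norm_mul, ← circ_single, ← circ_single]
      generalize circ k (Finsupp.single (norm b) 1) x + graftInner k b x = y
      generalize circ k (Finsupp.single (norm d) 1) x + graftInner k d x = z
      have h1 := circ_right_comm (graftInner k c x) (Finsupp.single (norm b) 1)
        (Finsupp.single (norm d) 1)
      have h2 := circ_right_comm (Finsupp.single (norm c) 1) y (Finsupp.single (norm d) 1)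
      have h3 := circ_right_comm (Finsupp.single (norm c) 1) (Finsupp.single (norm b) 1) z
      simp only [map_add, LinearMap.add_apply]
      rw [h1, h2, h3]
      abel
    · rfl

theorem inner_single (u : GoodWord n) : inner k (Finsupp.single u 1) = graftInner k u.1 := by
  simp [inner]

theorem inner_of (i : Fin n) : inner k (Finsupp.single (of i) 1) = 0 := inner_single _

theorem inner_circ_single (u v : GoodWord n) (x : GoodWord n →₀ k) :
    inner k (circ k (Finsupp.single u 1) (Finsupp.single v 1)) x =
      circ k (inner k (Finsupp.single u 1) x) (Finsupp.single v 1) +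
      circ k (Finsupp.single u 1) (graft k (Finsupp.single v 1) x) := by
  rw [circ_single, inner_single, val_mul, graftInner_ins, graftInner_mul, norm_val, norm_val, graft,
    LinearMap.add_apply, LinearMap.add_apply, inner_single, inner_single]

/-- Together with `inner_of`, this rule determines `inner` and is all that the identities below need
of it. -/
theorem inner_circ (x y z : GoodWord n →₀ k) :
    inner k (circ k x y) z = circ k (inner k x z) y + circ k x (graft k y z) := by
  have h1 : ∀ u : GoodWord n, ∀ y, inner k (circ k (Finsupp.single u 1) y) z =
      circ k (inner k (Finsupp.single u 1) z) y + circ k (Finsupp.single u 1) (graft k y z) :=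
    fun u y => LinearMap.congr_fun (f := (inner k).flip z ∘ₗ circ k (Finsupp.single u 1))
      (g := circ k (inner k (Finsupp.single u 1) z) +
        circ k (Finsupp.single u 1) ∘ₗ (graft k).flip z)
      (eq_of_eq_on_single fun v => inner_circ_single u v z) y
  exact LinearMap.congr_fun (f := (inner k).flip z ∘ₗ (circ k).flip y)
    (g := (circ k).flip y ∘ₗ (inner k).flip z + (circ k).flip (graft k y z))
    (eq_of_eq_on_single fun u => h1 u y) x

/-- Induction on the tree in the first argument with `v` and `w` arbitrary. For `a * b`, the terms
with both `v` and `w` at the root of `b` are symmetric by `circ_right_comm`; the induction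
hypotheses for `a` and `b` supply the rest. -/
theorem inner_right_symm (x v w : GoodWord n →₀ k) :
    inner k (inner k x v) w - inner k x (graft k v w) =
      inner k (inner k x w) v - inner k x (graft k w v) := by
  have h : ∀ u : GoodWord n, ∀ v w : GoodWord n →₀ k,
      inner k (inner k (Finsupp.single u 1) v) w - inner k (Finsupp.single u 1) (graft k v w) =
      inner k (inner k (Finsupp.single u 1) w) v - inner k (Finsupp.single u 1) (graft k w v) := by
    intro u
    induction u using GoodWord.induction with
    | of i => intro v w; simp [inner_of]
    | mul a b _ ha hb =>
      intro v w
      have h1 := congrArg (fun t => circ k t (Finsupp.single b 1)) (ha v w)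
      have h2 := congrArg (circ k (Finsupp.single a 1)) (hb v w)
      have h3 := congrArg (circ k (Finsupp.single a 1)) (circ_right_comm (Finsupp.single b 1) v w)
      simp only [map_sub, LinearMap.sub_apply] at h1 h2
      rw [← circ_single]
      simp only [inner_circ, graft, map_add, LinearMap.add_apply] at h1 h2 ⊢
      linear_combination (norm := module) h1 + h2 + h3
  exact LinearMap.congr_fun
    (f := (inner k).flip w ∘ₗ (inner k).flip v - (inner k).flip (graft k v w))
    (g := (inner k).flip v ∘ₗ (inner k).flip w - (inner k).flip (graft k w v))
    (eq_of_eq_on_single fun u => h u v w) x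

/-- Subtracting the terms in which `w` lands on `v` leaves all ways to graft `v` and `w`
independently on vertices of `x`, which is symmetric. -/
theorem graft_right_symm (x v w : GoodWord n →₀ k) :
    graft k (graft k x v) w - graft k x (graft k v w) =
      graft k (graft k x w) v - graft k x (graft k w v) := by
  have h1 := inner_right_symm x v w
  have h2 := circ_right_comm x v w
  simp only [inner_circ, graft, map_add, LinearMap.add_apply] at h1 ⊢
  linear_combination (norm := module) h1 + h2

/-! ### Leading words in the model -/

/-- The span of the basis vectors below `x`. -/
noncomputable def below (k : Type*) [Field k] {n : ℕ} (x : GoodWord n) :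
    Submodule k (GoodWord n →₀ k) :=
  Submodule.span k ((fun y => Finsupp.single y 1) '' Set.Iio x)

theorem single_mem_below {x y : GoodWord n} (h : y < x) : Finsupp.single y 1 ∈ below k x :=
  Submodule.subset_span ⟨y, h, rfl⟩

theorem below_mono {x y : GoodWord n} (h : x ≤ y) : below k x ≤ below k y :=
  Submodule.span_mono (Set.image_mono (Set.Iio_subset_Iio h))

theorem mem_of_mem_below {x : GoodWord n} {S : Submodule k (GoodWord n →₀ k)}
    (φ : (GoodWord n →₀ k) →ₗ[k] (GoodWord n →₀ k))
    (h : ∀ y < x, φ (Finsupp.single y 1) ∈ S) {p : GoodWord n →₀ k} (hp : p ∈ below k x) :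
    φ p ∈ S := by
  refine (Submodule.span_le (p := S.comap φ)).2 ?_ hp
  rintro _ ⟨y, hy, rfl⟩
  exact h y hy

theorem circ_mem_below_right {x : GoodWord n} {p : GoodWord n →₀ k} (hp : p ∈ below k x)
    (v : GoodWord n) : circ k p (Finsupp.single v 1) ∈ below k (x * v) :=
  mem_of_mem_below ((circ k).flip (Finsupp.single v 1)) (fun y hy => by
    rw [LinearMap.flip_apply, circ_single]
    exact single_mem_below (mul_lt_mul_right hy v)) hp

theorem circ_mem_below_left {x : GoodWord n} {p : GoodWord n →₀ k} (hp : p ∈ below k x)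
    (u : GoodWord n) : circ k (Finsupp.single u 1) p ∈ below k (u * x) :=
  mem_of_mem_below (circ k (Finsupp.single u 1)) (fun y hy => by
    rw [circ_single]
    exact single_mem_below (mul_lt_mul_left u hy)) hp

/-- Grafting away from the root puts `v` inside a factor; the factor gets longer and the word
smaller, by `mul_mul_lt`. -/
theorem inner_mem_below (u v : GoodWord n) :
    inner k (Finsupp.single u 1) (Finsupp.single v 1) ∈ below k (u * v) := by
  induction u using GoodWord.induction with
  | of i => rw [inner_of]; exact zero_mem _
  | mul a b _ ha hb =>
    rw [← circ_single, inner_circ, graft, LinearMap.add_apply, LinearMap.add_apply, map_add,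
      circ_single, circ_single]
    refine add_mem ?_ (add_mem (single_mem_below (mul_mul_lt a b v)) ?_)
    · rw [mul_right_comm]; exact circ_mem_below_right ha b
    · exact below_mono (mul_mul_lt a b v).le (circ_mem_below_left hb a)

theorem graft_single_sub_mem (u v : GoodWord n) :
    graft k (Finsupp.single u 1) (Finsupp.single v 1) - Finsupp.single (u * v) 1 ∈
      below k (u * v) := by
  rw [graft, LinearMap.add_apply, LinearMap.add_apply, circ_single, add_sub_cancel_left]
  exact inner_mem_below u v

theorem graft_single_mem_below {u v x : GoodWord n} (h : u * v < x) :
    graft k (Finsupp.single u 1) (Finsupp.single v 1) ∈ below k x := by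
  rw [← sub_add_cancel (graft k _ _) (Finsupp.single (u * v) 1)]
  exact add_mem (below_mono h.le (graft_single_sub_mem u v)) (single_mem_below h)

theorem graft_mem_below_left {x : GoodWord n} {p : GoodWord n →₀ k} (hp : p ∈ below k x)
    (u : GoodWord n) : graft k (Finsupp.single u 1) p ∈ below k (u * x) :=
  mem_of_mem_below (graft k (Finsupp.single u 1))
    (fun _ hy => graft_single_mem_below (mul_lt_mul_left u hy)) hp

theorem graft_mem_below_right {x : GoodWord n} {p : GoodWord n →₀ k} (hp : p ∈ below k x)
    (v : GoodWord n) : graft k p (Finsupp.single v 1) ∈ below k (x * v) :=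
  mem_of_mem_below ((graft k).flip (Finsupp.single v 1))
    (fun _ hy => by
      rw [LinearMap.flip_apply]
      exact graft_single_mem_below (mul_lt_mul_right hy v)) hp

theorem graft_mem_below {x y : GoodWord n} {p q : GoodWord n →₀ k} (hp : p ∈ below k x)
    (hq : q ∈ below k y) : graft k p q ∈ below k (x * y) :=
  mem_of_mem_below ((graft k).flip q) (fun _ hz => by
    rw [LinearMap.flip_apply]
    exact below_mono (mul_lt_mul_right hz y).le (graft_mem_below_left hq _)) hp

variable (k) in
/-- The value of a word in the model. -/
noncomputable def value : FreeMagma (Fin n) → (GoodWord n →₀ k)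
  | .of i => Finsupp.single (of i) 1
  | .mul a b => graft k (value a) (value b)

/-- The evaluation of good words in the model is unitriangular; errors in either factor stay smaller
because the NAP product is monotone. -/
theorem value_sub_mem (u : GoodWord n) : value k u.1 - Finsupp.single u 1 ∈ below k u := by
  induction u using GoodWord.induction with
  | of i => change Finsupp.single _ _ - _ ∈ _; rw [sub_self]; exact zero_mem _
  | mul u v h hu hv =>
    rw [h]
    change graft k (value k u.1) (value k v.1) - _ ∈ _
    generalize value k u.1 = x at hu
    generalize value k v.1 = y at hv
    have h1 : graft k x y - Finsupp.single (u * v) 1 =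
        (graft k (Finsupp.single u 1) (Finsupp.single v 1) - Finsupp.single (u * v) 1) +
        graft k (Finsupp.single u 1) (y - Finsupp.single v 1) +
        graft k (x - Finsupp.single u 1) (Finsupp.single v 1) +
        graft k (x - Finsupp.single u 1) (y - Finsupp.single v 1) := by
      simp only [map_sub, LinearMap.sub_apply]
      abel
    rw [h1]
    exact add_mem (add_mem (add_mem (graft_single_sub_mem u v) (graft_mem_below_left hv u))
      (graft_mem_below_right hu v)) (graft_mem_below hu hv)

end GoodWord

/-! ## Triangular families -/

section Triangular

variable {k : Type*} [Field k] {V ι : Type*} [AddCommGroup V] [Module k V] {r : ι → ℕ} {b e : ι → V}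

/-- In a combination of a triangular family, the term of greatest rank cannot be cancelled. -/
theorem exists_leading_index (hr : Function.Injective r)
    (h : ∀ i, e i - b i ∈ Submodule.span k (b '' {j | r j < r i})) {c : ι →₀ k} (hc : c ≠ 0) :
    ∃ i ∈ c.support, (∀ j ∈ c.support, r j ≤ r i) ∧
      Finsupp.linearCombination k e c - c i • b i ∈ Submodule.span k (b '' {j | r j < r i}) := by
  classical
  obtain ⟨i, hi, hmax⟩ := c.support.exists_max_image r (Finsupp.support_nonempty_iff.2 hc)
  refine ⟨i, hi, hmax, ?_⟩
  have h1 : Finsupp.linearCombination k e c =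
      c i • e i + ∑ j ∈ c.support.erase i, c j • e j := by
    rw [Finsupp.linearCombination_apply, Finsupp.sum]
    exact (Finset.add_sum_erase _ (fun j => c j • e j) hi).symm
  rw [h1, add_sub_right_comm, ← smul_sub]
  refine add_mem (Submodule.smul_mem _ _ (h i)) (Submodule.sum_mem _ fun j hj => ?_)
  have hlt : r j < r i := lt_of_le_of_ne (hmax j (Finset.mem_of_mem_erase hj))
    (hr.ne (Finset.ne_of_mem_erase hj))
  rw [← sub_add_cancel (e j) (b j)]
  refine Submodule.smul_mem _ _ (add_mem ?_ (Submodule.subset_span ⟨j, hlt, rfl⟩))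
  exact Submodule.span_mono (Set.image_mono fun l (hl : r l < r j) => hl.trans hlt) (h j)

theorem linearIndependent_of_triangular (hr : Function.Injective r) (hb : LinearIndependent k b)
    (h : ∀ i, e i - b i ∈ Submodule.span k (b '' {j | r j < r i})) : LinearIndependent k e := by
  rw [linearIndependent_iff]
  intro c h0
  by_contra hc
  obtain ⟨i, hi, -, h1⟩ := exists_leading_index hr h hc
  rw [h0, zero_sub, neg_mem_iff,
    Submodule.smul_mem_iff _ (Finsupp.mem_support_iff.1 hi)] at h1
  exact hb.notMem_span_image (s := {j | r j < r i}) (lt_irrefl (r i)) h1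

end Triangular

namespace FreeRS

variable {k : Type*} [Field k] {n : ℕ}

/-! ## Linear independence of the good words -/

/-- The unital product of the model. -/
noncomputable def unitalGraft (x y : k × (GoodWord n →₀ k)) : k × (GoodWord n →₀ k) :=
  (x.1 * y.1, x.1 • y.2 + y.1 • x.2 + GoodWord.graft k x.2 y.2)

theorem unitalGraft_add_left (x y z : k × (GoodWord n →₀ k)) :
    unitalGraft (x + y) z = unitalGraft x z + unitalGraft y z := by
  ext1
  · simp [unitalGraft, add_mul]
  · simp only [unitalGraft, Prod.fst_add, Prod.snd_add, map_add, LinearMap.add_apply]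
    module

theorem unitalGraft_add_right (x y z : k × (GoodWord n →₀ k)) :
    unitalGraft x (y + z) = unitalGraft x y + unitalGraft x z := by
  ext1
  · simp [unitalGraft, mul_add]
  · simp only [unitalGraft, Prod.fst_add, Prod.snd_add, map_add]
    module

theorem unitalGraft_smul_smul (a b : k) (x y : k × (GoodWord n →₀ k)) :
    unitalGraft (a • x) (b • y) = (a * b) • unitalGraft x y := by
  ext1
  · simp [unitalGraft, mul_mul_mul_comm]
  · simp only [unitalGraft, Prod.smul_fst, Prod.smul_snd, map_smul, LinearMap.smul_apply,
      smul_eq_mul]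
    module

/-- An associator with the unit among its arguments vanishes, so adjoining a unit preserves
right-symmetry. -/
theorem unitalGraft_right_symm (x y z : k × (GoodWord n →₀ k)) :
    unitalGraft (unitalGraft x y) z - unitalGraft x (unitalGraft y z) =
      unitalGraft (unitalGraft x z) y - unitalGraft x (unitalGraft z y) := by
  have h := GoodWord.graft_right_symm x.2 y.2 z.2
  ext1
  · simp only [unitalGraft, Prod.fst_sub]; ring
  · simp only [unitalGraft, Prod.snd_sub, map_add, map_smul, LinearMap.add_apply,
      LinearMap.smul_apply]
    linear_combination (norm := module) h

/-- The value of a word, possibly empty, in the model. -/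
noncomputable def modelWord (k : Type*) [Field k] {n : ℕ} (w : NAWord n) : k × (GoodWord n →₀ k) :=
  WithOne.recOneCoe (motive := fun _ => k × (GoodWord n →₀ k)) (1, 0)
    (fun u => (0, GoodWord.value k u)) w

theorem modelWord_one : modelWord k (1 : NAWord n) = (1, 0) := rfl

theorem modelWord_coe (u : FreeMagma (Fin n)) :
    modelWord k (u : NAWord n) = (0, GoodWord.value k u) := rfl

theorem modelWord_mul (u v : NAWord n) :
    modelWord k (u * v) = unitalGraft (modelWord k u) (modelWord k v) := by
  obtain rfl | ⟨u, rfl⟩ := NAWord.eq_one_or_coe u <;>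
    obtain rfl | ⟨v, rfl⟩ := NAWord.eq_one_or_coe v
  · rw [one_mul, modelWord_one]; simp [unitalGraft]
  · rw [one_mul, modelWord_one, modelWord_coe]; simp [unitalGraft]
  · rw [mul_one, modelWord_one, modelWord_coe]; simp [unitalGraft]
  · rw [← WithOne.coe_mul, modelWord_coe, modelWord_coe, modelWord_coe]
    simp only [unitalGraft, zero_mul, zero_smul, zero_add]
    rfl

/-- The linear map from the free nonassociative algebra to the model. -/
noncomputable def rawToModel (k : Type*) [Field k] (n : ℕ) :
    MonoidAlgebra k (NAWord n) →ₗ[k] k × (GoodWord n →₀ k) where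
  toFun x := Finsupp.linearCombination k (modelWord k) x.coeff
  map_add' x y := by rw [MonoidAlgebra.coeff_add, map_add]
  map_smul' a x := by rw [MonoidAlgebra.coeff_smul, map_smul]; rfl

theorem rawToModel_single (w : NAWord n) (a : k) :
    rawToModel k n (MonoidAlgebra.single w a) = a • modelWord k w :=
  Finsupp.linearCombination_single _ _ _

theorem rawToModel_mul (x y : MonoidAlgebra k (NAWord n)) :
    rawToModel k n (x * y) = unitalGraft (rawToModel k n x) (rawToModel k n y) := by
  have zero_left : ∀ z : k × (GoodWord n →₀ k), unitalGraft 0 z = 0 := fun z => by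
    simp [unitalGraft]
  have zero_right : ∀ z : k × (GoodWord n →₀ k), unitalGraft z 0 = 0 := fun z => by
    simp [unitalGraft]
  induction x using MonoidAlgebra.induction_linear with
  | zero => rw [zero_mul, map_zero, zero_left]
  | add x x' hx hx' => rw [add_mul, map_add, map_add, unitalGraft_add_left, hx, hx']
  | single u a =>
    induction y using MonoidAlgebra.induction_linear with
    | zero => rw [mul_zero, map_zero, zero_right]
    | add y y' hy hy' => rw [mul_add, map_add, map_add, unitalGraft_add_right, hy, hy']
    | single v b =>
      rw [MonoidAlgebra.single_mul_single, rawToModel_single, rawToModel_single, rawToModel_single,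
        unitalGraft_smul_smul, modelWord_mul]

/-- The congruence on the free nonassociative algebra that is induced by the model. -/
noncomputable def modelCon (k : Type*) [Field k] (n : ℕ) : RingCon (MonoidAlgebra k (NAWord n)) where
  r x y := rawToModel k n x = rawToModel k n y
  iseqv := ⟨fun _ => rfl, Eq.symm, Eq.trans⟩
  add' h h' := by rw [map_add, map_add, h, h']
  mul' h h' := by rw [rawToModel_mul, rawToModel_mul, h, h']

theorem rightSymmCon_le_modelCon : rightSymmCon k n ≤ modelCon k n := by
  refine RingCon.ringConGen_le.2 ?_
  rintro _ _ ⟨x, y, z, rfl, rfl⟩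
  change rawToModel k n _ = rawToModel k n _
  simp only [map_sub, rawToModel_mul]
  exact unitalGraft_right_symm _ _ _

/-- The linear map from the free right-symmetric algebra to the model. -/
noncomputable def toModel (k : Type*) [Field k] (n : ℕ) :
    FreeRS k n →ₗ[k] k × (GoodWord n →₀ k) where
  toFun x := Quotient.liftOn' x (rawToModel k n) fun _ _ h => rightSymmCon_le_modelCon h
  map_add' x y := by
    obtain ⟨x, rfl⟩ := mk_surjective x
    obtain ⟨y, rfl⟩ := mk_surjective y
    exact map_add (rawToModel k n) x y
  map_smul' a x := by
    obtain ⟨x, rfl⟩ := mk_surjective x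
    exact map_smul (rawToModel k n) a x

theorem toModel_word (w : NAWord n) : toModel k n (word k w) = modelWord k w := by
  change rawToModel k n (MonoidAlgebra.single w 1) = _
  rw [rawToModel_single, one_smul]

end FreeRS

/-- Good words, including the empty word. -/
abbrev GoodNAWord (n : ℕ) : Type := {w : NAWord n // w.IsGood}

namespace GoodNAWord

variable {n : ℕ}

/-- The rank of a good word among all words. -/
def rk (w : GoodNAWord n) : ℕ := NAWord.rk w.1

theorem rk_injective : Function.Injective (rk (n := n)) := fun _ _ h =>
  Subtype.ext (NAWord.rk_injective h)

/-- The empty word as a good word. -/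
def one : GoodNAWord n := ⟨1, NAWord.isGood_one⟩

/-- A nonempty good word as a good word. -/
def coe (u : GoodWord n) : GoodNAWord n := ⟨(u.1 : NAWord n), NAWord.isGood_coe.2 u.2⟩

theorem coe_injective : Function.Injective (coe (n := n)) := fun _ _ h =>
  Subtype.ext (WithOne.coe_injective (congrArg Subtype.val h))

theorem one_ne_coe (u : GoodWord n) : one ≠ coe u := fun h =>
  WithOne.one_ne_coe (congrArg Subtype.val h)

theorem eq_one_or_coe (w : GoodNAWord n) : w = one ∨ ∃ u, w = coe u := by
  obtain ⟨w, hw⟩ := w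
  rcases NAWord.isGood_iff.1 hw with rfl | ⟨u, rfl⟩
  · exact Or.inl rfl
  · exact Or.inr ⟨u, rfl⟩

end GoodNAWord

namespace FreeRS

variable {k : Type*} [Field k] {n : ℕ}

theorem low_eq_span (N : ℕ) :
    low k n N = Submodule.span k ((fun w : GoodNAWord n => word k w.1) '' {w | w.rk < N}) := by
  refine congrArg (Submodule.span k) (Set.ext fun x => ?_)
  constructor
  · rintro ⟨w, h1, h2, rfl⟩; exact ⟨⟨w, h1⟩, h2, rfl⟩
  · rintro ⟨w, h, rfl⟩; exact ⟨w.1, w.2, h, rfl⟩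

/-- Independence may be tested in the model, where the images of the good words are unitriangular
over the obvious basis. -/
theorem linearIndependent_word :
    LinearIndependent k fun w : GoodNAWord n => word k w.1 := by
  classical
  -- The map `norm` only serves to produce a good word from the underlying word; it fixes good
  -- words.
  let b : GoodNAWord n → k × (GoodWord n →₀ k) := fun w =>
    WithOne.recOneCoe (motive := fun _ => k × (GoodWord n →₀ k)) (1, 0)
      (fun u => (0, Finsupp.single (GoodWord.norm u) 1)) w.1
  have hb1 : b GoodNAWord.one = (1, 0) := rfl
  have hbc : ∀ u, b (GoodNAWord.coe u) = (0, Finsupp.single u 1) := fun u => by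
    change ((0 : k), Finsupp.single (GoodWord.norm u.1) (1 : k)) = _
    rw [GoodWord.norm_val]
  have hb : LinearIndependent k b := by
    rw [linearIndependent_iff]
    intro c hc
    have h1 : ∀ w : GoodNAWord n, c w = 0 := by
      have key : ∀ (φ : k × (GoodWord n →₀ k) →ₗ[k] k) (w : GoodNAWord n),
          (∀ v, φ (b v) = if v = w then 1 else 0) → c w = 0 := by
        intro φ w h
        have h2 := congrArg φ hc
        rw [Finsupp.apply_linearCombination, map_zero, Finsupp.linearCombination_apply] at h2
        simpa [h, Finsupp.sum_ite_eq'] using h2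
      intro w
      rcases w.eq_one_or_coe with rfl | ⟨u, rfl⟩
      · refine key (LinearMap.fst k k _) _ fun v => ?_
        rcases v.eq_one_or_coe with rfl | ⟨v, rfl⟩
        · rw [hb1, if_pos rfl]; rfl
        · rw [hbc, if_neg (GoodNAWord.one_ne_coe v).symm]; rfl
      · refine key (Finsupp.lapply u ∘ₗ LinearMap.snd k k _) _ fun v => ?_
        rcases v.eq_one_or_coe with rfl | ⟨v, rfl⟩
        · rw [hb1, if_neg (GoodNAWord.one_ne_coe u)]; rfl
        · rw [hbc]
          simp [Finsupp.single_apply, GoodNAWord.coe_injective.eq_iff]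
    exact Finsupp.ext h1
  refine LinearIndependent.of_comp (toModel k n) ?_
  refine linearIndependent_of_triangular GoodNAWord.rk_injective hb fun w => ?_
  change toModel k n (word k w.1) - b w ∈ _
  rw [toModel_word]
  rcases w.eq_one_or_coe with rfl | ⟨u, rfl⟩
  · rw [hb1]
    change modelWord k (1 : NAWord n) - _ ∈ _
    rw [modelWord_one, sub_self]
    exact zero_mem _
  · rw [hbc]
    change modelWord k (u.1 : NAWord n) - _ ∈ _
    rw [modelWord_coe, Prod.mk_sub_mk, sub_zero]
    have h1 := GoodWord.value_sub_mem (k := k) u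
    refine (Submodule.span_le (p := (Submodule.span k (b '' {j | j.rk < (GoodNAWord.coe u).rk})).comap
      (LinearMap.inr k k _))).2 ?_ h1
    rintro _ ⟨v, hv, rfl⟩
    refine Submodule.subset_span ⟨GoodNAWord.coe v, GoodWord.rk_lt.2 hv, hbc v⟩

end FreeRS

/-! ## The ideal generated by one element -/

namespace GoodWord

variable {n : ℕ}

instance : LeftCommutative fun (v u : GoodWord n) => u * v := ⟨fun v w u => mul_right_comm u w v⟩

theorem mulList_perm (w : GoodWord n) {vs vs' : List (GoodWord n)} (h : vs.Perm vs') :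
    mulList w vs = mulList w vs' := h.foldr_eq _

end GoodWord

namespace FreeRS

variable {k : Type*} [Field k] {n : ℕ} {f : FreeRS k n} {w : GoodWord n}

/-- `IdealExpr f w e t`: `e` arises from `f` by multiplications by good words, and `t` arises from
`w` by the same multiplications. -/
inductive IdealExpr (f : FreeRS k n) (w : GoodWord n) : FreeRS k n → GoodWord n → Prop
  | self : IdealExpr f w f w
  | mul_right {e : FreeRS k n} {t : GoodWord n} (v : GoodWord n) :
      IdealExpr f w e t → IdealExpr f w (e * gw k v) (t * v)
  | mul_left {e : FreeRS k n} {t : GoodWord n} (u : GoodWord n) :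
      IdealExpr f w e t → IdealExpr f w (gw k u * e) (u * t)

/-- The span of the expressions of rank less than `N`. -/
noncomputable def exprLow (f : FreeRS k n) (w : GoodWord n) (N : ℕ) : Submodule k (FreeRS k n) :=
  Submodule.span k {e | ∃ t, IdealExpr f w e t ∧ t.rk < N}

theorem exists_idealExpr_iff {t : GoodWord n} : (∃ e, IdealExpr f w e t) ↔ GoodWord.Red w t := by
  constructor
  · rintro ⟨e, h⟩
    induction h with
    | self => exact .self
    | mul_right v _ ih => exact .mul_right v ih
    | mul_left u _ ih => exact .mul_left u ih
  · intro h
    induction h with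
    | self => exact ⟨_, .self⟩
    | mul_right v _ ih => obtain ⟨e, ih⟩ := ih; exact ⟨_, .mul_right v ih⟩
    | mul_left u _ ih => obtain ⟨e, ih⟩ := ih; exact ⟨_, .mul_left u ih⟩

theorem exprLow_mono {M N : ℕ} (h : M ≤ N) : exprLow f w M ≤ exprLow f w N :=
  Submodule.span_mono fun _ ⟨t, h1, h2⟩ => ⟨t, h1, h2.trans_le h⟩

theorem IdealExpr.mem_exprLow {e : FreeRS k n} {t : GoodWord n} (h : IdealExpr f w e t) {N : ℕ}
    (hN : t.rk < N) : e ∈ exprLow f w N := Submodule.subset_span ⟨t, h, hN⟩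

theorem exprLow_le_comap {N : ℕ} {S : Submodule k (FreeRS k n)} (φ : FreeRS k n →ₗ[k] FreeRS k n)
    (h : ∀ e t, IdealExpr f w e t → t.rk < N → φ e ∈ S) {p : FreeRS k n}
    (hp : p ∈ exprLow f w N) : φ p ∈ S := by
  refine (Submodule.span_le (p := S.comap φ)).2 ?_ hp
  rintro e ⟨t, h1, h2⟩
  exact h e t h1 h2

/-- Leading words multiply by `gw_mul_gw`, and the smaller terms stay smaller by monotonicity. -/
theorem IdealExpr.sub_mem (hf : f - gw k w ∈ low k n w.rk) {e : FreeRS k n} {t : GoodWord n}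
    (h : IdealExpr f w e t) : e - gw k t ∈ low k n t.rk := by
  induction h with
  | self => exact hf
  | mul_right v _ ih =>
    have := add_mem (mul_gw_mem (v := v) ih) (gw_mul_gw _ v)
    rwa [sub_mul, sub_add_sub_cancel] at this
  | mul_left u _ ih =>
    have := add_mem (gw_mul_mem (u := u) ih) (gw_mul_gw u _)
    rwa [mul_sub, sub_add_sub_cancel] at this

theorem exprLow_mul_gw {x v : GoodWord n} {p : FreeRS k n} (hp : p ∈ exprLow f w x.rk) :
    p * gw k v ∈ exprLow f w (x * v).rk :=
  exprLow_le_comap (LinearMap.mulRight k (gw k v)) (fun _ _ h ht => (h.mul_right v).mem_exprLow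
    (GoodWord.rk_lt.2 (GoodWord.mul_lt_mul_right (GoodWord.rk_lt.1 ht) v))) hp

theorem gw_mul_exprLow {u x : GoodWord n} {p : FreeRS k n} (hp : p ∈ exprLow f w x.rk) :
    gw k u * p ∈ exprLow f w (u * x).rk :=
  exprLow_le_comap (LinearMap.mulLeft k (gw k u)) (fun _ _ h ht => (h.mul_left u).mem_exprLow
    (GoodWord.rk_lt.2 (GoodWord.mul_lt_mul_left u (GoodWord.rk_lt.1 ht)))) hp

theorem gw_mul_exprLow_succ {u x : GoodWord n} {p : FreeRS k n}
    (hp : p ∈ exprLow f w (x.rk + 1)) {N : ℕ} (hN : (u * x).rk < N) :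
    gw k u * p ∈ exprLow f w N :=
  exprLow_le_comap (LinearMap.mulLeft k (gw k u)) (fun _ t h ht => (h.mul_left u).mem_exprLow (by
    rcases (GoodWord.rk_le.1 (Nat.lt_succ_iff.1 ht)).eq_or_lt with rfl | ht
    · exact hN
    · exact (GoodWord.rk_lt.2 (GoodWord.mul_lt_mul_left u ht)).trans hN)) hp

/-- Smaller words in the factor give smaller expressions; the empty word gives `e` itself, whose
leading word is shorter. -/
theorem IdealExpr.mul_low {e : FreeRS k n} {t v : GoodWord n} (h : IdealExpr f w e t)
    {p : FreeRS k n} (hp : p ∈ low k n v.rk) : e * p ∈ exprLow f w (t * v).rk := by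
  refine low_le_comap (LinearMap.mulLeft k e) (fun _ => ?_) (fun y hy => ?_) hp
  · rw [LinearMap.mulLeft_apply, mul_one]
    exact h.mem_exprLow (GoodWord.rk_lt.2 (GoodWord.lt_mul_right t v))
  · exact (h.mul_right y).mem_exprLow
      (GoodWord.rk_lt.2 (GoodWord.mul_lt_mul_left t (GoodWord.rk_lt.1 hy)))

theorem IdealExpr.low_mul {e : FreeRS k n} {t u : GoodWord n} (h : IdealExpr f w e t)
    {p : FreeRS k n} (hp : p ∈ low k n u.rk) : p * e ∈ exprLow f w (u * t).rk := by
  refine low_le_comap (LinearMap.mulRight k e) (fun _ => ?_) (fun y hy => ?_) hp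
  · rw [LinearMap.mulRight_apply, one_mul]
    exact h.mem_exprLow (GoodWord.rk_lt.2 (GoodWord.lt_mul_left u t))
  · exact (h.mul_left y).mem_exprLow
      (GoodWord.rk_lt.2 (GoodWord.mul_lt_mul_right (GoodWord.rk_lt.1 hy) t))

/-- The product of `a` and `b` involves only good words up to `a * b`, and `t * (a * b) < t * a *
b`. -/
theorem IdealExpr.mul_gw_mul_gw {e : FreeRS k n} {t : GoodWord n} (h : IdealExpr f w e t)
    (a b : GoodWord n) : e * (gw k a * gw k b) ∈ exprLow f w (t * a * b).rk := by
  rw [← sub_add_cancel (gw k a * gw k b) (gw k (a * b)), mul_add]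
  have h1 := GoodWord.rk_lt.2 (GoodWord.mul_mul_lt t a b)
  exact add_mem (exprLow_mono h1.le (h.mul_low (gw_mul_gw a b))) ((h.mul_right _).mem_exprLow h1)

/-- The product of `f` with a list of good words on the right. -/
noncomputable def mulList (f : FreeRS k n) (vs : List (GoodWord n)) : FreeRS k n :=
  vs.foldr (fun v e => e * gw k v) f

theorem mulList_cons (v : GoodWord n) (vs : List (GoodWord n)) :
    mulList f (v :: vs) = mulList f vs * gw k v := rfl

theorem idealExpr_mulList (vs : List (GoodWord n)) :
    IdealExpr f w (mulList f vs) (GoodWord.mulList w vs) := by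
  induction vs with
  | nil => exact .self
  | cons v vs ih => exact .mul_right v ih

/-- Exchanging adjacent factors changes the product by `e(ab) - e(ba)`, a combination of smaller
expressions. -/
theorem mulList_sub_mulList {vs vs' : List (GoodWord n)} (h : vs.Perm vs') :
    mulList f vs - mulList f vs' ∈ exprLow f w (GoodWord.mulList w vs).rk := by
  induction h with
  | nil => rw [sub_self]; exact zero_mem _
  | cons v _ ih => rw [mulList_cons, mulList_cons, ← sub_mul]; exact exprLow_mul_gw ih
  | swap a b vs =>
    have h := idealExpr_mulList (f := f) (w := w) vs
    have h1 : mulList f (b :: a :: vs) - mulList f (a :: b :: vs) =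
        mulList f vs * (gw k a * gw k b) - mulList f vs * (gw k b * gw k a) := by
      simp only [mulList_cons]
      rw [mul_right_comm']
      abel
    rw [h1]
    refine Submodule.sub_mem _ (h.mul_gw_mul_gw a b) ?_
    have h2 := h.mul_gw_mul_gw b a
    rwa [GoodWord.mul_right_comm] at h2
  | trans h1 _ ih1 ih2 =>
    rw [← GoodWord.mulList_perm w h1] at ih2
    have := add_mem ih1 ih2
    rwa [sub_add_sub_cancel] at this

/-- Modulo smaller expressions, every expression is a product of `f` with words on the right, or
the product of a good word and an expression. -/
theorem IdealExpr.exists_normal {e : FreeRS k n} {t : GoodWord n}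
    (h : IdealExpr f w e t) :
    (∃ vs, t = GoodWord.mulList w vs ∧ e - mulList f vs ∈ exprLow f w t.rk) ∨
    ∃ q g s, IdealExpr f w g s ∧ t = q * s ∧ e - gw k q * g ∈ exprLow f w t.rk := by
  induction h with
  | self => exact Or.inl ⟨[], rfl, by rw [mulList, List.foldr, sub_self]; exact zero_mem _⟩
  | mul_left u h _ => exact Or.inr ⟨u, _, _, h, rfl, by rw [sub_self]; exact zero_mem _⟩
  | @mul_right e t v h ih =>
    rcases ih with ⟨vs, rfl, h1⟩ | ⟨q, g, s, hg, rfl, h1⟩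
    · exact Or.inl ⟨v :: vs, rfl, by rw [mulList_cons, ← sub_mul]; exact exprLow_mul_gw h1⟩
    · refine Or.inr ⟨q * v, g, s, hg, GoodWord.mul_right_comm _ _ _, ?_⟩
      -- The factor `v` is moved past `g` by `(qg)v = (qv)g + q(gv) - q(vg)`; the last two terms are
      -- smaller expressions.
      have h2 : e * gw k v - gw k (q * v) * g = (e - gw k q * g) * gw k v +
          (gw k q * gw k v - gw k (q * v)) * g + gw k q * (g * gw k v)
            - gw k q * (gw k v * g) := by
        rw [sub_mul, sub_mul, mul_right_comm' _ g]
        abel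
      have h3 := hg.low_mul (gw_mul_gw q v)
      rw [GoodWord.mul_right_comm] at h3
      have h4 := GoodWord.mul_mul_lt q v s
      rw [GoodWord.mul_right_comm] at h4
      rw [h2]
      exact Submodule.sub_mem _ (add_mem (add_mem (exprLow_mul_gw h1) h3)
        (((hg.mul_right v).mul_left q).mem_exprLow (GoodWord.rk_lt.2 (GoodWord.mul_mul_lt q s v))))
        (((hg.mul_left v).mul_left q).mem_exprLow (GoodWord.rk_lt.2 h4))

/-- First overlap. By its length `s` is one of the factors `vs`, so up to smaller expressions the
two sides are `F·s` and `q·g`, where `F` has the leading word `q`. Both are compared with `F·g`, in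
which `f` occurs twice. -/
theorem mulList_sub_gw_mul (hf : f - gw k w ∈ low k n w.rk) {vs : List (GoodWord n)}
    {q s : GoodWord n} {g : FreeRS k n} (hg : IdealExpr f w g s)
    (h : GoodWord.mulList w vs = q * s) :
    mulList f vs - gw k q * g ∈ exprLow f w (q * s).rk := by
  obtain ⟨vs', h1, rfl⟩ := GoodWord.exists_perm_of_mulList_eq_mul h
    (exists_idealExpr_iff.1 ⟨g, hg⟩).length_le
  have h2 := mulList_sub_mulList (f := f) (w := w) h1
  rw [h, mulList_cons] at h2
  have h3 := idealExpr_mulList (f := f) (w := w) vs'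
  have h4 : mulList f vs - gw k (GoodWord.mulList w vs') * g =
      (mulList f vs - mulList f vs' * gw k s) +
      (mulList f vs' - gw k (GoodWord.mulList w vs')) * g - mulList f vs' * (g - gw k s) := by
    rw [sub_mul, mul_sub]
    abel
  rw [h4]
  exact Submodule.sub_mem _ (add_mem h2 (hg.low_mul (h3.sub_mem hf))) (h3.mul_low (hg.sub_mem hf))

theorem IdealExpr.mul_mem (hf : f - gw k w ∈ low k n w.rk) {g g' : FreeRS k n} {s s' : GoodWord n}
    (hg : IdealExpr f w g s) (hg' : IdealExpr f w g' s') :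
    g' * g ∈ exprLow f w ((s' * s).rk + 1) := by
  rw [← sub_add_cancel g' (gw k s'), add_mul]
  exact add_mem (exprLow_mono (Nat.le_succ _) (hg.low_mul (hg'.sub_mem hf)))
    ((hg.mul_left s').mem_exprLow (Nat.lt_succ_self _))

/-- Second overlap, where `f` may sit in either of two factors. The two sides are compared with
`(pg')g` and `(pg)g'`, which by right-symmetry differ only by `p(g'g)` and `p(gg')`, and these are
smaller. -/
theorem gw_mul_sub_gw_mul (hf : f - gw k w ∈ low k n w.rk) {p s s' : GoodWord n}
    {g g' : FreeRS k n} (hg : IdealExpr f w g s) (hg' : IdealExpr f w g' s') :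
    gw k (p * s') * g - gw k (p * s) * g' ∈ exprLow f w (p * s' * s).rk := by
  have h1 : gw k (p * s') * g - gw k (p * s) * g' =
      (gw k p * g - gw k (p * s)) * g' - (gw k p * g' - gw k (p * s')) * g +
      (gw k p * (g' * g) - gw k p * (g * g')) := by
    rw [sub_mul, sub_mul, mul_right_comm' _ g g']
    abel
  have h2 := hg'.low_mul ((hg.mul_left p).sub_mem hf)
  rw [GoodWord.mul_right_comm] at h2
  have h3 := GoodWord.mul_mul_lt p s s'
  rw [GoodWord.mul_right_comm] at h3
  rw [h1]
  exact add_mem (Submodule.sub_mem _ h2 (hg.low_mul ((hg'.mul_left p).sub_mem hf)))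
    (Submodule.sub_mem _
      (gw_mul_exprLow_succ (hg.mul_mem hf hg') (GoodWord.rk_lt.2 (GoodWord.mul_mul_lt p s' s)))
      (gw_mul_exprLow_succ (hg'.mul_mem hf hg) (GoodWord.rk_lt.2 h3)))

/-- Two expressions with the same leading word agree modulo smaller expressions. -/
theorem IdealExpr.sub_mem_exprLow (hf : f - gw k w ∈ low k n w.rk) {t : GoodWord n} :
    ∀ {e e' : FreeRS k n}, IdealExpr f w e t → IdealExpr f w e' t → e - e' ∈ exprLow f w t.rk := by
  induction t using WellFoundedLT.induction with
  | ind t IH =>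
  intro e e' h h'
  rcases h.exists_normal with ⟨vs, rfl, h1⟩ | ⟨q, g, s, hg, rfl, h1⟩
  · rcases h'.exists_normal with ⟨vs', h2, h1'⟩ | ⟨q', g', s', hg', h2, h1'⟩
    · have h3 := mulList_sub_mulList (f := f) (w := w) (GoodWord.perm_of_mulList_eq h2)
      have h4 := Submodule.sub_mem _ (add_mem h1 h3) h1'
      rwa [sub_add_sub_cancel, sub_sub_sub_cancel_right] at h4
    · have h3 := mulList_sub_gw_mul hf hg' h2
      rw [h2] at h1 h1' ⊢
      have h4 := Submodule.sub_mem _ (add_mem h1 h3) h1'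
      rwa [sub_add_sub_cancel, sub_sub_sub_cancel_right] at h4
  · rcases h'.exists_normal with ⟨vs', h2, h1'⟩ | ⟨q', g', s', hg', h2, h1'⟩
    · have h3 := mulList_sub_gw_mul hf hg h2.symm
      have h4 := Submodule.sub_mem _ (Submodule.sub_mem _ h1 h3) h1'
      rwa [sub_sub_sub_cancel_right, sub_sub_sub_cancel_right] at h4
    · have h3 : gw k q * g - gw k q' * g' ∈ exprLow f w (q * s).rk := by
        -- Either `f` sits in the same factor of both expressions, and the induction applies to this
        -- shorter factor, or in two different factors.
        rcases GoodWord.eq_of_mul_eq_mul h2 with ⟨rfl, rfl⟩ | ⟨p, rfl, rfl⟩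
        · rw [← mul_sub]
          exact gw_mul_exprLow (IH s (GoodWord.lt_mul_left q s) hg hg')
        · exact gw_mul_sub_gw_mul hf hg hg'
      have h4 := Submodule.sub_mem _ (add_mem h1 h3) h1'
      rwa [sub_add_sub_cancel, sub_sub_sub_cancel_right] at h4

/-- The span of a choice of one expression for each leading word. -/
theorem exprLow_eq_span (hf : f - gw k w ∈ low k n w.rk) {e : GoodWord n → FreeRS k n}
    (he : ∀ t, GoodWord.Red w t → IdealExpr f w (e t) t) (N : ℕ) :
    exprLow f w N = Submodule.span k (e '' {t | GoodWord.Red w t ∧ t.rk < N}) := by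
  induction N using Nat.strong_induction_on with
  | _ N ih =>
  apply le_antisymm <;> refine Submodule.span_le.2 ?_
  · rintro x ⟨t, ht, hN⟩
    have hr := exists_idealExpr_iff.1 ⟨x, ht⟩
    have h := ht.sub_mem_exprLow hf (he t hr)
    rw [ih _ hN] at h
    rw [← sub_add_cancel x (e t)]
    have hsub : {s | GoodWord.Red w s ∧ s.rk < t.rk} ⊆ {s | GoodWord.Red w s ∧ s.rk < N} := by
      rintro s ⟨hs, hst⟩
      exact ⟨hs, hst.trans hN⟩
    exact add_mem (Submodule.span_mono (Set.image_mono hsub) h)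
      (Submodule.subset_span ⟨t, ⟨hr, hN⟩, rfl⟩)
  · rintro _ ⟨t, ⟨hr, hN⟩, rfl⟩
    exact (he t hr).mem_exprLow hN

/-! ### The ideal as the span of expressions. -/

theorem smul_mem_ideal {x : FreeRS k n} (a : k) (hx : x ∈ ideal f) : a • x ∈ ideal f := by
  have := (ideal f).mul_mem_left (a • (1 : FreeRS k n)) x hx
  rwa [smul_mul_assoc, one_mul] at this

theorem self_mem_ideal (f : FreeRS k n) : f ∈ ideal f := TwoSidedIdeal.subset_span (Set.mem_singleton f)

theorem IdealExpr.mem_ideal {e : FreeRS k n} {t : GoodWord n} (h : IdealExpr f w e t) :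
    e ∈ ideal f := by
  induction h with
  | self => exact self_mem_ideal f
  | mul_right v _ ih => exact (ideal f).mul_mem_right _ _ ih
  | mul_left u _ ih => exact (ideal f).mul_mem_left _ _ ih

/-- The combinations of expressions form a two-sided ideal that contains `f`, because every
multiplier is a combination of `1` and nonempty good words. -/
theorem exists_mem_exprLow_of_mem_ideal {x : FreeRS k n} (hx : x ∈ ideal f) :
    ∃ N, x ∈ exprLow f w N := by
  have hmul : ∀ y x : FreeRS k n, ∀ N, x ∈ exprLow f w N →
      (∃ M, y * x ∈ exprLow f w M) ∧ ∃ M, x * y ∈ exprLow f w M := by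
    intro y x N hx
    obtain ⟨K, hK⟩ := exists_mem_low y
    let T : Submodule k (FreeRS k n) := Submodule.span k {e | ∃ t, IdealExpr f w e t}
    have hT : ∀ z ∈ T, ∃ M, z ∈ exprLow f w M := by
      intro z hz
      induction hz using Submodule.span_induction with
      | mem e he => obtain ⟨t, ht⟩ := he; exact ⟨_, ht.mem_exprLow (Nat.lt_succ_self _)⟩
      | zero => exact ⟨0, zero_mem _⟩
      | add x y _ _ h h' =>
        obtain ⟨M, h⟩ := h
        obtain ⟨M', h'⟩ := h'
        exact ⟨max M M', add_mem (exprLow_mono (le_max_left _ _) h)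
          (exprLow_mono (le_max_right _ _) h')⟩
      | smul a x _ h => obtain ⟨M, h⟩ := h; exact ⟨M, Submodule.smul_mem _ _ h⟩
    constructor
    · refine hT _ (exprLow_le_comap (LinearMap.mulLeft k y) (fun e t he _ => ?_) hx)
      refine low_le_comap (LinearMap.mulRight k e) (fun _ => ?_) (fun u _ => ?_) hK
      · rw [LinearMap.mulRight_apply, one_mul]; exact Submodule.subset_span ⟨t, he⟩
      · exact Submodule.subset_span ⟨_, he.mul_left u⟩
    · refine hT _ (exprLow_le_comap (LinearMap.mulRight k y) (fun e t he _ => ?_) hx)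
      refine low_le_comap (LinearMap.mulLeft k e) (fun _ => ?_) (fun u _ => ?_) hK
      · rw [LinearMap.mulLeft_apply, mul_one]; exact Submodule.subset_span ⟨t, he⟩
      · exact Submodule.subset_span ⟨_, he.mul_right u⟩
  let I : TwoSidedIdeal (FreeRS k n) := TwoSidedIdeal.mk' {x | ∃ N, x ∈ exprLow f w N}
    ⟨0, zero_mem _⟩
    (by
      rintro x y ⟨M, h⟩ ⟨N, h'⟩
      exact ⟨max M N, add_mem (exprLow_mono (le_max_left _ _) h)
        (exprLow_mono (le_max_right _ _) h')⟩)
    (by rintro x ⟨M, h⟩; exact ⟨M, neg_mem h⟩)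
    (by rintro y x ⟨N, h⟩; exact (hmul y x N h).1)
    (by rintro x y ⟨N, h⟩; exact (hmul y x N h).2)
  have hI : ∀ z, z ∈ I ↔ ∃ N, z ∈ exprLow f w N := fun z => by
    rw [TwoSidedIdeal.mem_mk']; rfl
  refine (hI x).1 (TwoSidedIdeal.mem_span_iff.1 hx I ?_)
  rintro _ rfl
  exact (hI _).2 ⟨_, IdealExpr.self.mem_exprLow (Nat.lt_succ_self _)⟩

end FreeRS

/-- The good words that are multiples of a given one in the NAP magma with unit adjoined. -/
def GoodNAWord.redSet {n : ℕ} (v : GoodNAWord n) : Set (GoodNAWord n) :=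
  {u | v = one ∨ ∃ a b, v = coe a ∧ u = coe b ∧ GoodWord.Red a b}

namespace FreeRS

variable {k : Type*} [Field k] {n : ℕ}

theorem ideal_smul_le {f : FreeRS k n} (c : k) : ideal (c • f) ≤ ideal f := by
  intro x hx
  refine TwoSidedIdeal.mem_span_iff.1 hx _ ?_
  rintro _ rfl
  exact smul_mem_ideal c (self_mem_ideal f)

theorem ideal_smul {f : FreeRS k n} {c : k} (hc : c ≠ 0) : ideal (c • f) = ideal f := by
  refine le_antisymm (ideal_smul_le c) ?_
  conv_lhs => rw [← inv_smul_smul₀ hc f]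
  exact ideal_smul_le c⁻¹

theorem low_zero : low k n 0 = ⊥ := by
  refine (Submodule.span_eq_bot).2 ?_
  rintro _ ⟨w, -, h, -⟩
  exact absurd h (Nat.not_lt_zero _)

/-- The ideal generated by an element with leading word `v` is spanned by monic elements, one for
each multiple of `v` as leading word. -/
theorem exists_triangular_basis {f : FreeRS k n} {c : k} (hc : c ≠ 0) {v : GoodNAWord n}
    (hf : f - c • word k v.1 ∈ low k n v.rk) :
    ∃ e : GoodNAWord n → FreeRS k n, (∀ u, e u - word k u.1 ∈ low k n u.rk) ∧
      (∀ u ∉ v.redSet, e u = word k u.1) ∧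
      ∀ x, x ∈ ideal f ↔ x ∈ Submodule.span k (e '' v.redSet) := by
  classical
  rcases v.eq_one_or_coe with rfl | ⟨w, rfl⟩
  · refine ⟨fun u => word k u.1, fun u => by rw [sub_self]; exact zero_mem _, fun _ _ => rfl,
      fun x => ?_⟩
    -- No word has negative rank, so leading word `1` means a nonzero constant, and the ideal is the
    -- whole algebra.
    have h1 : f = c • 1 := by
      change f - c • word k 1 ∈ low k n 0 at hf
      rwa [low_zero, Submodule.mem_bot, sub_eq_zero] at hf
    refine iff_of_true ?_ ?_
    · have h2 : (1 : FreeRS k n) ∈ ideal f := by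
        have := smul_mem_ideal c⁻¹ (self_mem_ideal f)
        rwa [h1, inv_smul_smul₀ hc, ← h1] at this
      have := (ideal f).mul_mem_left x 1 h2
      rwa [mul_one] at this
    · obtain ⟨N, hN⟩ := exists_mem_low x
      rw [low_eq_span] at hN
      exact Submodule.span_mono (Set.image_mono fun u _ => Or.inl rfl) hN
  · have hf' : c⁻¹ • f - gw k w ∈ low k n w.rk := by
      have := Submodule.smul_mem _ c⁻¹ hf
      rwa [smul_sub, inv_smul_smul₀ hc] at this
    have hred : ∀ t, ∃ e : FreeRS k n, GoodWord.Red w t → IdealExpr (c⁻¹ • f) w e t := fun t => by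
      by_cases h : GoodWord.Red w t
      · obtain ⟨e, he⟩ := exists_idealExpr_iff (f := c⁻¹ • f).2 h; exact ⟨e, fun _ => he⟩
      · exact ⟨0, fun h' => absurd h' h⟩
    choose e he using hred
    have hset : ∀ u, GoodNAWord.coe u ∈ (GoodNAWord.coe w).redSet ↔ GoodWord.Red w u := by
      intro u
      constructor
      · rintro (h | ⟨a, b, h, h', hab⟩)
        · exact absurd h.symm (GoodNAWord.one_ne_coe _)
        · rwa [GoodNAWord.coe_injective h, GoodNAWord.coe_injective h']
      · exact fun h => Or.inr ⟨w, u, rfl, rfl, h⟩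
    -- Outside `redSet` the family is completed by the good words, so that it is triangular over all
    -- of them. The value `1` at the empty word is never used, as the empty word is not a multiple
    -- of `w`.
    let E : GoodNAWord n → FreeRS k n := fun u =>
      if u ∈ (GoodNAWord.coe w).redSet then
        WithOne.recOneCoe (motive := fun _ => FreeRS k n) 1 (fun a => e (GoodWord.norm a)) u.1
      else word k u.1
    have hE : ∀ u, GoodWord.Red w u → E (GoodNAWord.coe u) = e u := fun u hu => by
      change (if _ then _ else _) = _
      rw [if_pos ((hset u).2 hu)]
      change e (GoodWord.norm u.1) = _
      rw [GoodWord.norm_val]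
    refine ⟨E, fun u => ?_, fun u hu => if_neg hu, fun x => ?_⟩
    · by_cases hu : u ∈ (GoodNAWord.coe w).redSet
      · obtain h | ⟨a, u, h, rfl, hr⟩ := id hu
        · exact absurd h.symm (GoodNAWord.one_ne_coe _)
        · rw [hE _ ((hset u).1 hu)]
          exact (he u ((hset u).1 hu)).sub_mem hf'
      · change (if _ then _ else _) - _ ∈ _
        rw [if_neg hu, sub_self]; exact zero_mem _
    · rw [← ideal_smul (f := f) (inv_ne_zero hc)]
      constructor
      · intro hx
        obtain ⟨N, hN⟩ := exists_mem_exprLow_of_mem_ideal (w := w) hx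
        rw [exprLow_eq_span hf' he] at hN
        refine Submodule.span_mono ?_ hN
        rintro _ ⟨t, ⟨ht, -⟩, rfl⟩
        exact ⟨GoodNAWord.coe t, (hset t).2 ht, hE t ht⟩
      · intro hx
        induction hx using Submodule.span_induction with
        | mem y hy =>
          obtain ⟨u, hu, rfl⟩ := hy
          obtain h | ⟨a, u, h, rfl, hr⟩ := id hu
          · exact absurd h.symm (GoodNAWord.one_ne_coe _)
          · rw [hE _ ((hset u).1 hu)]
            exact (he u ((hset u).1 hu)).mem_ideal
        | zero => exact zero_mem _
        | add x y _ _ h h' => exact add_mem h h'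
        | smul a x _ h => exact smul_mem_ideal a h

end FreeRS

/-! ## Leading words of the elements of an ideal -/

namespace NAWord

variable {n : ℕ}

theorem finite_deg_le (D : ℕ) : {w : NAWord n | w.deg ≤ D}.Finite := by
  refine Set.Finite.subset ((Set.finite_Iic (rankBound n D)).preimage
    (rk_injective (n := n)).injOn) fun w (hw : w.deg ≤ D) => ?_
  obtain rfl | ⟨u, rfl⟩ := eq_one_or_coe w
  · exact Nat.zero_le _
  · exact rank_lt_rankBound u D (Nat.le_succ_of_le hw)

end NAWord

namespace FreeRS

variable {k : Type*} [Field k] {n : ℕ}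

theorem low_eq_span_image (N : ℕ) :
    low k n N = Submodule.span k (word k '' {w : NAWord n | w.IsGood ∧ w.rk < N}) := by
  refine congrArg (Submodule.span k) (Set.ext fun x => ?_)
  constructor
  · rintro ⟨w, h1, h2, rfl⟩; exact ⟨w, ⟨h1, h2⟩, rfl⟩
  · rintro ⟨w, ⟨h1, h2⟩, rfl⟩; exact ⟨w, h1, h2, rfl⟩

theorem exists_lead {N : ℕ} {x : FreeRS k n} (hx : x ∈ low k n N) (h0 : x ≠ 0) :
    ∃ (c : k) (v : GoodNAWord n), c ≠ 0 ∧ v.rk < N ∧ x - c • word k v.1 ∈ low k n v.rk := by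
  rw [low_eq_span, Finsupp.mem_span_image_iff_linearCombination] at hx
  obtain ⟨c, hc, rfl⟩ := hx
  have hc0 : c ≠ 0 := by rintro rfl; exact h0 (map_zero _)
  obtain ⟨v, hv, -, h⟩ := exists_leading_index (k := k) (e := fun w : GoodNAWord n => word k w.1)
    GoodNAWord.rk_injective (fun i => by rw [sub_self]; exact zero_mem _) hc0
  refine ⟨c v, v, Finsupp.mem_support_iff.1 hv, hc hv, ?_⟩
  rw [low_eq_span]
  exact h

/-- Otherwise the word `v` would be a combination of good words of smaller rank, against
independence. -/
theorem lead_not_lt {x : FreeRS k n} {c d : k} {u v : GoodNAWord n} (hd : d ≠ 0)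
    (hu : x - c • word k u.1 ∈ low k n u.rk) (hv : x - d • word k v.1 ∈ low k n v.rk) :
    ¬ u.rk < v.rk := by
  intro h
  have h1 : x ∈ low k n v.rk := by
    rw [← sub_add_cancel x (c • word k u.1)]
    exact add_mem (low_mono h.le hu) (Submodule.smul_mem _ _ (word_mem_low u.2 h))
  have h2 := Submodule.sub_mem _ h1 hv
  rw [sub_sub_cancel, Submodule.smul_mem_iff _ hd, low_eq_span] at h2
  exact (linearIndependent_word (k := k) (n := n)).notMem_span_image
    (s := {w | w.rk < v.rk}) (x := v) (lt_irrefl v.rk) h2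

theorem lead_unique {x : FreeRS k n} {c d : k} {u v : GoodNAWord n} (hc : c ≠ 0) (hd : d ≠ 0)
    (hu : x - c • word k u.1 ∈ low k n u.rk) (hv : x - d • word k v.1 ∈ low k n v.rk) : u = v := by
  have h1 := lead_not_lt hd hu hv
  have h2 := lead_not_lt hc hv hu
  exact GoodNAWord.rk_injective (by omega)

/-- The leading words of the elements of `(f)`. -/
def leadSet (f : FreeRS k n) : Set (GoodNAWord n) :=
  {v | ∃ x ∈ ideal f, x - word k v.1 ∈ low k n v.rk}

theorem mem_leadSet {f x : FreeRS k n} (hx : x ∈ ideal f) {c : k} (hc : c ≠ 0) {v : GoodNAWord n}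
    (h : x - c • word k v.1 ∈ low k n v.rk) : v ∈ leadSet f := by
  refine ⟨c⁻¹ • x, smul_mem_ideal _ hx, ?_⟩
  have := Submodule.smul_mem _ c⁻¹ h
  rwa [smul_sub, inv_smul_smul₀ hc] at this

theorem ideal_zero_mem {x : FreeRS k n} : x ∈ ideal (0 : FreeRS k n) ↔ x = 0 := by
  constructor
  · intro h
    have := TwoSidedIdeal.mem_span_iff.1 h ⊥ (by rintro _ rfl; exact zero_mem _)
    simpa using this
  · rintro rfl; exact zero_mem _

theorem leadSet_zero : leadSet (0 : FreeRS k n) = ∅ := by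
  refine Set.eq_empty_iff_forall_notMem.2 fun v => ?_
  rintro ⟨x, hx, h⟩
  rw [ideal_zero_mem.1 hx] at h
  have h1 : (0 : FreeRS k n) - (1 : k) • word k v.1 ∈ low k n v.rk := by rwa [one_smul]
  rw [zero_sub, neg_mem_iff, one_smul, low_eq_span] at h1
  exact (linearIndependent_word (k := k) (n := n)).notMem_span_image
    (s := {w | w.rk < v.rk}) (x := v) (lt_irrefl v.rk) h1

/-- An element of the ideal is a combination of the triangular family over `redSet`, and the
greatest index in it is its leading word. So the leading word of `f` alone determines those of the
ideal. -/
theorem leadSet_eq_redSet {f : FreeRS k n} {c : k} (hc : c ≠ 0) {v : GoodNAWord n}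
    (hf : f - c • word k v.1 ∈ low k n v.rk) : leadSet f = v.redSet := by
  obtain ⟨e, h1, h2, h3⟩ := exists_triangular_basis hc hf
  refine Set.Subset.antisymm ?_ ?_
  · rintro u ⟨x, hx, hxu⟩
    have h4 := (h3 x).1 hx
    rw [Finsupp.mem_span_image_iff_linearCombination] at h4
    obtain ⟨a, ha, rfl⟩ := h4
    have ha0 : a ≠ 0 := by
      rintro rfl
      rw [map_zero] at hxu
      have h5 : u ∈ leadSet (0 : FreeRS k n) := ⟨0, zero_mem _, hxu⟩
      rw [leadSet_zero] at h5
      exact h5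
    obtain ⟨i, hi, -, h5⟩ := exists_leading_index (k := k) GoodNAWord.rk_injective
      (b := fun w : GoodNAWord n => word k w.1) (fun i => by rw [← low_eq_span]; exact h1 i) ha0
    rw [← low_eq_span] at h5
    have h6 := lead_unique (Finsupp.mem_support_iff.1 hi) one_ne_zero h5 (by rwa [one_smul])
    rw [← h6]
    exact ha hi
  · intro u hu
    exact ⟨e u, (h3 _).2 (Submodule.subset_span ⟨u, hu, rfl⟩), h1 u⟩

theorem isLeadingWord_of_sub_mem {g : FreeRS k n} {v : GoodNAWord n}
    (h : g - word k v.1 ∈ low k n v.rk) : IsLeadingWord g v.1 := by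
  rw [low_eq_span_image, Finsupp.mem_span_image_iff_linearCombination] at h
  obtain ⟨l, hl, h⟩ := h
  have hlv : l v.1 = 0 := by
    by_contra h0
    exact lt_irrefl _ (hl (Finsupp.mem_support_iff.2 h0)).2
  have hs : ∀ u ∈ (Finsupp.single v.1 1 + l).support, u = v.1 ∨ (u.IsGood ∧ u.rk < v.1.rk) := by
    intro u hu
    by_contra! h1
    obtain ⟨h1, h2⟩ := h1
    rw [Finsupp.mem_support_iff, Finsupp.add_apply, Finsupp.single_eq_of_ne h1, zero_add] at hu
    have h3 := hl (Finsupp.mem_support_iff.2 hu)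
    exact absurd h3.2 (h2 h3.1).not_gt
  refine ⟨Finsupp.single v.1 1 + l, fun u hu => ?_, ?_, ?_, fun u hu => ?_⟩
  · rcases hs u hu with rfl | h1
    · exact v.2
    · exact h1.1
  · rw [← Finsupp.linearCombination_apply, map_add, h, Finsupp.linearCombination_single, one_smul,
      add_sub_cancel]
  · rw [Finsupp.mem_support_iff, Finsupp.add_apply, hlv, add_zero, Finsupp.single_eq_same]
    exact one_ne_zero
  · rw [NAWord.lt_iff_rk]
    exact (hs u hu).imp_right And.right

theorem mem_low_of_isLeadingWord {g : FreeRS k n} {v : NAWord n} (h : IsLeadingWord g v) :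
    g ∈ low k n (v.rk + 1) := by
  obtain ⟨c, h1, rfl, -, h2⟩ := h
  refine Submodule.sum_mem _ fun u hu => Submodule.smul_mem _ _ (word_mem_low (h1 u hu) ?_)
  rcases h2 u hu with rfl | h
  · exact Nat.lt_succ_self _
  · exact (NAWord.lt_iff_rk.1 h).trans (Nat.lt_succ_self _)

/-! ### Enumeration of the leading words of the ideal. -/

open Classical in
/-- The number of leading words of elements of `(f)` that have rank less than `N`. -/
noncomputable def leadCount (f : FreeRS k n) (N : ℕ) : ℕ :=
  Nat.count (fun m => ∃ v ∈ leadSet f, v.rk = m) N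

theorem leadCount_mono (f : FreeRS k n) : Monotone (leadCount f) := by
  classical
  exact Nat.count_monotone _

/-- The `i`-th leading word, counted from zero, has exactly `i` predecessors; either alternative
guarantees that it exists. -/
theorem exists_leadCount_eq {f : FreeRS k n} {i : ℕ}
    (h : (leadSet f).Infinite ∨ ∃ N, i < leadCount f N) : ∃ v ∈ leadSet f, leadCount f v.rk = i := by
  classical
  have h1 : ∀ hf : {m | ∃ v ∈ leadSet f, v.rk = m}.Finite, i < hf.toFinset.card := by
    intro hf
    rcases h with h | ⟨N, h⟩
    · exact absurd (hf.subset (s := GoodNAWord.rk '' leadSet f) fun _ h => h)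
        (h.image GoodNAWord.rk_injective.injOn)
    · refine lt_of_lt_of_le h ?_
      rw [leadCount]
      exact Nat.count_le_card hf N
  obtain ⟨v, hv, h2⟩ := Nat.nth_mem (p := fun m => ∃ v ∈ leadSet f, v.rk = m) i h1
  refine ⟨v, hv, ?_⟩
  rw [h2, leadCount]
  exact Nat.count_nth h1

/-- An enumeration of monic elements of `(f)`, one for each leading word and in the order of their
leading words, is a leading basis. -/
theorem isLeadingBasis_of_enumeration {f : FreeRS k n} {e : ℕ → Option (FreeRS k n × NAWord n)}
    (h1 : ∀ i g w, e i = some (g, w) → ∃ v ∈ leadSet f, v.1 = w ∧ g ∈ ideal f ∧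
      g - word k v.1 ∈ low k n v.rk ∧ leadCount f v.rk = i)
    (h2 : ∀ v ∈ leadSet f, ∃ g, e (leadCount f v.rk) = some (g, v.1)) : IsLeadingBasis f e := by
  classical
  -- The listed elements are completed by good words outside `leadSet`, which makes the family
  -- triangular over all good words and hence independent.
  have hG : ∀ v : GoodNAWord n, ∃ g, g - word k v.1 ∈ low k n v.rk ∧
      (v ∈ leadSet f → g ∈ ideal f ∧ e (leadCount f v.rk) = some (g, v.1)) := by
    intro v
    by_cases hv : v ∈ leadSet f
    · obtain ⟨g, hg⟩ := h2 v hv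
      obtain ⟨v', -, h3, h4, h5, -⟩ := h1 _ _ _ hg
      obtain rfl : v' = v := Subtype.ext h3
      exact ⟨g, h5, fun _ => ⟨h4, hg⟩⟩
    · exact ⟨word k v.1, by rw [sub_self]; exact zero_mem _, fun h => absurd h hv⟩
  choose G hG1 hG2 using hG
  have hGi : LinearIndependent k G := linearIndependent_of_triangular GoodNAWord.rk_injective
    linearIndependent_word fun v => by rw [← low_eq_span]; exact hG1 v
  have he : ∀ i g w, e i = some (g, w) →
      ∃ v ∈ leadSet f, v.1 = w ∧ G v = g ∧ leadCount f v.rk = i := by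
    intro i g w h
    obtain ⟨v, hv, h3, -, -, h4⟩ := h1 i g w h
    have h5 := (hG2 v hv).2
    rw [h4, h] at h5
    injection h5 with h5
    injection h5 with h5 h6
    exact ⟨v, hv, h3, h5.symm, h4⟩
  -- Division: the leading term of an element of the ideal is removed by the listed element with the
  -- same leading word, and the rank decreases.
  have hspan : ∀ N, ∀ x ∈ ideal f, x ∈ low k n N →
      x ∈ Submodule.span k (G '' {v | v ∈ leadSet f ∧ v.rk < N}) := by
    intro N
    induction N using Nat.strong_induction_on with
    | _ N ih =>
    intro x hx hN
    by_cases h0 : x = 0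
    · rw [h0]; exact zero_mem _
    obtain ⟨c, v, hc, hvN, h3⟩ := exists_lead hN h0
    have hv := mem_leadSet hx hc h3
    have h4 : x - c • G v ∈ low k n v.rk := by
      have h5 : x - c • G v = (x - c • word k v.1) - c • (G v - word k v.1) := by module
      rw [h5]
      exact Submodule.sub_mem _ h3 (Submodule.smul_mem _ _ (hG1 v))
    have h5 := ih _ hvN _ (sub_mem hx (smul_mem_ideal c (hG2 v hv).1)) h4
    have hsub : {u | u ∈ leadSet f ∧ u.rk < v.rk} ⊆ {u | u ∈ leadSet f ∧ u.rk < N} := by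
      rintro u ⟨hu, huv⟩
      exact ⟨hu, huv.trans hvN⟩
    rw [← sub_add_cancel x (c • G v)]
    exact add_mem (Submodule.span_mono (Set.image_mono hsub) h5)
      (Submodule.smul_mem _ _ (Submodule.subset_span ⟨v, ⟨hv, hvN⟩, rfl⟩))
  have hideal : ∀ x, x ∈ Submodule.span k {g | ∃ i w, e i = some (g, w)} → x ∈ ideal f := by
    intro x hx
    induction hx using Submodule.span_induction with
    | mem g hg =>
      obtain ⟨i, w, hg⟩ := hg
      obtain ⟨v, -, -, h, -⟩ := h1 i g w hg
      exact h
    | zero => exact zero_mem _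
    | add x y _ _ h h' => exact add_mem h h'
    | smul a x _ h => exact smul_mem_ideal a h
  refine ⟨?_, ?_, ?_, ?_, ?_, ?_, ?_⟩
  · intro i j hij hj
    obtain ⟨⟨g, w⟩, hgw⟩ := Option.isSome_iff_exists.1 hj
    obtain ⟨v, hv, -, -, -, hj'⟩ := h1 j g w hgw
    rcases hij.eq_or_lt with rfl | hij
    · exact hj
    · obtain ⟨u, hu, rfl⟩ := exists_leadCount_eq (Or.inr ⟨v.rk, hj'.symm ▸ hij⟩)
      obtain ⟨g', hg'⟩ := h2 u hu
      rw [hg']; rfl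
  · have hv : ∀ i : {i : ℕ // (e i).isSome}, ∃ v, G v = ((e i).get i.2).1 ∧ leadCount f v.rk = i := by
      rintro ⟨i, hi⟩
      obtain ⟨⟨g, w⟩, hgw⟩ := Option.isSome_iff_exists.1 hi
      obtain ⟨v, -, -, h3, h4⟩ := he i g w hgw
      exact ⟨v, by simp [hgw, h3], h4⟩
    choose φ hφ1 hφ2 using hv
    have h3 : Function.Injective φ := fun i j hij => Subtype.ext (by rw [← hφ2 i, hij, hφ2 j])
    have h4 := hGi.comp φ h3
    exact (funext hφ1 : G ∘ φ = _) ▸ h4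
  · refine Set.Subset.antisymm (fun x hx => hideal x hx) fun x hx => ?_
    obtain ⟨N, hN⟩ := exists_mem_low x
    refine Submodule.span_mono ?_ (hspan N x hx hN)
    rintro _ ⟨v, ⟨hv, -⟩, rfl⟩
    exact ⟨_, _, (hG2 v hv).2⟩
  · intro i g w h
    obtain ⟨v, -, rfl, -, h3, -⟩ := h1 i g w h
    exact isLeadingWord_of_sub_mem h3
  · intro i j g h u v hij hi hj
    obtain ⟨u, -, rfl, -, -, h3⟩ := h1 i g u hi
    obtain ⟨v, -, rfl, -, -, h4⟩ := h1 j h v hj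
    rw [NAWord.lt_iff_rk]
    by_contra hlt
    have := leadCount_mono f (not_lt.1 hlt)
    change leadCount f v.rk ≤ leadCount f u.rk at this
    omega
  · intro D
    refine ((NAWord.finite_deg_le (n := n) D).image fun w => leadCount f w.rk).subset ?_
    rintro i ⟨g, w, h, hw⟩
    obtain ⟨v, -, rfl, -, -, h3⟩ := h1 i g w h
    exact ⟨v.1, hw, h3⟩
  · intro x v hv
    constructor
    · intro hx
      -- Division of `x` uses only leading words of rank at most that of `v`, and the rank order
      -- refines the degree.
      refine Submodule.span_mono ?_ (hspan _ x hx (mem_low_of_isLeadingWord hv))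
      rintro _ ⟨u, ⟨hu, huv⟩, rfl⟩
      exact ⟨_, _, (hG2 u hu).2, NAWord.deg_le_of_rk_le (Nat.lt_succ_iff.1 huv)⟩
    · intro hx
      refine hideal x (Submodule.span_mono ?_ hx)
      rintro g ⟨i, w, h, -⟩
      exact ⟨i, w, h⟩

theorem leadCount_injOn {f : FreeRS k n} {u v : GoodNAWord n} (hu : u ∈ leadSet f)
    (hv : v ∈ leadSet f) (h : leadCount f u.rk = leadCount f v.rk) : u = v := by
  classical
  rcases lt_trichotomy u.rk v.rk with h1 | h1 | h1
  · exact absurd h (Nat.count_strict_mono ⟨u, hu, rfl⟩ h1).ne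
  · exact GoodNAWord.rk_injective h1
  · exact absurd h (Nat.count_strict_mono ⟨v, hv, rfl⟩ h1).ne'

theorem exists_isLeadingBasis (f : FreeRS k n) : ∃ e, IsLeadingBasis f e := by
  classical
  choose g hg1 hg2 using fun v : leadSet f => v.2
  let e : ℕ → Option (FreeRS k n × NAWord n) := fun i =>
    if h : ∃ v : leadSet f, leadCount f v.1.rk = i then some (g h.choose, h.choose.1.1) else none
  refine ⟨e, isLeadingBasis_of_enumeration (fun i x w h => ?_) fun v hv => ?_⟩
  · by_cases hi : ∃ v : leadSet f, leadCount f v.1.rk = i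
    · simp only [e, dif_pos hi, Option.some.injEq, Prod.mk.injEq] at h
      obtain ⟨rfl, rfl⟩ := h
      exact ⟨_, hi.choose.2, rfl, hg1 _, hg2 _, hi.choose_spec⟩
    · simp only [e, dif_neg hi] at h
      cases h
  · have hi : ∃ u : leadSet f, leadCount f u.1.rk = leadCount f v.rk := ⟨⟨v, hv⟩, rfl⟩
    have h3 : hi.choose.1 = v := leadCount_injOn hi.choose.2 hv hi.choose_spec
    refine ⟨g hi.choose, ?_⟩
    simp only [e, dif_pos hi, h3]

end FreeRS

/-! ## Computable list operations and unbounded search -/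

namespace Computable

variable {α β γ σ : Type*} [Primcodable α] [Primcodable β] [Primcodable γ] [Primcodable σ]

/-- A fold is a recursion on the position in the list. The default for a missing entry is harmless,
as only positions below the length occur. -/
theorem list_foldl {f : α → List β} {g : α → σ} {h : α → σ × β → σ} (hf : Computable f)
    (hg : Computable g) (hh : Computable₂ h) :
    Computable fun a => (f a).foldl (fun s b => h a (s, b)) (g a) := by
  have hstep : Computable₂ fun (a : α) (p : ℕ × σ) =>
      (Option.casesOn ((f a)[p.1]?) p.2 fun b => h a (p.2, b) : σ) := by
    refine Computable.option_casesOn (o := fun q : α × (ℕ × σ) => (f q.1)[q.2.1]?)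
      (f := fun q => q.2.2) (g := fun q b => h q.1 (q.2.2, b)) ?_ ?_ ?_
    · exact Computable.list_getElem?.comp (hf.comp .fst) (Computable.fst.comp .snd)
    · exact Computable.snd.comp .snd
    · exact hh.comp (Computable.fst.comp .fst)
        ((Computable.snd.comp (Computable.snd.comp .fst)).pair .snd)
  refine (Computable.nat_rec (Computable.list_length.comp hf) hg hstep).of_eq fun a => ?_
  have key : ∀ m ≤ (f a).length, (Nat.rec (g a) (fun i s =>
      (Option.casesOn ((f a)[i]?) s fun b => h a (s, b) : σ)) m : σ) =
      ((f a).take m).foldl (fun s b => h a (s, b)) (g a) := by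
    intro m hm
    induction m with
    | zero => simp
    | succ m ih =>
      have hlt : m < (f a).length := hm
      rw [List.take_succ_eq_append_getElem hlt, List.foldl_append, ← ih hlt.le]
      simp [hlt]
  have := key _ le_rfl
  rw [List.take_length] at this
  exact this

theorem list_flatMap {f : α → List β} {g : α → β → List σ} (hf : Computable f)
    (hg : Computable₂ g) : Computable fun a => (f a).flatMap (g a) := by
  refine (list_foldl (σ := List σ) (g := fun _ => []) (h := fun a p => p.1 ++ g a p.2) hf
    (Computable.const []) ?_).of_eq fun a => ?_
  · exact Computable.list_append.comp (Computable.fst.comp .snd)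
      (hg.comp .fst (Computable.snd.comp .snd))
  · have key : ∀ (l : List β) (s : List σ),
        l.foldl (fun s b => s ++ g a b) s = s ++ l.flatMap (g a) := by
      intro l
      induction l with
      | nil => intro s; simp
      | cons b l ih => intro s; simp [ih]
    exact key _ _

theorem list_map {f : α → List β} {g : α → β → σ} (hf : Computable f)
    (hg : Computable₂ g) : Computable fun a => (f a).map (g a) := by
  refine (list_flatMap (g := fun a b => [g a b]) hf ?_).of_eq fun a => ?_
  · exact Computable.list_cons.comp hg (Computable.const [])
  · induction f a with
    | nil => rfl
    | cons b l ih => simp [ih]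

theorem list_all {f : α → List β} {p : α → β → Bool} (hf : Computable f)
    (hp : Computable₂ p) : Computable fun a => (f a).all (p a) := by
  refine (list_foldl (σ := Bool) (g := fun _ => true) (h := fun a q => q.1 && p a q.2) hf
    (Computable.const true) ?_).of_eq fun a => ?_
  · exact Primrec.and.to_comp.comp (Computable.fst.comp .snd)
      (hp.comp .fst (Computable.snd.comp .snd))
  · have key : ∀ (l : List β) (s : Bool),
        l.foldl (fun s b => s && p a b) s = (s && l.all (p a)) := by
      intro l
      induction l with
      | nil => intro s; simp
      | cons b l ih => intro s; simp [ih, Bool.and_assoc]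
    exact (key _ _).trans (Bool.true_and _)

/-- If every input has a certificate and certificates can be checked, then certificates can be
found by unbounded search. -/
theorem exists_search {P : α → γ → Bool} (hP : Computable₂ P) (h : ∀ a, ∃ c, P a c = true) :
    ∃ g : α → γ, Computable g ∧ ∀ a, P a (g a) = true := by
  -- Each number is decoded to a candidate and tested; the code of an existing certificate shows
  -- that the search ends.
  let F : α → ℕ → Option γ := fun a m =>
    (Encodable.decode m : Option γ).bind fun c => bif P a c then some c else none
  have hF : Computable₂ F := by
    refine Computable.option_bind (Computable.decode.comp .snd) ?_
    refine Computable.cond (hP.comp (Computable.fst.comp .fst) .snd) ?_ (Computable.const none)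
    exact Computable.option_some.comp .snd
  have hFs : ∀ a m c, F a m = some c → P a c = true := by
    intro a m c hc
    obtain ⟨d, -, hd⟩ := Option.bind_eq_some_iff.1 hc
    cases hpd : P a d
    · rw [hpd] at hd; cases hd
    · rw [hpd] at hd
      cases hd
      exact hpd
  have hdom : ∀ a, (Nat.rfindOpt (F a)).Dom := by
    intro a
    obtain ⟨c, hc⟩ := h a
    refine Nat.rfindOpt_dom.2 ⟨Encodable.encode c, c, ?_⟩
    simp [F, Encodable.encodek, hc]
  refine ⟨fun a => (Nat.rfindOpt (F a)).get (hdom a), ?_, fun a => ?_⟩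
  · refine (Partrec.rfindOpt hF).of_eq fun a => ?_
    exact (Part.some_get (hdom a)).symm
  · obtain ⟨m, hm⟩ := Nat.rfindOpt_spec (Part.get_mem (hdom a))
    exact hFs a m _ hm

end Computable

/-! ## Primitive recursive functions of words -/

namespace RSWord

variable {n : ℕ} {α σ : Type*} [Primcodable α] [Primcodable σ]

theorem primrec_mul : Primrec₂ fun u v : FreeMagma (Fin n) => u * v := by
  refine Primrec.encode_iff.1 ?_
  exact Primrec.succ.comp (Primrec.nat_mul.comp (Primrec.const 2)
    (Primrec₂.natPair.comp (Primrec.encode.comp .fst) (Primrec.encode.comp .snd)))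

theorem primrec_of : Primrec fun i : Fin n => FreeMagma.of i := by
  refine Primrec.encode_iff.1 ?_
  exact Primrec.nat_mul.comp (Primrec.const 2) Primrec.fin_val

/-- Functions that are defined by structural recursion on words are primitive recursive. -/
theorem primrec_rec {F : α → FreeMagma (Fin n) → σ} {g : α → Fin n → σ}
    {h : α → (FreeMagma (Fin n) × FreeMagma (Fin n)) × (σ × σ) → σ} (hg : Primrec₂ g)
    (hh : Primrec₂ h) (hof : ∀ a i, F a (.of i) = g a i)
    (hmul : ∀ a u v, F a (u * v) = h a ((u, v), (F a u, F a v))) : Primrec₂ F := by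
  -- Course-of-values recursion on codes: the list holds the values at all smaller codes, so its
  -- length is the current code. The outer decoding only ensures the value `none` at numbers that
  -- code no word.
  let step : α → List (Option σ) → Option (Option σ) := fun a l =>
    some ((Encodable.decode l.length : Option (FreeMagma (Fin n))).bind fun _ =>
      bif l.length % 2 == 0 then (Encodable.decode (l.length / 2) : Option (Fin n)).map (g a)
      else (l[(Nat.unpair (l.length / 2)).1]?.getD none).bind fun s =>
        (l[(Nat.unpair (l.length / 2)).2]?.getD none).bind fun t =>
        (Encodable.decode (Nat.unpair (l.length / 2)).1 : Option (FreeMagma (Fin n))).bind fun u =>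
        (Encodable.decode (Nat.unpair (l.length / 2)).2 : Option (FreeMagma (Fin n))).map fun v =>
          h a ((u, v), (s, t)))
  have hlen : Primrec fun p : α × List (Option σ) => p.2.length :=
    Primrec.list_length.comp Primrec.snd
  have hhalf : Primrec fun p : α × List (Option σ) => p.2.length / 2 :=
    Primrec.nat_div.comp hlen (Primrec.const 2)
  have hun := Primrec.unpair.comp hhalf
  have hstep : Primrec₂ step := by
    refine Primrec.option_some.comp (Primrec.option_bind (Primrec.decode.comp hlen) ?_)
    refine Primrec.cond ?_ ?_ ?_
    · exact (Primrec.beq.comp (Primrec.nat_mod.comp hlen (Primrec.const 2)) (Primrec.const 0)).comp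
        .fst
    · exact Primrec.option_map ((Primrec.decode.comp hhalf).comp .fst)
        (hg.comp (Primrec.fst.comp (Primrec.fst.comp .fst)) .snd)
    · refine Primrec.option_bind ((Primrec.option_getD.comp (Primrec.list_getElem?.comp .snd
        (Primrec.fst.comp hun)) (Primrec.const none)).comp .fst) ?_
      refine Primrec.option_bind ((Primrec.option_getD.comp (Primrec.list_getElem?.comp .snd
        (Primrec.snd.comp hun)) (Primrec.const none)).comp (Primrec.fst.comp .fst)) ?_
      refine Primrec.option_bind ((Primrec.decode.comp (Primrec.fst.comp hun)).comp
        (Primrec.fst.comp (Primrec.fst.comp .fst))) ?_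
      refine Primrec.option_map ((Primrec.decode.comp (Primrec.snd.comp hun)).comp
        (Primrec.fst.comp (Primrec.fst.comp (Primrec.fst.comp .fst)))) ?_
      have e1 : Primrec fun q : (((((α × List (Option σ)) × FreeMagma (Fin n)) × σ) × σ) ×
          FreeMagma (Fin n)) × FreeMagma (Fin n) => q.1.1 := Primrec.fst.comp .fst
      exact hh.comp (Primrec.fst.comp (Primrec.fst.comp (Primrec.fst.comp (Primrec.fst.comp e1))))
        (((Primrec.snd.comp .fst).pair .snd).pair
          ((Primrec.snd.comp (Primrec.fst.comp e1)).pair (Primrec.snd.comp e1)))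
  have key : Primrec₂ fun (a : α) (m : ℕ) =>
      (Encodable.decode m : Option (FreeMagma (Fin n))).map (F a) := by
    refine Primrec.nat_strong_rec _ hstep fun a m => ?_
    simp only [step, List.length_map, List.length_range]
    congr 1
    cases hm : (Encodable.decode m : Option (FreeMagma (Fin n))) with
    | none => rfl
    | some w =>
      have hw : magmaEncode w = m := magmaEncode_of_decode m w hm
      cases w with
      | of i =>
        have h1 : m = 2 * Encodable.encode i := hw.symm
        have h2 : (m % 2 == 0) = true := by simp [h1]
        have h3 : m / 2 = Encodable.encode i := by omega
        rw [Option.bind_some, h2, cond_true, h3, Encodable.encodek]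
        simp [hof]
      | mul u v =>
        have h1 : m = 2 * Nat.pair (Encodable.encode u) (Encodable.encode v) + 1 := hw.symm
        have h2 : (m % 2 == 0) = false := by
          have : m % 2 = 1 := by omega
          simp [this]
        have h3 : m / 2 = Nat.pair (Encodable.encode u) (Encodable.encode v) := by omega
        have h4 : Encodable.encode u < m := by
          have := Nat.left_le_pair (Encodable.encode u) (Encodable.encode v); omega
        have h5 : Encodable.encode v < m := by
          have := Nat.right_le_pair (Encodable.encode u) (Encodable.encode v); omega
        rw [Option.bind_some, h2, cond_false, h3, Nat.unpair_pair]
        simp only [List.getElem?_map, List.getElem?_range h4, List.getElem?_range h5,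
          Option.map_some, Option.getD_some, Encodable.encodek, Option.bind_some]
        exact congrArg some (hmul a u v).symm
  refine Primrec.option_some_iff.1 ((key.comp .fst (Primrec.encode.comp .snd)).of_eq fun p => ?_)
  simp [Encodable.encodek]

theorem primrec_length : Primrec fun u : FreeMagma (Fin n) => u.length := by
  have h : Primrec₂ fun (_ : Unit) (u : FreeMagma (Fin n)) => u.length :=
    primrec_rec (g := fun _ _ => 1) (h := fun _ p => p.2.1 + p.2.2) (Primrec.const 1)
      (Primrec.nat_add.comp (Primrec.fst.comp (Primrec.snd.comp .snd))
        (Primrec.snd.comp (Primrec.snd.comp .snd)))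
      (fun _ _ => rfl) fun _ _ _ => rfl
  exact h.comp (Primrec.const ()) .id

theorem primrec_rankBound (n : ℕ) : Primrec (rankBound n) := by
  refine (Primrec.nat_rec₁ (f := fun _ c => c + c * c) n ?_).of_eq fun d => ?_
  · exact Primrec.nat_add.comp .snd (Primrec.nat_mul.comp .snd .snd)
  · induction d with
    | zero => rfl
    | succ d ih => simp only [rankBound, ← ih]

theorem primrec_rank : Primrec fun u : FreeMagma (Fin n) => rank u := by
  have hb : Primrec fun p : Unit × ((FreeMagma (Fin n) × FreeMagma (Fin n)) × (ℕ × ℕ)) =>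
      rankBound n (p.2.1.1.length + p.2.1.2.length - 2) :=
    (primrec_rankBound n).comp (Primrec.nat_sub.comp (Primrec.nat_add.comp
      (primrec_length.comp (Primrec.fst.comp (Primrec.fst.comp .snd)))
      (primrec_length.comp (Primrec.snd.comp (Primrec.fst.comp .snd)))) (Primrec.const 2))
  have h : Primrec₂ fun (_ : Unit) (u : FreeMagma (Fin n)) => rank u :=
    primrec_rec (g := fun _ i => (i : ℕ))
      (h := fun _ p => rankBound n (p.1.1.length + p.1.2.length - 2) +
        (p.2.1 * rankBound n (p.1.1.length + p.1.2.length - 2) + p.2.2))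
      (Primrec.fin_val.comp .snd)
      (Primrec.nat_add.comp hb (Primrec.nat_add.comp
        (Primrec.nat_mul.comp (Primrec.fst.comp (Primrec.snd.comp .snd)) hb)
        (Primrec.snd.comp (Primrec.snd.comp .snd))))
      (fun _ _ => rfl) fun _ _ _ => rfl
  exact h.comp (Primrec.const ()) .id

/-- The inserted word `v` comes first because it is the parameter of a recursion on `u`. -/
theorem primrec_ins : Primrec₂ fun v u : FreeMagma (Fin n) => ins u v := by
  refine primrec_rec (g := fun v i => .of i * v)
    (h := fun v p => bif decide (rank v < rank p.1.2) then p.2.1 * p.1.2 else p.1.1 * p.1.2 * v)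
    (primrec_mul.comp (primrec_of.comp .snd) .fst) ?_ (fun _ _ => rfl) fun v a b => ?_
  · have h1 : Primrec fun p : FreeMagma (Fin n) × ((FreeMagma (Fin n) × FreeMagma (Fin n)) ×
        (FreeMagma (Fin n) × FreeMagma (Fin n))) => p.2.1.2 :=
      Primrec.snd.comp (Primrec.fst.comp .snd)
    exact Primrec.cond ((Primrec.nat_lt.comp (primrec_rank.comp .fst) (primrec_rank.comp h1)).decide)
      (primrec_mul.comp (Primrec.fst.comp (Primrec.snd.comp .snd)) h1)
      (primrec_mul.comp (primrec_mul.comp (Primrec.fst.comp (Primrec.fst.comp .snd)) h1) .fst)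
  · rw [ins_mul]
    by_cases hv : v < b
    · have h' : rank v < rank b := hv
      simp [hv, h']
    · have h' : ¬ rank v < rank b := hv
      simp [hv, h']

/-- Decision of badness. -/
def badB : FreeMagma (Fin n) → Bool
  | .of _ => false
  | .mul a b => badB a || (badB b || !decide (ins a b = a * b))

theorem badB_iff (u : FreeMagma (Fin n)) : badB u = true ↔ IsBad u := by
  induction u with
  | ih1 i => exact iff_of_false Bool.false_ne_true (not_isBad_of i)
  | ih2 a b ha hb =>
    rw [isBad_mul_iff, ← ha, ← hb]
    change (badB a || (badB b || !decide (ins a b = a * b))) = true ↔ _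
    simp

theorem primrec_badB : Primrec fun u : FreeMagma (Fin n) => badB u := by
  have h : Primrec₂ fun (_ : Unit) (u : FreeMagma (Fin n)) => badB u := by
    refine primrec_rec (g := fun _ _ => false)
      (h := fun _ p => p.2.1 || (p.2.2 || !decide (ins p.1.1 p.1.2 = p.1.1 * p.1.2)))
      (Primrec.const false) ?_ (fun _ _ => rfl) fun _ _ _ => rfl
    have h1 : Primrec fun p : Unit × ((FreeMagma (Fin n) × FreeMagma (Fin n)) × (Bool × Bool)) =>
        p.2.1.1 := Primrec.fst.comp (Primrec.fst.comp .snd)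
    have h2 : Primrec fun p : Unit × ((FreeMagma (Fin n) × FreeMagma (Fin n)) × (Bool × Bool)) =>
        p.2.1.2 := Primrec.snd.comp (Primrec.fst.comp .snd)
    exact Primrec.or.comp (Primrec.fst.comp (Primrec.snd.comp .snd))
      (Primrec.or.comp (Primrec.snd.comp (Primrec.snd.comp .snd))
        (Primrec.not.comp (Primrec.eq.comp (primrec_ins.comp h2 h1) (primrec_mul.comp h1 h2)).decide))
  exact h.comp (Primrec.const ()) .id

theorem primrec_head : Primrec fun u : FreeMagma (Fin n) => head u := by
  have h : Primrec₂ fun (_ : Unit) (u : FreeMagma (Fin n)) => head u :=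
    primrec_rec (g := fun _ i => i) (h := fun _ p => p.2.1) .snd
      (Primrec.fst.comp (Primrec.snd.comp .snd)) (fun _ _ => rfl) fun _ _ _ => rfl
  exact h.comp (Primrec.const ()) .id

theorem primrec_factors : Primrec fun u : FreeMagma (Fin n) => factors u := by
  have h : Primrec₂ fun (_ : Unit) (u : FreeMagma (Fin n)) => factors u :=
    primrec_rec (g := fun _ _ => []) (h := fun _ p => p.1.2 :: p.2.1) (Primrec.const [])
      (Primrec.list_cons.comp (Primrec.snd.comp (Primrec.fst.comp .snd))
        (Primrec.fst.comp (Primrec.snd.comp .snd))) (fun _ _ => rfl) fun _ _ _ => rfl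
  exact h.comp (Primrec.const ()) .id

/-- The number of occurrences of `v` in `l`. -/
def occ (l : List (FreeMagma (Fin n))) (v : FreeMagma (Fin n)) : ℕ :=
  l.foldl (fun s u => bif decide (u = v) then s + 1 else s) 0

theorem occ_eq (l : List (FreeMagma (Fin n))) (v : FreeMagma (Fin n)) : occ l v = l.count v := by
  have key : ∀ s, l.foldl (fun s u => bif decide (u = v) then s + 1 else s) s = s + l.count v := by
    induction l with
    | nil => intro s; simp
    | cons u l ih =>
      intro s
      rw [List.foldl_cons, ih, List.count_cons]
      by_cases h : u = v
      · simp [h]; omega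
      · simp [h]
  exact (key 0).trans (Nat.zero_add _)

theorem primrec_occ : Primrec₂ fun (l : List (FreeMagma (Fin n))) v => occ l v := by
  refine Primrec.list_foldl (f := fun p : List (FreeMagma (Fin n)) × FreeMagma (Fin n) => p.1)
    (g := fun _ => 0) (h := fun p q => bif decide (q.2 = p.2) then q.1 + 1 else q.1)
    Primrec.fst (Primrec.const 0) ?_
  exact Primrec.cond (Primrec.eq.comp (Primrec.snd.comp .snd) (Primrec.snd.comp .fst)).decide
    (Primrec.succ.comp (Primrec.fst.comp .snd)) (Primrec.fst.comp .snd)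

/-- Decision whether `u` is obtained from `w` by adding factors. -/
def rootB (w u : FreeMagma (Fin n)) : Bool :=
  decide (head w = head u) &&
    (factors w).foldl (fun s v => s && decide (occ (factors w) v ≤ occ (factors u) v)) true

/-- Inclusion of multisets has to be tested only at elements of the smaller one. -/
theorem rootB_iff (w u : GoodWord n) : rootB w.1 u.1 = true ↔ ∃ vs, GoodWord.mulList w vs = u := by
  have key : ∀ (l : List (FreeMagma (Fin n))) (P : FreeMagma (Fin n) → Bool) (s : Bool),
      l.foldl (fun s v => s && P v) s = true ↔ s = true ∧ ∀ v ∈ l, P v = true := by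
    intro l P
    induction l with
    | nil => simp
    | cons v l ih => intro s; rw [List.foldl_cons, ih]; simp [and_assoc]
  rw [GoodWord.exists_mulList_iff, rootB, Bool.and_eq_true, key, Multiset.le_iff_count]
  simp only [decide_eq_true_eq, true_and, occ_eq, Multiset.coe_count]
  refine and_congr_right fun _ => ⟨fun h v => ?_, fun h v _ => h v⟩
  by_cases hv : v ∈ factors w.1
  · exact h v hv
  · rw [List.count_eq_zero_of_not_mem hv]; exact Nat.zero_le _

theorem primrec_rootB : Primrec₂ fun w u : FreeMagma (Fin n) => rootB w u := by
  refine Primrec.and.comp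
    (Primrec.eq.comp (primrec_head.comp .fst) (primrec_head.comp .snd)).decide ?_
  refine Primrec.list_foldl (h := fun p q =>
    q.1 && decide (occ (factors p.1) q.2 ≤ occ (factors p.2) q.2))
    (primrec_factors.comp .fst) (Primrec.const true) ?_
  exact Primrec.and.comp (Primrec.fst.comp .snd) (Primrec.nat_le.comp
    (primrec_occ.comp (primrec_factors.comp (Primrec.fst.comp .fst)) (Primrec.snd.comp .snd))
    (primrec_occ.comp (primrec_factors.comp (Primrec.snd.comp .fst)) (Primrec.snd.comp .snd))).decide

/-- Decision of `GoodWord.Red`. -/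
def redB (w : FreeMagma (Fin n)) : FreeMagma (Fin n) → Bool
  | .of i => rootB w (.of i)
  | .mul a b => rootB w (a * b) || (redB w a || redB w b)

/-- The recursion of `redB` is that of `red_mul_iff`, since a good word is the concatenation of its
two factors. -/
theorem redB_iff (w u : GoodWord n) : redB w.1 u.1 = true ↔ GoodWord.Red w u := by
  induction u using GoodWord.induction with
  | of i => exact (rootB_iff w (.of i)).trans GoodWord.red_of_iff.symm
  | mul u v h hu hv =>
    rw [GoodWord.red_mul_iff, ← rootB_iff, ← hu, ← hv, h]
    change (rootB w.1 (u.1 * v.1) || (redB w.1 u.1 || redB w.1 v.1)) = true ↔ _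
    simp

theorem primrec_redB : Primrec₂ fun w u : FreeMagma (Fin n) => redB w u := by
  refine primrec_rec (g := fun w i => rootB w (.of i))
    (h := fun w p => rootB w (p.1.1 * p.1.2) || (p.2.1 || p.2.2))
    (primrec_rootB.comp .fst (primrec_of.comp .snd)) ?_ (fun _ _ => rfl) fun _ _ _ => rfl
  exact Primrec.or.comp (primrec_rootB.comp .fst (primrec_mul.comp
    (Primrec.fst.comp (Primrec.fst.comp .snd)) (Primrec.snd.comp (Primrec.fst.comp .snd))))
    (Primrec.or.comp (Primrec.fst.comp (Primrec.snd.comp .snd))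
      (Primrec.snd.comp (Primrec.snd.comp .snd)))

/-- A list that contains all words of length at most `d`. -/
def wordList (n : ℕ) : ℕ → List (FreeMagma (Fin n))
  | 0 => []
  | d + 1 => (List.finRange n).map .of ++
      (wordList n d).flatMap fun a => (wordList n d).map fun b => a * b

theorem mem_wordList (u : FreeMagma (Fin n)) : ∀ d, u.length ≤ d → u ∈ wordList n d := by
  induction u with
  | ih1 i =>
    intro d hd
    cases d with
    | zero => simp at hd
    | succ d => exact List.mem_append_left _ (List.mem_map_of_mem (List.mem_finRange i))
  | ih2 a b ha hb =>
    intro d hd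
    have h1 := a.length_pos
    have h2 := b.length_pos
    rw [length_mul] at hd
    cases d with
    | zero => omega
    | succ d =>
      exact List.mem_append_right _ (List.mem_flatMap.2 ⟨a, ha d (by omega),
        List.mem_map_of_mem (hb d (by omega))⟩)

theorem primrec_wordList (n : ℕ) : Primrec (wordList n) := by
  refine (Primrec.nat_rec₁ (f := fun _ l => (List.finRange n).map .of ++
    l.flatMap fun a => l.map fun b => a * b) [] ?_).of_eq fun d => ?_
  · refine Primrec.list_append.comp (Primrec.const _) (Primrec.list_flatMap .snd ?_)
    exact Primrec.list_map (Primrec.snd.comp .fst)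
      (primrec_mul.comp (Primrec.snd.comp .fst) .snd)
  · induction d with
    | zero => rfl
    | succ d ih => simp only [wordList, ← ih]

end RSWord

/-! ## Certificates for membership in an ideal -/

instance NAWord.instDecidableEq (n : ℕ) : DecidableEq (NAWord n) :=
  inferInstanceAs (DecidableEq (Option (FreeMagma (Fin n))))

namespace RSExpr

variable {k : Type*} [Field k] {n : ℕ}

/-- The element of the free nonassociative algebra that is presented by a list. -/
noncomputable def raw (l : RSExpr k n) : MonoidAlgebra k (NAWord n) :=
  (l.map fun p => MonoidAlgebra.single p.2 p.1).sum

theorem raw_nil : raw ([] : RSExpr k n) = 0 := rfl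

theorem raw_cons (p : k × NAWord n) (l : RSExpr k n) :
    raw (p :: l) = MonoidAlgebra.single p.2 p.1 + raw l := rfl

theorem raw_append (l l' : RSExpr k n) : raw (l ++ l') = raw l + raw l' := by
  simp [raw]

theorem eval_eq_mk (l : RSExpr k n) : l.eval = FreeRS.mk k n (raw l) := by
  induction l with
  | nil => rw [raw_nil, map_zero]; rfl
  | cons p l ih => rw [raw_cons, map_add, ← ih, FreeRS.mk_single]; rfl

theorem eval_append (l l' : RSExpr k n) : eval (l ++ l') = eval l + eval l' := by
  rw [eval_eq_mk, raw_append, map_add, ← eval_eq_mk, ← eval_eq_mk]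

theorem eval_cons (p : k × NAWord n) (l : RSExpr k n) :
    eval (p :: l) = p.1 • FreeRS.word k p.2 + eval l := rfl

theorem eval_nil : eval ([] : RSExpr k n) = 0 := rfl

/-- The list of the scaled terms. -/
def scale (a : k) (l : RSExpr k n) : RSExpr k n := l.map fun p => (a * p.1, p.2)

theorem eval_scale (a : k) (l : RSExpr k n) : eval (scale a l) = a • eval l := by
  induction l with
  | nil => exact (smul_zero a).symm
  | cons p l ih =>
    rw [eval_cons, smul_add, ← ih, smul_smul]
    rfl

/-- The total coefficient of a word in a list. -/
def coef [DecidableEq k] (l : RSExpr k n) (w : NAWord n) : k :=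
  l.foldl (fun s p => bif decide (p.2 = w) then s + p.1 else s) 0

theorem coef_eq [DecidableEq k] (l : RSExpr k n) (w : NAWord n) : coef l w = (raw l).coeff w := by
  have key : ∀ s, l.foldl (fun s p => bif decide (p.2 = w) then s + p.1 else s) s =
      s + (raw l).coeff w := by
    induction l with
    | nil => intro s; exact (add_zero s).symm
    | cons p l ih =>
      intro s
      rw [List.foldl_cons, ih, raw_cons, MonoidAlgebra.coeff_add, MonoidAlgebra.coeff_single,
        Finsupp.add_apply, Finsupp.single_apply]
      by_cases h : p.2 = w
      · simp [h, add_assoc]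
      · simp [h]
  exact (key 0).trans (zero_add _)

theorem coeff_eq_zero {l : RSExpr k n} {w : NAWord n} (h : ∀ p ∈ l, p.2 ≠ w) :
    (raw l).coeff w = 0 := by
  induction l with
  | nil => rfl
  | cons p l ih =>
    rw [raw_cons, MonoidAlgebra.coeff_add, MonoidAlgebra.coeff_single, Finsupp.add_apply,
      Finsupp.single_eq_of_ne (h p (.head _)).symm, zero_add]
    exact ih fun q hq => h q (.tail _ hq)

/-- Decision whether two lists present the same element of the free nonassociative algebra. -/
def rawEqB [DecidableEq k] (l l' : RSExpr k n) : Bool :=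
  (l ++ l').all fun p => decide (coef l p.2 = coef l' p.2)

/-- A word that occurs in neither list has coefficient zero on both sides, so finitely many
comparisons suffice. -/
theorem rawEqB_iff [DecidableEq k] (l l' : RSExpr k n) : rawEqB l l' = true ↔ raw l = raw l' := by
  rw [rawEqB, List.all_eq_true]
  simp only [decide_eq_true_eq, coef_eq]
  constructor
  · intro h
    refine MonoidAlgebra.coeff_injective (Finsupp.ext fun w => ?_)
    by_cases hw : ∃ p ∈ l ++ l', p.2 = w
    · obtain ⟨p, hp, rfl⟩ := hw
      exact h p hp
    · push Not at hw
      rw [coeff_eq_zero fun p hp => hw p (List.mem_append_left _ hp),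
        coeff_eq_zero fun p hp => hw p (List.mem_append_right _ hp)]
  · intro h p _
    rw [h]

/-- The word that arises from `u` by a sequence of multiplications. -/
def ctxWord (ctx : List (Bool × NAWord n)) (u : NAWord n) : NAWord n :=
  ctx.foldl (fun u p => bif p.1 then u * p.2 else p.2 * u) u

/-- The element that arises from `x` by a sequence of multiplications by words. -/
noncomputable def ctxRaw (ctx : List (Bool × NAWord n)) (x : MonoidAlgebra k (NAWord n)) :
    MonoidAlgebra k (NAWord n) :=
  ctx.foldl (fun x p => bif p.1 then x * MonoidAlgebra.single p.2 1
    else MonoidAlgebra.single p.2 1 * x) x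

theorem ctxRaw_cons (b : Bool) (w : NAWord n) (ctx : List (Bool × NAWord n))
    (x : MonoidAlgebra k (NAWord n)) : ctxRaw ((b, w) :: ctx) x =
      ctxRaw ctx (bif b then x * MonoidAlgebra.single w 1 else MonoidAlgebra.single w 1 * x) := rfl

theorem ctxRaw_zero (ctx : List (Bool × NAWord n)) :
    ctxRaw ctx (0 : MonoidAlgebra k (NAWord n)) = 0 := by
  induction ctx with
  | nil => rfl
  | cons p ctx ih =>
    obtain ⟨b, w⟩ := p
    rw [ctxRaw_cons, mul_zero, zero_mul, Bool.cond_self, ih]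

theorem ctxRaw_add (ctx : List (Bool × NAWord n)) (x y : MonoidAlgebra k (NAWord n)) :
    ctxRaw ctx (x + y) = ctxRaw ctx x + ctxRaw ctx y := by
  induction ctx generalizing x y with
  | nil => rfl
  | cons p ctx ih =>
    obtain ⟨b, w⟩ := p
    rw [ctxRaw_cons, ctxRaw_cons, ctxRaw_cons, ← ih]
    cases b
    · simp only [cond_false, mul_add]
    · simp only [cond_true, add_mul]

theorem ctxRaw_single (ctx : List (Bool × NAWord n)) (u : NAWord n) (a : k) :
    ctxRaw ctx (MonoidAlgebra.single u a) = MonoidAlgebra.single (ctxWord ctx u) a := by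
  induction ctx generalizing u with
  | nil => rfl
  | cons p ctx ih =>
    obtain ⟨b, w⟩ := p
    rw [ctxRaw_cons]
    cases b
    · rw [cond_false, MonoidAlgebra.single_mul_single, one_mul, ih]; rfl
    · rw [cond_true, MonoidAlgebra.single_mul_single, mul_one, ih]; rfl

/-- The generators of the ideal in the free nonassociative algebra: `f` and the instances of the
right-symmetric identity for words. -/
def gen (f : RSExpr k n) (o : Option (NAWord n × NAWord n × NAWord n)) : RSExpr k n :=
  Option.casesOn o f fun t =>
    [(1, t.1 * t.2.1 * t.2.2), (-1, t.1 * (t.2.1 * t.2.2)), (-1, t.1 * t.2.2 * t.2.1),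
      (1, t.1 * (t.2.2 * t.2.1))]

/-- Certificates: lists of coefficients, contexts and generators. -/
abbrev Cert (k : Type*) (n : ℕ) : Type _ :=
  List (k × List (Bool × NAWord n) × Option (NAWord n × NAWord n × NAWord n))

/-- The linear combination that is described by a certificate. -/
def expand (f : RSExpr k n) (c : Cert k n) : RSExpr k n :=
  c.flatMap fun t => (gen f t.2.2).map fun p => (t.1 * p.1, ctxWord t.2.1 p.2)

theorem raw_map_ctx (a : k) (ctx : List (Bool × NAWord n)) (l : RSExpr k n) :
    raw (l.map fun p => (a * p.1, ctxWord ctx p.2)) = a • ctxRaw ctx (raw l) := by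
  induction l with
  | nil => rw [raw_nil, ctxRaw_zero, smul_zero]; rfl
  | cons p l ih =>
    rw [List.map_cons, raw_cons, ih, raw_cons, ctxRaw_add, smul_add, ctxRaw_single,
      MonoidAlgebra.smul_single, smul_eq_mul]

theorem expand_cons (f : RSExpr k n) (t) (c : Cert k n) : raw (expand f (t :: c)) =
    t.1 • ctxRaw t.2.1 (raw (gen f t.2.2)) + raw (expand f c) := by
  rw [expand, List.flatMap_cons, raw_append, raw_map_ctx]
  rfl

theorem raw_expand_append (f : RSExpr k n) (c c' : Cert k n) :
    raw (expand f (c ++ c')) = raw (expand f c) + raw (expand f c') := by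
  rw [expand, List.flatMap_append, raw_append]
  rfl

/-- The span of the multiples of the generators in the free nonassociative algebra. -/
noncomputable def certSpan (f : RSExpr k n) : Submodule k (MonoidAlgebra k (NAWord n)) :=
  Submodule.span k {x | ∃ ctx o, x = ctxRaw ctx (raw (gen f o))}

theorem mem_certSpan_iff {f : RSExpr k n} {x : MonoidAlgebra k (NAWord n)} :
    x ∈ certSpan f ↔ ∃ c, x = raw (expand f c) := by
  constructor
  · intro hx
    induction hx using Submodule.span_induction with
    | mem x hx =>
      obtain ⟨ctx, o, rfl⟩ := hx
      refine ⟨[(1, ctx, o)], ?_⟩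
      rw [expand_cons, one_smul]
      exact (add_zero _).symm
    | zero => exact ⟨[], rfl⟩
    | add x y _ _ h h' =>
      obtain ⟨c, rfl⟩ := h
      obtain ⟨c', rfl⟩ := h'
      exact ⟨c ++ c', (raw_expand_append f c c').symm⟩
    | smul a x hx h =>
      clear hx
      obtain ⟨c, rfl⟩ := h
      refine ⟨c.map fun t => (a * t.1, t.2), ?_⟩
      induction c with
      | nil => exact smul_zero a
      | cons t c ih => rw [List.map_cons, expand_cons, expand_cons, ← ih, smul_add, smul_smul]
  · rintro ⟨c, rfl⟩
    induction c with
    | nil => exact zero_mem _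
    | cons t c ih =>
      rw [expand_cons]
      exact add_mem (Submodule.smul_mem _ _ (Submodule.subset_span ⟨_, _, rfl⟩)) ih

/-- Multiplication by a word appends one entry to the context; linearity does the rest. -/
theorem certSpan_mul {f : RSExpr k n} {x : MonoidAlgebra k (NAWord n)} (hx : x ∈ certSpan f)
    (y : MonoidAlgebra k (NAWord n)) : x * y ∈ certSpan f ∧ y * x ∈ certSpan f := by
  induction y using MonoidAlgebra.induction_linear with
  | zero => rw [mul_zero, zero_mul]; exact ⟨zero_mem _, zero_mem _⟩
  | add y y' h h' => rw [mul_add, add_mul]; exact ⟨add_mem h.1 h'.1, add_mem h.2 h'.2⟩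
  | single w a =>
    have h1 : (MonoidAlgebra.single w a : MonoidAlgebra k (NAWord n)) =
        a • MonoidAlgebra.single w 1 := by
      rw [MonoidAlgebra.smul_single, smul_eq_mul, mul_one]
    rw [h1, mul_smul_comm, smul_mul_assoc]
    suffices h2 : ∀ b : Bool, (bif b then x * MonoidAlgebra.single w 1
        else MonoidAlgebra.single w 1 * x) ∈ certSpan f from
      ⟨Submodule.smul_mem _ _ (h2 true), Submodule.smul_mem _ _ (h2 false)⟩
    intro b
    have h3 : ∀ y : MonoidAlgebra k (NAWord n), (bif b then y * MonoidAlgebra.single w 1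
        else MonoidAlgebra.single w 1 * y) = ctxRaw [(b, w)] y := fun y => rfl
    rw [h3]
    induction hx using Submodule.span_induction with
    | mem x hx =>
      obtain ⟨ctx, o, rfl⟩ := hx
      refine Submodule.subset_span ⟨ctx ++ [(b, w)], o, ?_⟩
      rw [ctxRaw, ctxRaw, ctxRaw, List.foldl_append]
    | zero => rw [ctxRaw_zero]; exact zero_mem _
    | add x y _ _ h h' => rw [ctxRaw_add]; exact add_mem h h'
    | smul a x _ h =>
      have h4 : ctxRaw [(b, w)] (a • x) = a • ctxRaw [(b, w)] x := by
        rw [← h3, ← h3]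
        cases b
        · simp only [cond_false, mul_smul_comm]
        · simp only [cond_true, smul_mul_assoc]
      rw [h4]
      exact Submodule.smul_mem _ _ h

/-- The identity is trilinear, so its instances for words, the only ones among the generators, imply
all others. -/
theorem right_symm_mem_certSpan (f : RSExpr k n) (x y z : MonoidAlgebra k (NAWord n)) :
    x * y * z - x * (y * z) - (x * z * y - x * (z * y)) ∈ certSpan f := by
  induction x using MonoidAlgebra.induction_linear with
  | zero => simp
  | add x x' h h' =>
    have := add_mem h h'
    convert this using 1
    simp only [add_mul]
    abel
  | single u a =>
    induction y using MonoidAlgebra.induction_linear with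
    | zero => simp
    | add y y' h h' =>
      have := add_mem h h'
      convert this using 1
      simp only [add_mul, mul_add]
      abel
    | single v b =>
      induction z using MonoidAlgebra.induction_linear with
      | zero => simp
      | add z z' h h' =>
        have := add_mem h h'
        convert this using 1
        simp only [add_mul, mul_add]
        abel
      | single w c =>
        have h : raw (gen f (some (u, v, w))) ∈ certSpan f :=
          Submodule.subset_span ⟨[], some (u, v, w), rfl⟩
        have h1 := Submodule.smul_mem _ (a * b * c) h
        convert h1 using 1
        simp only [gen, raw_cons, raw_nil, MonoidAlgebra.single_mul_single, smul_add, add_zero,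
          MonoidAlgebra.smul_single, smul_eq_mul]
        simp only [mul_one, mul_neg, MonoidAlgebra.single_neg]
        rw [mul_right_comm a c b, mul_comm c b, mul_assoc a b c]
        abel

/-- The two-sided ideal of the free nonassociative algebra that is generated by `f` and the
right-symmetric identity. -/
noncomputable def certIdeal (f : RSExpr k n) : TwoSidedIdeal (MonoidAlgebra k (NAWord n)) :=
  TwoSidedIdeal.mk' (certSpan f) (zero_mem _) add_mem neg_mem
    (fun h => (certSpan_mul h _).2) fun h => (certSpan_mul h _).1

theorem mem_certIdeal {f : RSExpr k n} {x : MonoidAlgebra k (NAWord n)} :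
    x ∈ certIdeal f ↔ x ∈ certSpan f := by
  rw [certIdeal, TwoSidedIdeal.mem_mk']
  rfl

/-- The congruence of `certIdeal f` contains all instances of the identity, hence also the
congruence that they generate. -/
theorem sub_mem_certSpan {f : RSExpr k n} {x y : MonoidAlgebra k (NAWord n)}
    (h : FreeRS.mk k n x = FreeRS.mk k n y) : x - y ∈ certSpan f := by
  have h1 : rightSymmCon k n ≤ (certIdeal f).ringCon := by
    refine RingCon.ringConGen_le.2 ?_
    rintro _ _ ⟨x, y, z, rfl, rfl⟩
    exact ((certIdeal f).rel_iff _ _).2 (mem_certIdeal.2 (right_symm_mem_certSpan f x y z))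
  exact mem_certIdeal.1 (((certIdeal f).rel_iff _ _).1 (h1 (FreeRS.mk_eq_iff.1 h)))

theorem mk_ctxRaw_mem {I : TwoSidedIdeal (FreeRS k n)} (ctx : List (Bool × NAWord n))
    {x : MonoidAlgebra k (NAWord n)} (hx : FreeRS.mk k n x ∈ I) :
    FreeRS.mk k n (ctxRaw ctx x) ∈ I := by
  induction ctx generalizing x with
  | nil => exact hx
  | cons p ctx ih =>
    obtain ⟨b, w⟩ := p
    rw [ctxRaw_cons]
    refine ih ?_
    cases b
    · rw [cond_false, FreeRS.mk_mul]; exact I.mul_mem_left _ _ hx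
    · rw [cond_true, FreeRS.mk_mul]; exact I.mul_mem_right _ _ hx

theorem mk_gen_mem (f : RSExpr k n) (o : Option (NAWord n × NAWord n × NAWord n)) :
    FreeRS.mk k n (raw (gen f o)) ∈ FreeRS.ideal f.eval := by
  cases o with
  | none =>
    change FreeRS.mk k n (raw f) ∈ _
    rw [← eval_eq_mk]
    exact FreeRS.self_mem_ideal _
  | some t =>
    obtain ⟨u, v, w⟩ := t
    have h := FreeRS.right_symm (FreeRS.word k u) (FreeRS.word k v) (FreeRS.word k w)
    have h1 : FreeRS.mk k n (raw (gen f (some (u, v, w)))) = 0 := by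
      rw [← eval_eq_mk]
      simp only [gen, eval_cons, eval_nil, FreeRS.word_mul]
      linear_combination (norm := module) h
    rw [h1]
    exact zero_mem _

theorem eval_expand_mem (f : RSExpr k n) (c : Cert k n) :
    (expand f c).eval ∈ FreeRS.ideal f.eval := by
  rw [eval_eq_mk (expand f c)]
  induction c with
  | nil => exact zero_mem _
  | cons t c ih =>
    rw [expand_cons, map_add, map_smul]
    exact add_mem (FreeRS.smul_mem_ideal _ (mk_ctxRaw_mem _ (mk_gen_mem f _))) ih

/-- The image of `certSpan f` is an ideal that contains `f`, so the class of `x` has a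
representative in `certSpan f`; it differs from `x` by an element that lies in `certSpan f` as well.
-/
theorem mem_certSpan_of_mk_mem {f : RSExpr k n} {x : MonoidAlgebra k (NAWord n)}
    (h : FreeRS.mk k n x ∈ FreeRS.ideal f.eval) : x ∈ certSpan f := by
  let I : TwoSidedIdeal (FreeRS k n) := TwoSidedIdeal.mk' (FreeRS.mk k n '' (certSpan f))
    ⟨0, zero_mem _, map_zero _⟩
    (by
      rintro _ _ ⟨x, hx, rfl⟩ ⟨y, hy, rfl⟩
      exact ⟨x + y, add_mem hx hy, map_add _ _ _⟩)
    (by rintro _ ⟨x, hx, rfl⟩; exact ⟨-x, neg_mem hx, map_neg _ _⟩)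
    (by
      rintro y _ ⟨x, hx, rfl⟩
      obtain ⟨y, rfl⟩ := FreeRS.mk_surjective y
      exact ⟨y * x, (certSpan_mul hx y).2, FreeRS.mk_mul _ _⟩)
    (by
      rintro _ y ⟨x, hx, rfl⟩
      obtain ⟨y, rfl⟩ := FreeRS.mk_surjective y
      exact ⟨x * y, (certSpan_mul hx y).1, FreeRS.mk_mul _ _⟩)
  have hI : ∀ z, z ∈ I ↔ z ∈ FreeRS.mk k n '' (certSpan f) := fun z =>
    TwoSidedIdeal.mem_mk' _ _ _ _ _ _ z
  obtain ⟨y, hy, hxy⟩ := (hI _).1 (TwoSidedIdeal.mem_span_iff.1 h I (by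
    rintro _ rfl
    refine (hI _).2 ⟨raw f, Submodule.subset_span ⟨[], none, rfl⟩, (eval_eq_mk f).symm⟩))
  rw [← sub_add_cancel x y]
  exact add_mem (sub_mem_certSpan hxy.symm) hy

/-- Congruence modulo `(f)` is witnessed by certificates. -/
theorem sub_mem_ideal_iff {f l l' : RSExpr k n} :
    l.eval - l'.eval ∈ FreeRS.ideal f.eval ↔ ∃ c, raw l = raw (l' ++ expand f c) := by
  constructor
  · intro h
    rw [eval_eq_mk l, eval_eq_mk l', ← map_sub] at h
    obtain ⟨c, hc⟩ := mem_certSpan_iff.1 (mem_certSpan_of_mk_mem h)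
    exact ⟨c, by rw [raw_append, ← hc, add_sub_cancel]⟩
  · rintro ⟨c, hc⟩
    rw [eval_eq_mk l, hc, raw_append, map_add, ← eval_eq_mk, ← eval_eq_mk, add_sub_cancel_left]
    exact eval_expand_mem f c

theorem eval_eq_iff {l l' : RSExpr k n} :
    l.eval = l'.eval ↔ ∃ c, raw l = raw (l' ++ expand [] c) := by
  rw [← sub_mem_ideal_iff, eval_nil, FreeRS.ideal_zero_mem, sub_eq_zero]

end RSExpr

/-! ## Computability of the operations on words -/

namespace NAWord

variable {n : ℕ} {α σ : Type*} [Primcodable α] [Primcodable σ]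

theorem primrec_coe : Primrec fun u : FreeMagma (Fin n) => (u : NAWord n) :=
  (Primrec.option_some : Primrec (some : FreeMagma (Fin n) → Option (FreeMagma (Fin n))))

theorem primrec_recOneCoe {f : α → NAWord n} {g : α → σ} {h : α → FreeMagma (Fin n) → σ}
    (hf : Primrec f) (hg : Primrec g) (hh : Primrec₂ h) :
    Primrec fun a => WithOne.recOneCoe (motive := fun _ => σ) (g a) (h a) (f a) := by
  have hf' : Primrec fun a => (f a : Option (FreeMagma (Fin n))) := hf
  refine (Primrec.option_casesOn hf' hg hh).of_eq fun a => ?_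
  obtain h1 | ⟨u, h1⟩ := eq_one_or_coe (f a)
  · rw [h1]; rfl
  · rw [h1]; rfl

theorem primrec_mul : Primrec₂ fun u v : NAWord n => u * v := by
  refine (primrec_recOneCoe (f := fun p : NAWord n × NAWord n => p.1) (g := fun p => p.2)
    (h := fun p a => WithOne.recOneCoe (motive := fun _ => NAWord n) (a : NAWord n)
      (fun b => ((a * b : FreeMagma (Fin n)) : NAWord n)) p.2) .fst .snd ?_).of_eq fun p => ?_
  · exact primrec_recOneCoe (f := fun q : (NAWord n × NAWord n) × FreeMagma (Fin n) => q.1.2)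
      (g := fun q => (q.2 : NAWord n))
      (h := fun q b => ((q.2 * b : FreeMagma (Fin n)) : NAWord n))
      (Primrec.snd.comp .fst) (primrec_coe.comp .snd)
      (primrec_coe.comp (RSWord.primrec_mul.comp (Primrec.snd.comp .fst) .snd))
  · obtain ⟨u, v⟩ := p
    obtain rfl | ⟨u, rfl⟩ := eq_one_or_coe u
    · exact (one_mul v).symm
    · obtain rfl | ⟨v, rfl⟩ := eq_one_or_coe v
      · exact (mul_one _).symm
      · rfl

theorem primrec_rk : Primrec (rk : NAWord n → ℕ) :=
  primrec_recOneCoe .id (Primrec.const 0) (Primrec.succ.comp (primrec_rank.comp .snd))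

theorem primrec_deg : Primrec (deg : NAWord n → ℕ) :=
  primrec_recOneCoe .id (Primrec.const 0) (primrec_length.comp .snd)

/-- Decision of `NAWord.IsGood`. -/
def goodB (w : NAWord n) : Bool :=
  WithOne.recOneCoe (motive := fun _ => Bool) true (fun u => !badB u) w

theorem goodB_iff (w : NAWord n) : goodB w = true ↔ w.IsGood := by
  obtain rfl | ⟨u, rfl⟩ := eq_one_or_coe w
  · exact iff_of_true rfl isGood_one
  · rw [isGood_coe, ← badB_iff]
    change (!badB u) = true ↔ _
    simp

theorem primrec_goodB : Primrec (goodB : NAWord n → Bool) :=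
  primrec_recOneCoe .id (Primrec.const true) (Primrec.not.comp (primrec_badB.comp .snd))

/-- Decision of membership of good words in `GoodNAWord.redSet`. -/
def redB (v u : NAWord n) : Bool :=
  WithOne.recOneCoe (motive := fun _ => Bool) true (fun a =>
    WithOne.recOneCoe (motive := fun _ => Bool) false (fun b => RSWord.redB a b) u) v

theorem redB_iff (v u : GoodNAWord n) : redB v.1 u.1 = true ↔ u ∈ v.redSet := by
  rcases v.eq_one_or_coe with rfl | ⟨a, rfl⟩
  · exact iff_of_true rfl (Or.inl rfl)
  · rcases u.eq_one_or_coe with rfl | ⟨b, rfl⟩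
    · refine iff_of_false Bool.false_ne_true ?_
      rintro (h | ⟨_, b, -, h, -⟩)
      · exact GoodNAWord.one_ne_coe _ h.symm
      · exact GoodNAWord.one_ne_coe _ h
    · refine (RSWord.redB_iff a b).trans ⟨fun h => Or.inr ⟨a, b, rfl, rfl, h⟩, ?_⟩
      rintro (h | ⟨a', b', h, h', h''⟩)
      · exact absurd h.symm (GoodNAWord.one_ne_coe _)
      · rwa [GoodNAWord.coe_injective h, GoodNAWord.coe_injective h']

theorem primrec_redB : Primrec₂ (redB : NAWord n → NAWord n → Bool) :=
  primrec_recOneCoe (f := fun p : NAWord n × NAWord n => p.1) .fst (Primrec.const true)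
    (primrec_recOneCoe (f := fun q : (NAWord n × NAWord n) × FreeMagma (Fin n) => q.1.2)
      (g := fun _ => false) (h := fun q b => RSWord.redB q.2 b) (Primrec.snd.comp .fst)
      (Primrec.const false) (RSWord.primrec_redB.comp (Primrec.snd.comp .fst) .snd))

/-- A list that contains all words of degree at most `d`. -/
def wordList (n d : ℕ) : List (NAWord n) :=
  1 :: List.map (fun u : FreeMagma (Fin n) => ((u : FreeMagma (Fin n)) : NAWord n)) (RSWord.wordList n d)

theorem mem_wordList {w : NAWord n} {d : ℕ} (h : w.deg ≤ d) : w ∈ wordList n d := by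
  obtain rfl | ⟨u, rfl⟩ := eq_one_or_coe w
  · exact .head _
  · exact .tail _ (List.mem_map_of_mem (RSWord.mem_wordList u d h))

theorem primrec_wordList (n : ℕ) : Primrec (wordList n) :=
  Primrec.list_cons.comp (Primrec.const 1)
    (Primrec.list_map (RSWord.primrec_wordList n) (primrec_coe.comp .snd))

end NAWord

/-! ## Normal forms of expressions -/

namespace RSExpr

variable {k : Type*} [Field k] {n : ℕ}

/-- Whether the list is empty or starts with its leading term, all its words being good. -/
def normalB [DecidableEq k] (l : RSExpr k n) : Bool :=
  Option.casesOn l.head? true fun p => !decide (p.1 = 0) && (NAWord.goodB p.2 &&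
    l.tail.all fun q => NAWord.goodB q.2 && decide (q.2.rk < p.2.rk))

theorem normalB_cons [DecidableEq k] {p : k × NAWord n} {l : RSExpr k n} :
    normalB (p :: l) = true ↔
      p.1 ≠ 0 ∧ p.2.IsGood ∧ ∀ q ∈ l, q.2.IsGood ∧ q.2.rk < p.2.rk := by
  change (!decide (p.1 = 0) && (NAWord.goodB p.2 &&
    l.all fun q => NAWord.goodB q.2 && decide (q.2.rk < p.2.rk))) = true ↔ _
  simp [NAWord.goodB_iff]

theorem eval_mem_low {l : RSExpr k n} {N : ℕ} (h : ∀ q ∈ l, q.2.IsGood ∧ q.2.rk < N) :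
    eval l ∈ FreeRS.low k n N := by
  induction l with
  | nil => exact zero_mem _
  | cons p l ih =>
    rw [eval_cons]
    exact add_mem (Submodule.smul_mem _ _ (FreeRS.word_mem_low (h p (.head _)).1 (h p (.head _)).2))
      (ih fun q hq => h q (.tail _ hq))

theorem eval_cons_sub_mem [DecidableEq k] {p : k × NAWord n} {l : RSExpr k n}
    (h : normalB (p :: l) = true) :
    eval (p :: l) - p.1 • FreeRS.word k p.2 ∈ FreeRS.low k n p.2.rk := by
  rw [eval_cons, add_sub_cancel_left]
  exact eval_mem_low (normalB_cons.1 h).2.2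

theorem exists_eval_eq_of_mem_low {N : ℕ} {x : FreeRS k n} (hx : x ∈ FreeRS.low k n N) :
    ∃ l : RSExpr k n, (∀ q ∈ l, q.2.IsGood ∧ q.2.rk < N) ∧ eval l = x := by
  induction hx using Submodule.span_induction with
  | mem x hx =>
    obtain ⟨w, h1, h2, rfl⟩ := hx
    refine ⟨[(1, w)], by simp [h1, h2], ?_⟩
    rw [eval_cons, one_smul]
    exact add_zero _
  | zero => exact ⟨[], by simp, rfl⟩
  | add x y _ _ h h' =>
    obtain ⟨l, hl, rfl⟩ := h
    obtain ⟨l', hl', rfl⟩ := h'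
    refine ⟨l ++ l', fun q hq => ?_, eval_append l l'⟩
    rcases List.mem_append.1 hq with hq | hq
    · exact hl q hq
    · exact hl' q hq
  | smul a x _ h =>
    obtain ⟨l, hl, rfl⟩ := h
    refine ⟨scale a l, fun q hq => ?_, eval_scale a l⟩
    obtain ⟨p, hp, rfl⟩ := List.mem_map.1 hq
    exact hl p hp

theorem exists_normal_cons [DecidableEq k] {x : FreeRS k n} {c : k} (hc : c ≠ 0) {v : GoodNAWord n}
    (h : x - c • FreeRS.word k v.1 ∈ FreeRS.low k n v.rk) :
    ∃ l : RSExpr k n, normalB ((c, v.1) :: l) = true ∧ eval ((c, v.1) :: l) = x := by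
  obtain ⟨l, hl, hx⟩ := exists_eval_eq_of_mem_low h
  exact ⟨l, normalB_cons.2 ⟨hc, v.2, hl⟩, by rw [eval_cons, hx, add_sub_cancel]⟩

theorem exists_normal [DecidableEq k] (x : FreeRS k n) :
    ∃ l : RSExpr k n, normalB l = true ∧ eval l = x := by
  obtain ⟨N, hN⟩ := FreeRS.exists_mem_low x
  by_cases h0 : x = 0
  · exact ⟨[], rfl, h0.symm⟩
  · obtain ⟨c, v, hc, -, h⟩ := FreeRS.exists_lead hN h0
    obtain ⟨l, hl⟩ := exists_normal_cons hc h
    exact ⟨_, hl⟩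

/-! ### Recognising and counting leading words from a normal form. -/

/-- Decision whether a good word is a leading word of the ideal generated by an element in normal
form. -/
def leadB (l : RSExpr k n) (w : NAWord n) : Bool :=
  Option.casesOn l.head? false fun p => NAWord.redB p.2 w

/-- By `leadSet_eq_redSet`, only the first term of a normal form matters. -/
theorem leadB_iff [DecidableEq k] {l : RSExpr k n} (hl : normalB l = true) (w : GoodNAWord n) :
    leadB l w.1 = true ↔ w ∈ FreeRS.leadSet l.eval := by
  cases l with
  | nil =>
    rw [eval_nil, FreeRS.leadSet_zero]
    exact iff_of_false Bool.false_ne_true id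
  | cons p l =>
    obtain ⟨h1, h2, -⟩ := normalB_cons.1 hl
    rw [FreeRS.leadSet_eq_redSet h1 (v := ⟨p.2, h2⟩) (eval_cons_sub_mem hl)]
    exact NAWord.redB_iff ⟨p.2, h2⟩ w

/-- Decision whether there is a leading word of degree at most `d` and of rank `m`. -/
def hasRankB (l : RSExpr k n) (d m : ℕ) : Bool :=
  !(NAWord.wordList n d).all fun w => !(decide (w.rk = m) && (NAWord.goodB w && leadB l w))

theorem hasRankB_iff [DecidableEq k] {l : RSExpr k n} (hl : normalB l = true) {d m : ℕ} :
    hasRankB l d m = true ↔ ∃ v ∈ FreeRS.leadSet l.eval, v.rk = m ∧ v.1 ∈ NAWord.wordList n d := by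
  rw [hasRankB, Bool.not_eq_true', List.all_eq_false]
  simp only [Bool.not_eq_true, Bool.not_eq_false', Bool.and_eq_true, decide_eq_true_eq,
    NAWord.goodB_iff]
  constructor
  · rintro ⟨w, h1, h2, h3, h4⟩
    exact ⟨⟨w, h3⟩, (leadB_iff hl _).1 h4, h2, h1⟩
  · rintro ⟨v, h1, h2, h3⟩
    exact ⟨v.1, h3, h2, v.2, (leadB_iff hl _).2 h1⟩

/-- The number of leading words of degree at most `d` and of rank less than `N`. -/
def countB (l : RSExpr k n) (d N : ℕ) : ℕ :=
  Nat.rec 0 (fun m c => bif hasRankB l d m then c + 1 else c) N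

/-- Words of smaller rank than `w` have degree at most `w.deg`, so the finite word list misses none
of them. -/
theorem countB_eq [DecidableEq k] {l : RSExpr k n} (hl : normalB l = true) (w : NAWord n) :
    countB l w.deg w.rk = FreeRS.leadCount l.eval w.rk := by
  classical
  have key : ∀ N ≤ w.rk, countB l w.deg N = FreeRS.leadCount l.eval N := by
    intro N hN
    induction N with
    | zero => exact (Nat.count_zero _).symm
    | succ m ih =>
      change (bif hasRankB l w.deg m then countB l w.deg m + 1 else countB l w.deg m) = _
      rw [ih (Nat.le_of_succ_le hN), FreeRS.leadCount, FreeRS.leadCount, Nat.count_succ]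
      have h1 : hasRankB l w.deg m = true ↔ ∃ v ∈ FreeRS.leadSet l.eval, v.rk = m := by
        rw [hasRankB_iff hl]
        refine ⟨fun ⟨v, h1, h2, _⟩ => ⟨v, h1, h2⟩, fun ⟨v, h1, h2⟩ => ⟨v, h1, h2,
          NAWord.mem_wordList (NAWord.deg_le_of_rk_le ?_)⟩⟩
        change v.rk ≤ w.rk
        omega
      by_cases h2 : ∃ v ∈ FreeRS.leadSet l.eval, v.rk = m
      · rw [if_pos h2, h1.2 h2, cond_true]
      · rw [if_neg h2, Bool.eq_false_iff.2 (h1.not.2 h2), cond_false, add_zero]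
  exact key _ le_rfl

/-! ### Computability of the operations on expressions -/

variable [Primcodable k]

theorem computable_coef [DecidableEq k] (hk : IsComputableField k) :
    Computable₂ fun (l : RSExpr k n) (w : NAWord n) => coef l w := by
  refine Computable.list_foldl (f := fun p : RSExpr k n × NAWord n => p.1) (g := fun _ => (0 : k))
    (h := fun p q => bif decide (q.2.2 = p.2) then q.1 + q.2.1 else q.1)
    Computable.fst (Computable.const 0) ?_
  refine Computable.cond ?_ (hk.add.comp (Computable.fst.comp .snd)
    (Computable.fst.comp (Computable.snd.comp .snd))) (Computable.fst.comp .snd)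
  exact (Primrec.eq.comp (Primrec.snd.comp (Primrec.snd.comp .snd))
    (Primrec.snd.comp .fst)).decide.to_comp

theorem computable_rawEqB [DecidableEq k] (hk : IsComputableField k) :
    Computable₂ fun l l' : RSExpr k n => rawEqB l l' := by
  refine Computable.list_all (f := fun p : RSExpr k n × RSExpr k n => p.1 ++ p.2)
    (p := fun p q => decide (coef p.1 q.2 = coef p.2 q.2))
    (Computable.list_append.comp Computable.fst Computable.snd) ?_
  have h := (Primrec.eq (α := k)).decide.to_comp
  exact h.comp ((computable_coef hk).comp (Computable.fst.comp .fst) (Computable.snd.comp .snd))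
    ((computable_coef hk).comp (Computable.snd.comp .fst) (Computable.snd.comp .snd))

theorem primrec_ctxWord :
    Primrec₂ fun (ctx : List (Bool × NAWord n)) (u : NAWord n) => ctxWord ctx u := by
  refine Primrec.list_foldl (f := fun p : List (Bool × NAWord n) × NAWord n => p.1)
    (g := fun p => p.2) (h := fun _ q => bif q.2.1 then q.1 * q.2.2 else q.2.2 * q.1)
    Primrec.fst Primrec.snd ?_
  have h1 : Primrec fun p : (List (Bool × NAWord n) × NAWord n) × (NAWord n × (Bool × NAWord n)) =>
      p.2.1 := Primrec.fst.comp .snd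
  have h2 : Primrec fun p : (List (Bool × NAWord n) × NAWord n) × (NAWord n × (Bool × NAWord n)) =>
      p.2.2.2 := Primrec.snd.comp (Primrec.snd.comp .snd)
  exact Primrec.cond (Primrec.fst.comp (Primrec.snd.comp .snd)) (NAWord.primrec_mul.comp h1 h2)
    (NAWord.primrec_mul.comp h2 h1)

theorem primrec_gen :
    Primrec₂ fun (f : RSExpr k n) (o : Option (NAWord n × NAWord n × NAWord n)) => gen f o := by
  refine Primrec.option_casesOn
    (o := fun p : RSExpr k n × Option (NAWord n × NAWord n × NAWord n) => p.2)
    (f := fun p => p.1) Primrec.snd Primrec.fst ?_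
  have hu : Primrec fun p : (RSExpr k n × Option (NAWord n × NAWord n × NAWord n)) ×
      (NAWord n × NAWord n × NAWord n) => p.2.1 := Primrec.fst.comp .snd
  have hv : Primrec fun p : (RSExpr k n × Option (NAWord n × NAWord n × NAWord n)) ×
      (NAWord n × NAWord n × NAWord n) => p.2.2.1 := Primrec.fst.comp (Primrec.snd.comp .snd)
  have hw : Primrec fun p : (RSExpr k n × Option (NAWord n × NAWord n × NAWord n)) ×
      (NAWord n × NAWord n × NAWord n) => p.2.2.2 := Primrec.snd.comp (Primrec.snd.comp .snd)
  have hm := @NAWord.primrec_mul n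
  exact Primrec.list_cons.comp ((Primrec.const 1).pair (hm.comp (hm.comp hu hv) hw))
    (Primrec.list_cons.comp ((Primrec.const (-1)).pair (hm.comp hu (hm.comp hv hw)))
    (Primrec.list_cons.comp ((Primrec.const (-1)).pair (hm.comp (hm.comp hu hw) hv))
    (Primrec.list_cons.comp ((Primrec.const 1).pair (hm.comp hu (hm.comp hw hv)))
    (Primrec.const []))))

theorem computable_expand (hk : IsComputableField k) :
    Computable₂ fun (f : RSExpr k n) (c : Cert k n) => expand f c := by
  refine Computable.list_flatMap (f := fun p : RSExpr k n × Cert k n => p.2)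
    (g := fun p t => (gen p.1 t.2.2).map fun q => (t.1 * q.1, ctxWord t.2.1 q.2))
    Computable.snd ?_
  refine Computable.list_map (f := fun p : (RSExpr k n × Cert k n) × (k × List (Bool × NAWord n) ×
      Option (NAWord n × NAWord n × NAWord n)) => gen p.1.1 p.2.2.2)
    (g := fun p q => (p.2.1 * q.1, ctxWord p.2.2.1 q.2)) ?_ ?_
  · exact primrec_gen.to_comp.comp (Computable.fst.comp .fst)
      (Computable.snd.comp (Computable.snd.comp .snd))
  · exact (hk.mul.comp (Computable.fst.comp (Computable.snd.comp .fst))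
      (Computable.fst.comp .snd)).pair (primrec_ctxWord.to_comp.comp
        (Computable.fst.comp (Computable.snd.comp (Computable.snd.comp .fst)))
        (Computable.snd.comp .snd))

theorem computable_scale (hk : IsComputableField k) :
    Computable₂ fun (a : k) (l : RSExpr k n) => scale a l :=
  Computable.list_map (f := fun p : k × RSExpr k n => p.2)
    (g := fun p q => (p.1 * q.1, q.2)) Computable.snd
    ((hk.mul.comp (Computable.fst.comp .fst) (Computable.fst.comp .snd)).pair
      (Computable.snd.comp .snd))

theorem computable_leadB {k : Type*} [Primcodable k] :
    Computable₂ fun (l : RSExpr k n) (w : NAWord n) => leadB l w :=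
  (Primrec.option_casesOn (o := fun p : RSExpr k n × NAWord n => p.1.head?)
    (f := fun _ => false) (g := fun p q => NAWord.redB q.2 p.2) (Primrec.list_head?.comp .fst)
    (Primrec.const false) (NAWord.primrec_redB.comp (Primrec.snd.comp .snd)
      (Primrec.snd.comp .fst))).to_comp

theorem computable_normalB [DecidableEq k] : Computable fun l : RSExpr k n => normalB l := by
  have h2 : Computable₂ fun (l : RSExpr k n) (p : k × NAWord n) =>
      !decide (p.1 = 0) && (NAWord.goodB p.2 &&
        l.tail.all fun q => NAWord.goodB q.2 && decide (q.2.rk < p.2.rk)) := by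
    refine Primrec.and.to_comp.comp ?_ (Primrec.and.to_comp.comp
      (NAWord.primrec_goodB.to_comp.comp (Computable.snd.comp .snd)) ?_)
    · exact (Primrec.not.comp (PrimrecPred.decide (Primrec.eq.comp (Primrec.fst.comp .snd)
        (Primrec.const 0)))).to_comp
    · refine Computable.list_all (f := fun p : RSExpr k n × (k × NAWord n) => p.1.tail)
        (p := fun (p : RSExpr k n × (k × NAWord n)) (q : k × NAWord n) =>
          NAWord.goodB q.2 && decide (q.2.rk < p.2.2.rk))
        (Primrec.list_tail.to_comp.comp .fst) ?_
      exact (Primrec.and.comp (NAWord.primrec_goodB.comp (Primrec.snd.comp .snd))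
        (Primrec.nat_lt.comp (NAWord.primrec_rk.comp (Primrec.snd.comp .snd))
          (NAWord.primrec_rk.comp (Primrec.snd.comp (Primrec.snd.comp .fst)))).decide).to_comp
  exact Computable.option_casesOn (o := fun l : RSExpr k n => l.head?) (f := fun _ => true)
    Primrec.list_head?.to_comp (Computable.const true) h2

theorem computable_hasRankB {k : Type*} [Primcodable k] :
    Computable fun p : RSExpr k n × (ℕ × ℕ) => hasRankB p.1 p.2.1 p.2.2 := by
  refine Primrec.not.to_comp.comp (Computable.list_all
    (f := fun p : RSExpr k n × (ℕ × ℕ) => NAWord.wordList n p.2.1)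
    (p := fun p w => !(decide (w.rk = p.2.2) && (NAWord.goodB w && leadB p.1 w)))
    ((NAWord.primrec_wordList n).to_comp.comp (Computable.fst.comp .snd)) ?_)
  refine Primrec.not.to_comp.comp (Primrec.and.to_comp.comp ?_ (Primrec.and.to_comp.comp
    (NAWord.primrec_goodB.to_comp.comp .snd)
    (computable_leadB.comp (Computable.fst.comp .fst) .snd)))
  exact (Primrec.eq.comp (NAWord.primrec_rk.comp .snd)
    (Primrec.snd.comp (Primrec.snd.comp .fst))).decide.to_comp

theorem computable_countB {k : Type*} [Primcodable k] :
    Computable fun p : RSExpr k n × (ℕ × ℕ) => countB p.1 p.2.1 p.2.2 := by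
  have h1 : Computable fun q : (RSExpr k n × (ℕ × ℕ)) × (ℕ × ℕ) =>
      hasRankB q.1.1 q.1.2.1 q.2.1 :=
    computable_hasRankB.comp (g := fun q : (RSExpr k n × (ℕ × ℕ)) × (ℕ × ℕ) =>
      (q.1.1, q.1.2.1, q.2.1)) ((Computable.fst.comp .fst).pair
        ((Computable.fst.comp (Computable.snd.comp .fst)).pair (Computable.fst.comp .snd)))
  have h2 : Computable₂ fun (p : RSExpr k n × (ℕ × ℕ)) (q : ℕ × ℕ) =>
      bif hasRankB p.1 p.2.1 q.1 then q.2 + 1 else q.2 :=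
    Computable.cond h1 (Computable.succ.comp (Computable.snd.comp .snd))
      (Computable.snd.comp .snd)
  exact Computable.nat_rec (f := fun p : RSExpr k n × (ℕ × ℕ) => p.2.2) (g := fun _ => 0)
    (Computable.snd.comp .snd) (Computable.const 0) h2

end RSExpr

/-! ## Remainders and the number of leading words -/

/-- Repeated right multiplication by a letter yields ever longer multiples. -/
theorem GoodNAWord.infinite_redSet {n : ℕ} (i : Fin n) (v : GoodNAWord n) : v.redSet.Infinite := by
  obtain ⟨w, hw⟩ : ∃ w : GoodWord n, ∀ u, GoodWord.Red w u → GoodNAWord.coe u ∈ v.redSet := by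
    rcases v.eq_one_or_coe with rfl | ⟨w, rfl⟩
    · exact ⟨GoodWord.of i, fun _ _ => Or.inl rfl⟩
    · exact ⟨w, fun u hu => Or.inr ⟨w, u, rfl, rfl, hu⟩⟩
  let t : ℕ → GoodWord n := fun m => Nat.rec w (fun _ u => u * GoodWord.of i) m
  have ht : StrictMono t := strictMono_nat_of_lt_succ fun m => GoodWord.lt_mul_right (t m) _
  refine Set.infinite_of_injective_forall_mem (f := fun m => GoodNAWord.coe (t m))
    (GoodNAWord.coe_injective.comp ht.injective) fun m => hw _ ?_
  induction m with
  | zero => exact .self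
  | succ m ih => exact .mul_right _ ih

theorem GoodNAWord.eq_one_of_zero (v : GoodNAWord 0) : v = GoodNAWord.one := by
  rcases v.eq_one_or_coe with rfl | ⟨w, rfl⟩
  · rfl
  · exact (head w.1).elim0

namespace FreeRS

variable {k : Type*} [Field k] {n : ℕ}

theorem leadSet_nonempty {f : FreeRS k n} (hf : f ≠ 0) : (leadSet f).Nonempty := by
  obtain ⟨N, hN⟩ := exists_mem_low f
  obtain ⟨c, v, hc, -, h⟩ := exists_lead hN hf
  exact ⟨v, mem_leadSet (self_mem_ideal f) hc h⟩

/-- Locates the end of the basis: with a letter there are infinitely many leading words, and without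
letters the empty word is the only one. The algorithm can therefore report the end. -/
theorem exists_leadCount_eq_iff {f : FreeRS k n} (hf : f ≠ 0) (i : ℕ) :
    (∃ v ∈ leadSet f, leadCount f v.rk = i) ↔ ¬ (n = 0 ∧ i ≠ 0) := by
  rcases n with - | n
  · obtain ⟨v, hv⟩ := leadSet_nonempty hf
    have h0 : ∀ u : GoodNAWord 0, leadCount f u.rk = 0 := fun u => by
      
      classical
      rw [u.eq_one_of_zero]
      exact Nat.count_zero _
    constructor
    · rintro ⟨u, -, rfl⟩ h
      exact h.2 (h0 u)
    · intro h
      exact ⟨v, hv, by rw [h0]; simpa [eq_comm] using h⟩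
  · refine iff_of_true (exists_leadCount_eq (Or.inl ?_)) fun h => Nat.succ_ne_zero n h.1
    obtain ⟨N, hN⟩ := exists_mem_low f
    obtain ⟨c, v, hc, -, h⟩ := exists_lead hN hf
    rw [leadSet_eq_redSet hc h]
    exact v.infinite_redSet 0

/-- Every element is congruent modulo `(f)` to one whose leading word is not a leading word
of `(f)`. -/
theorem exists_remainder (f x : FreeRS k n) : ∃ y, x - y ∈ ideal f ∧
    ∀ c : k, c ≠ 0 → ∀ v : GoodNAWord n, y - c • word k v.1 ∈ low k n v.rk → v ∉ leadSet f := by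
  obtain ⟨N, hN⟩ := exists_mem_low x
  induction N using Nat.strong_induction_on generalizing x with
  | _ N ih =>
    by_cases h0 : x = 0
    · refine ⟨0, by rw [h0, sub_zero]; exact zero_mem _, fun c hc v h _ => ?_⟩
      have h1 := mem_leadSet (self_mem_ideal (0 : FreeRS k n)) hc h
      rwa [leadSet_zero] at h1
    · obtain ⟨c, v, hc, hvN, h⟩ := exists_lead hN h0
      by_cases hv : v ∈ leadSet f
      · obtain ⟨z, hz, hzv⟩ := hv
        have h1 : x - c • z ∈ low k n v.rk := by
          have h2 := Submodule.sub_mem _ h (Submodule.smul_mem _ c hzv)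
          rwa [smul_sub, sub_sub_sub_cancel_right] at h2
        obtain ⟨y, hy, hyv⟩ := ih _ hvN _ h1
        refine ⟨y, ?_, hyv⟩
        have h3 := add_mem hy (smul_mem_ideal c hz)
        rwa [sub_right_comm, sub_add_cancel] at h3
      · refine ⟨x, by rw [sub_self]; exact zero_mem _, fun d hd u hu => ?_⟩
        rwa [lead_unique hd hc hu h]

end FreeRS

/-! ## Algorithms for one-relator right-symmetric algebras -/

namespace RSExpr

variable {k : Type*} [Field k] {n : ℕ} [DecidableEq k]

/-- Whether `g` and `c` present the `i`-th element of the basis of `(f)` and its certificate, where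
`f₀` is the normal form of `f`. The empty list stands for the end of the basis. -/
def entryB (f₀ f : RSExpr k n) (i : ℕ) (g : RSExpr k n) (c : Cert k n) : Bool :=
  -- The end is accepted only if `f = 0`, or if there are no letters and `i` is not the first index.
  Option.casesOn g.head? (f₀.isEmpty || (decide (n = 0) && !decide (i = 0))) fun p =>
    normalB g && (decide (p.1 = 1) && (leadB f₀ p.2 &&
      (decide (countB f₀ p.2.deg p.2.rk = i) && rawEqB g (expand f c))))

/-- Whether `r` and `c` present a remainder of `h` modulo `(f)` and a certificate, where `f₀` is the
normal form of `f`. -/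
def remainderB (f₀ f h r : RSExpr k n) (c : Cert k n) : Bool :=
  normalB r && ((Option.casesOn r.head? true fun p => !leadB f₀ p.2) &&
    rawEqB h (r ++ expand f c))

theorem eval_ne_zero {p : k × NAWord n} {l : RSExpr k n} (h : normalB (p :: l) = true) :
    eval (p :: l) ≠ 0 := by
  intro h0
  have h1 := FreeRS.mem_leadSet (f := 0) (v := ⟨p.2, (normalB_cons.1 h).2.1⟩)
    (FreeRS.ideal_zero_mem.2 h0) (normalB_cons.1 h).1 (eval_cons_sub_mem h)
  rwa [FreeRS.leadSet_zero] at h1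

theorem isEmpty_iff_eval {l : RSExpr k n} (h : normalB l = true) :
    l.isEmpty = true ↔ l.eval = 0 := by
  cases l with
  | nil => exact iff_of_true rfl rfl
  | cons p l => exact iff_of_false Bool.false_ne_true (eval_ne_zero h)

theorem exists_eq_cons_of_entryB {f₀ f g : RSExpr k n} {i : ℕ} {c : Cert k n}
    (h₀ : normalB f₀ = true) (hf : f₀.eval = f.eval) (h : entryB f₀ f i g c = true)
    (hg : g ≠ []) : ∃ (v : GoodNAWord n) (l : RSExpr k n), g = (1, v.1) :: l ∧
      v ∈ FreeRS.leadSet f.eval ∧ g.eval ∈ FreeRS.ideal f.eval ∧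
      g.eval - FreeRS.word k v.1 ∈ FreeRS.low k n v.rk ∧ FreeRS.leadCount f.eval v.rk = i := by
  obtain - | ⟨⟨a, x⟩, l⟩ := g
  · exact absurd rfl hg
  · change (normalB ((a, x) :: l) && (decide (a = 1) && (leadB f₀ x &&
      (decide (countB f₀ x.deg x.rk = i) && rawEqB ((a, x) :: l) (expand f c))))) = true at h
    simp only [Bool.and_eq_true, decide_eq_true_eq] at h
    obtain ⟨h1, rfl, h3, h4, h5⟩ := h
    have hx := (normalB_cons.1 h1).2.1
    rw [countB_eq h₀, hf] at h4
    have h6 := (leadB_iff h₀ ⟨x, hx⟩).1 h3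
    have h7 := eval_cons_sub_mem h1
    rw [one_smul] at h7
    rw [hf] at h6
    refine ⟨⟨x, hx⟩, l, rfl, h6, ?_, h7, h4⟩
    have h8 : eval ((1, x) :: l) - eval [] ∈ FreeRS.ideal f.eval :=
      sub_mem_ideal_iff.2 ⟨c, (rawEqB_iff _ _).1 h5⟩
    rwa [eval_nil, sub_zero] at h8

/-- The search for a basis element cannot fail: if an `i`-th leading word exists, a monic element
with this leading word has a normal form and a certificate; otherwise the test for the end succeeds.
-/
theorem exists_entryB {f₀ f : RSExpr k n} (h₀ : normalB f₀ = true) (hf : f₀.eval = f.eval) (i : ℕ) :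
    ∃ g c, entryB f₀ f i g c = true := by
  by_cases h : ∃ v ∈ FreeRS.leadSet f.eval, FreeRS.leadCount f.eval v.rk = i
  · obtain ⟨v, hv, hi⟩ := h
    obtain ⟨x, hx, hxv⟩ := id hv
    rw [← one_smul k (FreeRS.word k v.1)] at hxv
    obtain ⟨l, hl, rfl⟩ := exists_normal_cons one_ne_zero hxv
    have hx' : eval ((1, v.1) :: l) - eval [] ∈ FreeRS.ideal f.eval := by
      rwa [eval_nil, sub_zero]
    obtain ⟨c, hc⟩ := sub_mem_ideal_iff.1 hx'
    refine ⟨(1, v.1) :: l, c, ?_⟩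
    have hc' : rawEqB ((1, v.1) :: l) (expand f c) = true := (rawEqB_iff _ _).2 hc
    change (normalB ((1, v.1) :: l) && (decide ((1 : k) = 1) && (leadB f₀ v.1 &&
      (decide (countB f₀ v.1.deg v.1.rk = i) && rawEqB ((1, v.1) :: l) (expand f c))))) = true
    simp only [Bool.and_eq_true, decide_eq_true_eq]
    refine ⟨hl, trivial, (leadB_iff h₀ v).2 (by rw [hf]; exact hv), ?_, hc'⟩
    rw [countB_eq h₀, hf]
    exact hi
  · refine ⟨[], [], ?_⟩
    change (f₀.isEmpty || (decide (n = 0) && !decide (i = 0))) = true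
    rw [Bool.or_eq_true, isEmpty_iff_eval h₀, hf, or_iff_not_imp_left]
    intro h1
    rw [FreeRS.exists_leadCount_eq_iff h1, not_not] at h
    simpa using h

theorem ne_nil_of_entryB {f₀ f g : RSExpr k n} {c : Cert k n} (h₀ : normalB f₀ = true)
    (hf : f₀.eval = f.eval) {v : GoodNAWord n} (hv : v ∈ FreeRS.leadSet f.eval)
    (h : entryB f₀ f (FreeRS.leadCount f.eval v.rk) g c = true) : g ≠ [] := by
  rintro rfl
  have h0 : f.eval ≠ 0 := by
    intro h0
    rw [h0, FreeRS.leadSet_zero] at hv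
    exact hv
  change (f₀.isEmpty || (decide (n = 0) && !decide (FreeRS.leadCount f.eval v.rk = 0))) = true at h
  rw [Bool.or_eq_true, isEmpty_iff_eval h₀, hf, or_iff_right h0] at h
  exact (FreeRS.exists_leadCount_eq_iff h0 _).1 ⟨v, hv, rfl⟩ (by simpa using h)

theorem exists_remainderB {f₀ f : RSExpr k n} (h₀ : normalB f₀ = true) (hf : f₀.eval = f.eval)
    (h : RSExpr k n) : ∃ r c, remainderB f₀ f h r c = true := by
  obtain ⟨y, hy, hyl⟩ := FreeRS.exists_remainder f.eval h.eval
  obtain ⟨r, hr, rfl⟩ := exists_normal y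
  obtain ⟨c, hc⟩ := sub_mem_ideal_iff.1 hy
  refine ⟨r, c, ?_⟩
  rw [remainderB, hr, (rawEqB_iff _ _).2 hc, Bool.true_and, Bool.and_true]
  cases r with
  | nil => rfl
  | cons p r =>
    have h1 := hyl p.1 (normalB_cons.1 hr).1 ⟨p.2, (normalB_cons.1 hr).2.1⟩ (eval_cons_sub_mem hr)
    change (!leadB f₀ p.2) = true
    rw [Bool.not_eq_true', ← Bool.not_eq_true, leadB_iff h₀ ⟨p.2, (normalB_cons.1 hr).2.1⟩, hf]
    exact h1

/-- If `h` lies in the ideal, so does the remainder; a nonzero remainder would then have a leading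
word of the ideal, which its test excludes. -/
theorem isEmpty_iff_mem_ideal {f₀ f h r : RSExpr k n} {c : Cert k n} (h₀ : normalB f₀ = true)
    (hf : f₀.eval = f.eval) (hr : remainderB f₀ f h r c = true) :
    r.isEmpty = true ↔ h.eval ∈ FreeRS.ideal f.eval := by
  simp only [remainderB, Bool.and_eq_true] at hr
  obtain ⟨h1, h2, h3⟩ := hr
  have h4 : h.eval - r.eval ∈ FreeRS.ideal f.eval :=
    sub_mem_ideal_iff.2 ⟨c, (rawEqB_iff _ _).1 h3⟩
  cases r with
  | nil =>
    rw [eval_nil, sub_zero] at h4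
    exact iff_of_true rfl h4
  | cons p r =>
    refine iff_of_false Bool.false_ne_true fun h5 => ?_
    have h6 := sub_mem h5 h4
    rw [sub_sub_cancel] at h6
    change (!leadB f₀ p.2) = true at h2
    rw [Bool.not_eq_true', ← Bool.not_eq_true, leadB_iff h₀ ⟨p.2, (normalB_cons.1 h1).2.1⟩,
      hf] at h2
    exact h2 (FreeRS.mem_leadSet h6 (normalB_cons.1 h1).1 (eval_cons_sub_mem h1))

variable [Primcodable k]

theorem primrec_isEmpty {α : Type*} [Primcodable α] : Primrec (List.isEmpty : List α → Bool) :=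
  (Primrec.not.comp (Primrec.option_isSome.comp Primrec.list_head?)).of_eq fun l => by
    cases l <;> rfl

/-- A normal form exists and its equality with `f` has a certificate, so search replaces an explicit
rewriting procedure. -/
theorem exists_computable_normal (hk : IsComputableField k) : ∃ N : RSExpr k n → RSExpr k n,
    Computable N ∧ ∀ f, normalB (N f) = true ∧ (N f).eval = f.eval := by
  obtain ⟨F, hF, h⟩ := Computable.exists_search (α := RSExpr k n) (γ := RSExpr k n × Cert k n)
    (P := fun f q => normalB q.1 && rawEqB f (q.1 ++ expand [] q.2))
    (Primrec.and.to_comp.comp (computable_normalB.comp (Computable.fst.comp .snd))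
      ((computable_rawEqB hk).comp .fst (Computable.list_append.comp (Computable.fst.comp .snd)
        ((computable_expand hk).comp (Computable.const []) (Computable.snd.comp .snd))))) fun f => by
      obtain ⟨l, hl, h⟩ := exists_normal f.eval
      obtain ⟨c, hc⟩ := eval_eq_iff.1 h.symm
      exact ⟨(l, c), Bool.and_eq_true_iff.2 ⟨hl, (rawEqB_iff _ _).2 hc⟩⟩
  refine ⟨fun f => (F f).1, Computable.fst.comp hF, fun f => ?_⟩
  have h1 := Bool.and_eq_true_iff.1 (h f)
  exact ⟨h1.1, (eval_eq_iff.2 ⟨(F f).2, (rawEqB_iff _ _).1 h1.2⟩).symm⟩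

theorem computable_entryB (hk : IsComputableField k) {N : RSExpr k n → RSExpr k n}
    (hN : Computable N) : Computable₂ fun (a : RSExpr k n × ℕ) (q : RSExpr k n × Cert k n) =>
      entryB (N a.1) a.1 a.2 q.1 q.2 := by
  have hN' : Computable fun s : (RSExpr k n × ℕ) × (RSExpr k n × Cert k n) => N s.1.1 :=
    hN.comp (Computable.fst.comp .fst)
  have h0 : Computable fun s : (RSExpr k n × ℕ) × (RSExpr k n × Cert k n) =>
      (N s.1.1).isEmpty || (decide (n = 0) && !decide (s.1.2 = 0)) := by
    refine Primrec.or.to_comp.comp ?_ (Primrec.and.to_comp.comp (Computable.const _) ?_)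
    · exact primrec_isEmpty.to_comp.comp hN'
    · exact (Primrec.not.comp (Primrec.eq.comp (Primrec.snd.comp .fst)
        (Primrec.const 0)).decide).to_comp
  have hx : Computable fun t : ((RSExpr k n × ℕ) × (RSExpr k n × Cert k n)) × (k × NAWord n) =>
      t.2.2 := Computable.snd.comp .snd
  have hg : Computable fun t : ((RSExpr k n × ℕ) × (RSExpr k n × Cert k n)) × (k × NAWord n) =>
      t.1.2.1 := Computable.fst.comp (Computable.snd.comp .fst)
  have hn : Computable fun t : ((RSExpr k n × ℕ) × (RSExpr k n × Cert k n)) × (k × NAWord n) =>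
      N t.1.1.1 := hN'.comp .fst
  have h1 : Computable fun t : ((RSExpr k n × ℕ) × (RSExpr k n × Cert k n)) × (k × NAWord n) =>
      decide (t.2.1 = 1) :=
    (Primrec.eq.comp (Primrec.fst.comp .snd) (Primrec.const 1)).decide.to_comp
  have h2 : Computable fun t : ((RSExpr k n × ℕ) × (RSExpr k n × Cert k n)) × (k × NAWord n) =>
      countB (N t.1.1.1) t.2.2.deg t.2.2.rk :=
    computable_countB.comp (g := fun t : ((RSExpr k n × ℕ) × (RSExpr k n × Cert k n)) ×
      (k × NAWord n) => (N t.1.1.1, t.2.2.deg, t.2.2.rk))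
      (hn.pair ((NAWord.primrec_deg.to_comp.comp hx).pair (NAWord.primrec_rk.to_comp.comp hx)))
  have h3 : Computable fun t : ((RSExpr k n × ℕ) × (RSExpr k n × Cert k n)) × (k × NAWord n) =>
      decide (countB (N t.1.1.1) t.2.2.deg t.2.2.rk = t.1.1.2) :=
    (Primrec.eq (α := ℕ)).decide.to_comp.comp h2 (Computable.snd.comp (Computable.fst.comp .fst))
  have h4 : Computable fun t : ((RSExpr k n × ℕ) × (RSExpr k n × Cert k n)) × (k × NAWord n) =>
      rawEqB t.1.2.1 (expand t.1.1.1 t.1.2.2) :=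
    (computable_rawEqB hk).comp hg ((computable_expand hk).comp
      (Computable.fst.comp (Computable.fst.comp .fst))
      (Computable.snd.comp (Computable.snd.comp .fst)))
  exact Computable.option_casesOn (Primrec.list_head?.to_comp.comp (Computable.fst.comp .snd)) h0
    (Primrec.and.to_comp.comp (computable_normalB.comp hg) (Primrec.and.to_comp.comp h1
      (Primrec.and.to_comp.comp (computable_leadB.comp hn hx) (Primrec.and.to_comp.comp h3 h4))))

/-- The entries are found by independent searches. They fit together because `f` and `i` determine
the leading word of the `i`-th entry, and any monic element of the ideal with this leading word will
do. -/
theorem exists_computable_leadingBasis (hk : IsComputableField k) :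
    ∃ E : RSExpr k n → ℕ → Option (RSExpr k n × NAWord n), Computable₂ E ∧
      ∀ f : RSExpr k n, FreeRS.IsLeadingBasis f.eval
        fun i => (E f i).map fun p => (p.1.eval, p.2) := by
  obtain ⟨N, hN, hNf⟩ := exists_computable_normal (n := n) hk
  obtain ⟨G, hG, h⟩ := Computable.exists_search (computable_entryB hk hN) fun a => by
    obtain ⟨g, c, h⟩ := exists_entryB (hNf a.1).1 (hNf a.1).2 a.2
    exact ⟨(g, c), h⟩
  refine ⟨fun f i => (G (f, i)).1.head?.map fun p => ((G (f, i)).1, p.2), ?_, fun f => ?_⟩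
  · have h1 : Computable fun a : RSExpr k n × ℕ => (G a).1 := Computable.fst.comp hG
    exact Computable.option_map (Primrec.list_head?.to_comp.comp h1)
      ((h1.comp .fst).pair (Computable.snd.comp .snd))
  · refine FreeRS.isLeadingBasis_of_enumeration (fun i g w hi => ?_) fun v hv => ?_
    · by_cases hg : (G (f, i)).1 = []
      · simp [hg] at hi
      · obtain ⟨v, l, h1, h2, h3, h4, h5⟩ :=
          exists_eq_cons_of_entryB (hNf f).1 (hNf f).2 (h (f, i)) hg
        simp only [h1, List.head?_cons, Option.map_some, Option.some.injEq, Prod.mk.injEq] at hi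
        rw [← h1] at hi
        obtain ⟨rfl, rfl⟩ := hi
        exact ⟨v, h2, rfl, h3, h4, h5⟩
    · have h0 := h (f, FreeRS.leadCount f.eval v.rk)
      obtain ⟨u, l, h1, h2, -, -, h5⟩ := exists_eq_cons_of_entryB (hNf f).1 (hNf f).2 h0
        (ne_nil_of_entryB (hNf f).1 (hNf f).2 hv h0)
      obtain rfl := FreeRS.leadCount_injOn h2 hv h5
      exact ⟨eval ((1, u.1) :: l), by
        simp only [h1, List.head?_cons, Option.map_some]⟩

/-- Membership in the ideal that is generated by one element is decidable. -/
theorem exists_computable_mem_ideal (hk : IsComputableField k) :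
    ∃ D : RSExpr k n × RSExpr k n → Bool, Computable D ∧
      ∀ p, D p = true ↔ p.2.eval ∈ FreeRS.ideal p.1.eval := by
  obtain ⟨N, hN, hNf⟩ := exists_computable_normal (n := n) hk
  have hc : Computable₂ fun (a : RSExpr k n × RSExpr k n) (q : RSExpr k n × Cert k n) =>
      remainderB (N a.1) a.1 a.2 q.1 q.2 := by
    have hr : Computable fun s : (RSExpr k n × RSExpr k n) × (RSExpr k n × Cert k n) => s.2.1 :=
      Computable.fst.comp .snd
    have h1 : Computable fun t : ((RSExpr k n × RSExpr k n) × (RSExpr k n × Cert k n)) ×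
        (k × NAWord n) => !leadB (N t.1.1.1) t.2.2 :=
      Primrec.not.to_comp.comp (computable_leadB.comp
        (hN.comp (Computable.fst.comp (Computable.fst.comp .fst))) (Computable.snd.comp .snd))
    exact Primrec.and.to_comp.comp (computable_normalB.comp hr) (Primrec.and.to_comp.comp
      (Computable.option_casesOn (Primrec.list_head?.to_comp.comp hr) (Computable.const true) h1)
      ((computable_rawEqB hk).comp (Computable.snd.comp .fst) (Computable.list_append.comp hr
        ((computable_expand hk).comp (Computable.fst.comp .fst) (Computable.snd.comp .snd)))))
  obtain ⟨R, hR, h⟩ := Computable.exists_search hc fun a => by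
    obtain ⟨r, c, h⟩ := exists_remainderB (hNf a.1).1 (hNf a.1).2 a.2
    exact ⟨(r, c), h⟩
  exact ⟨fun p => (R p).1.isEmpty, primrec_isEmpty.to_comp.comp (Computable.fst.comp hR),
    fun p => isEmpty_iff_mem_ideal (hNf p.1).1 (hNf p.1).2 (h p)⟩

end RSExpr

theorem ComputablePred.of_bool {α : Type*} [Primcodable α] {p : α → Prop} {D : α → Bool}
    (hD : Computable D) (h : ∀ a, D a = true ↔ p a) : ComputablePred p :=
  ComputablePred.computable_iff.2 ⟨D, hD, funext fun a => propext (h a).symm⟩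

theorem FreeRS.coe_oneRelator_eq_iff {k : Type*} [Field k] {n : ℕ} {f x y : FreeRS k n} :
    (x : OneRelator f) = (y : OneRelator f) ↔ x - y ∈ ideal f := by
  rw [RingCon.eq, TwoSidedIdeal.rel_iff]

theorem mainTheorem2 (k : Type*) [Field k] (n : ℕ) :
    (∀ f : FreeRS k n, ∃ e : ℕ → Option (FreeRS k n × NAWord n), FreeRS.IsLeadingBasis f e) ∧
    (∀ [Primcodable k], IsComputableField k →
      (∃ E : RSExpr k n → ℕ → Option (RSExpr k n × NAWord n), Computable₂ E ∧
        ∀ f : RSExpr k n, FreeRS.IsLeadingBasis f.eval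
          fun i => (E f i).map fun p => (p.1.eval, p.2)) ∧
      ComputablePred (fun p : RSExpr k n × RSExpr k n => p.2.eval ∈ FreeRS.ideal p.1.eval) ∧
      ComputablePred (fun p : RSExpr k n × RSExpr k n × RSExpr k n =>
        (p.2.1.eval : FreeRS.OneRelator p.1.eval) = (p.2.2.eval : FreeRS.OneRelator p.1.eval))) := by
  -- Decidable equality only serves to write Boolean tests; their computability comes from comparing
  -- codes, not from this instance.
  classical
  refine ⟨FreeRS.exists_isLeadingBasis, fun hk => ⟨RSExpr.exists_computable_leadingBasis hk, ?_⟩⟩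
  obtain ⟨D, hD, h⟩ := RSExpr.exists_computable_mem_ideal (n := n) hk
  -- The difference of two elements is presented by appending the second list with its coefficients
  -- negated, which reduces the word problem to membership.
  refine ⟨.of_bool hD h, .of_bool (D := fun p => D (p.1, p.2.1 ++ RSExpr.scale (-1) p.2.2)) ?_
    fun p => ?_⟩
  · exact hD.comp (Computable.fst.pair (Computable.list_append.comp (Computable.fst.comp .snd)
      ((RSExpr.computable_scale hk).comp (Computable.const (-1)) (Computable.snd.comp .snd))))
  · rw [h, FreeRS.coe_oneRelator_eq_iff, RSExpr.eval_append, RSExpr.eval_scale,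
      show p.2.1.eval + (-1 : k) • p.2.2.eval = p.2.1.eval - p.2.2.eval by module]
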